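/- Let $\Omega\subset\mathbb R^3$ be a bounded, connected Lipschitz domain with surface measure $\sigma$ on $\partial\Omega$, and let $\Gamma=\Gamma_D$ and $\Gamma_N$ be disjoint, nonempty, relatively open subsets of $\partial\Omega$ such that $\partial\Omega\setminus(\Gamma_D\cup\Gamma_N)$ has $\sigma$-measure zero. Denote by $\mu_1\le\mu_2\le\dots$ the eigenvalues, counted with multiplicities, of the Neumann Laplacian in $L^2(\Omega)$, and by $\lambda_1^\Gamma\le\lambda_2^\Gamma\le\dots$ the eigenvalues, counted with multiplicities, of the mixed Laplacian $$-\Delta_\Gamma u=-\Delta u,\qquad \operatorname{dom}(-\Delta_\Gamma)=\{u\in H^1(\Omega): u|_{\Gamma_D}=0,\ \Delta u\in L^2(\Omega),\ \partial_\nu u|_{\Gamma_N}=0\},$$ where $u|_{\Gamma_D}=0$ is meant in the sense of traces and $\partial_\nu u|_{\Gamma_N}=0$ means that $\int_\Omega\nabla u\cdot\overline{\nabla v}\,dx+\int_\Omega\Delta u\,\overline v\,dx=0$ for all $v\in H^1(\Omega)$ with $v|_{\partial\Omega\setminus\overline{\Gamma_N}}=0$. (Both operators are selfadjoint, nonnegative,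 with purely discrete spectrum.) A plane part of $\partial\Omega$ is a subset of $\partial\Omega$ that is contained in a plane and is not of $\sigma$-measure zero; two plane parts are parallel if they lie in parallel (possibly equal) planes. Let $\Sigma\subset\partial\Omega$ be the union of two plane parts of $\partial\Omega$ and all plane parts of $\partial\Omega$ that are parallel to one of these two. If $\Gamma_N\subset\Sigma$, then $$\mu_{k+1}\le\lambda_k^\Gamma\qquad\text{for all } k\in\mathbb N=\{1,2,\dots\}.$$ -/

import Mathlib

open MeasureTheory Filter Topology
open scoped ContDiff NNReal

/-- Euclidean three-space. -/
abbrev E3 : Type := EuclideanSpace ℝ (Fin 3)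

/-- The complex Hilbert space `L²(Ω)` with respect to Lebesgue measure. -/
abbrev L2 (Ω : Set E3) : Type := Lp ℂ 2 ((volume : Measure E3).restrict Ω)

/-- The surface measure on `∂Ω`, as two-dimensional Hausdorff measure (Mathlib's normalization
differs from the usual one by a positive constant factor, which does not affect null sets or
convergence in `L²(∂Ω)`). -/
noncomputable def surfaceMeasure (Ω : Set E3) : Measure E3 :=
  (Measure.hausdorffMeasure 2 : Measure E3).restrict (frontier Ω)

/-- A bounded, connected Lipschitz domain in `ℝ³`: near each boundary point, after an orthogonal
change of coordinates, `Ω` is the set of points strictly below the graph of a Lipschitz function of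
the first two coordinates. -/
structure IsBoundedLipschitzDomain (Ω : Set E3) : Prop where
  isOpen : IsOpen Ω
  isBounded : Bornology.IsBounded Ω
  isConnected : IsConnected Ω
  isLipschitz : ∀ p ∈ frontier Ω,
    ∃ (T : E3 ≃ₗᵢ[ℝ] E3) (h : EuclideanSpace ℝ (Fin 2) → ℝ) (K : ℝ≥0) (U : Set E3),
      LipschitzWith K h ∧ IsOpen U ∧ p ∈ U ∧
        ∀ x ∈ U, (x ∈ Ω ↔ T x 2 < h !₂[T x 0, T x 1])

/-- The classical partial derivative `∂ⱼ φ`. -/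
noncomputable def partialDeriv (j : Fin 3) (φ : E3 → ℂ) (x : E3) : ℂ :=
  fderiv ℝ φ x (EuclideanSpace.single j 1)

/-- `φ` is a test function on `Ω`, that is, `φ ∈ C_c^∞(Ω)`. -/
structure IsTestFunction (Ω : Set E3) (φ : E3 → ℂ) : Prop where
  contDiff : ContDiff ℝ ∞ φ
  hasCompactSupport : HasCompactSupport φ
  tsupport_subset : tsupport φ ⊆ Ω

/-- `G = (G₀, G₁, G₂) ∈ L²(Ω)³` is the weak (distributional) gradient of `u ∈ L²(Ω)`. -/
def HasWeakGradient (Ω : Set E3) (u : L2 Ω) (G : Fin 3 → L2 Ω) : Prop :=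
  ∀ φ : E3 → ℂ, IsTestFunction Ω φ → ∀ j : Fin 3,
    ∫ x in Ω, u x * partialDeriv j φ x = -∫ x in Ω, G j x * φ x

/-- `u ∈ H¹(Ω)`. -/
def MemH1 (Ω : Set E3) (u : L2 Ω) : Prop :=
  ∃ G : Fin 3 → L2 Ω, HasWeakGradient Ω u G

/-- `g ∈ L²(∂Ω)` is the trace of `u ∈ H¹(Ω)`: there are functions `φ n`, smooth up to the boundary,
which converge to `u` in `H¹(Ω)` and whose boundary values converge to `g` in `L²(∂Ω)`. -/
def HasTrace (Ω : Set E3) (u : L2 Ω) (g : Lp ℂ 2 (surfaceMeasure Ω)) : Prop :=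
  ∃ G : Fin 3 → L2 Ω, HasWeakGradient Ω u G ∧
    ∃ φ : ℕ → E3 → ℂ, (∀ n, ContDiff ℝ ∞ (φ n)) ∧
      Tendsto (fun n => eLpNorm (fun x => φ n x - u x) 2 (volume.restrict Ω)) atTop (𝓝 0) ∧
      (∀ j, Tendsto (fun n => eLpNorm (fun x => partialDeriv j (φ n) x - G j x) 2
        (volume.restrict Ω)) atTop (𝓝 0)) ∧
      Tendsto (fun n => eLpNorm (fun x => φ n x - g x) 2 (surfaceMeasure Ω)) atTop (𝓝 0)

/-- `u ∈ H¹(Ω)` and the trace of `u` vanishes almost everywhere on `Γ ⊆ ∂Ω`; for relatively open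
`Γ` this says `u ∈ H¹_{0,Γ}(Ω)`. -/
def MemH1Zero (Ω Γ : Set E3) (u : L2 Ω) : Prop :=
  ∃ g : Lp ℂ 2 (surfaceMeasure Ω), HasTrace Ω u g ∧ ∀ᵐ x ∂(surfaceMeasure Ω), x ∈ Γ → g x = 0

/-- `-Δ u = f` on `Ω` in the sense of distributions. -/
def HasWeakNegLaplacian (Ω : Set E3) (u f : L2 Ω) : Prop :=
  ∀ φ : E3 → ℂ, IsTestFunction Ω φ →
    ∫ x in Ω, u x * Laplacian.laplacian φ x = -∫ x in Ω, f x * φ x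

/-- For `u, v ∈ H¹(Ω)` with `-Δ u = f ∈ L²(Ω)`: the boundary pairing of the normal derivative of
`u` with the trace of `v`, which by Green's identity equals
`∫ ∇u · conj ∇v - ∫ f conj v`, is zero. (Mathlib's inner product is conjugate linear in its first
argument.) -/
def NormalDerivPairingZero (Ω : Set E3) (u f v : L2 Ω) : Prop :=
  ∀ G F : Fin 3 → L2 Ω, HasWeakGradient Ω u G → HasWeakGradient Ω v F →
    ∑ j, inner ℂ (F j) (G j) - inner ℂ v f = 0

/-- The graph of the mixed Laplacian `-Δ_Γ` in `L²(Ω)`: `u ∈ dom (-Δ_Γ)` and `-Δ_Γ u = f`. The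
domain consists of all `u ∈ H¹_{0,Γ_D}(Ω)` with `Δ u ∈ L²(Ω)` whose normal derivative vanishes on
`Γ_N`, that is, whose normal derivative pairs to zero with every `v ∈ H¹(Ω)` whose trace vanishes
on the complement of the closure of `Γ_N` in `∂Ω`. -/
structure MixedLaplacian (Ω ΓD ΓN : Set E3) (u f : L2 Ω) : Prop where
  dirichlet : MemH1Zero Ω ΓD u
  laplacian : HasWeakNegLaplacian Ω u f
  neumann : ∀ v : L2 Ω, MemH1Zero Ω (frontier Ω \ closure ΓN) v → NormalDerivPairingZero Ω u f v

/-- The graph of the Neumann Laplacian in `L²(Ω)`: `u ∈ H¹(Ω)`, `-Δ u = f ∈ L²(Ω)`, and the normal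
derivative of `u` vanishes on all of `∂Ω`. -/
structure NeumannLaplacian (Ω : Set E3) (u f : L2 Ω) : Prop where
  memH1 : MemH1 Ω u
  laplacian : HasWeakNegLaplacian Ω u f
  neumann : ∀ v : L2 Ω, MemH1 Ω v → NormalDerivPairingZero Ω u f v

/-- The linear span of all eigenfunctions of the operator with graph `A` that belong to eigenvalues
`s ≤ t`. For a symmetric operator its dimension is the number of eigenvalues not exceeding `t`,
counted with multiplicities. -/
noncomputable def spectralSpan {Ω : Set E3} (A : L2 Ω → L2 Ω → Prop) (t : ℝ) : Submodule ℂ (L2 Ω) :=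
  Submodule.span ℂ {u | ∃ s : ℝ, s ≤ t ∧ A u ((s : ℂ) • u)}

/-- `l` is the `k`-th eigenvalue (`k = 1, 2, …`) of the operator with graph `A`, the eigenvalues
being ordered nondecreasingly and counted with multiplicities: `l` is the smallest real number such
that at least `k` eigenvalues, counted with multiplicities, do not exceed it. There is at most one
such `l`. -/
def IsKthEigenvalue {Ω : Set E3} (A : L2 Ω → L2 Ω → Prop) (k : ℕ) (l : ℝ) : Prop :=
  IsLeast {t : ℝ | (k : Cardinal) ≤ Module.rank ℂ (spectralSpan A t)} l

/-- `Γ` is a relatively open subset of `∂Ω`. -/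
def IsRelOpenInFrontier (Ω Γ : Set E3) : Prop :=
  ∃ V : Set E3, IsOpen V ∧ Γ = V ∩ frontier Ω

/-- The Dirichlet part `ΓD` and the Neumann part `ΓN` are disjoint, nonempty, relatively open
subsets of `∂Ω` that together cover `∂Ω` up to a set of surface measure zero. -/
structure IsBoundaryDecomposition (Ω ΓD ΓN : Set E3) : Prop where
  relOpen_dirichlet : IsRelOpenInFrontier Ω ΓD
  relOpen_neumann : IsRelOpenInFrontier Ω ΓN
  nonempty_dirichlet : ΓD.Nonempty
  nonempty_neumann : ΓN.Nonempty
  disjoint : Disjoint ΓD ΓN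
  null_remainder : surfaceMeasure Ω (frontier Ω \ (ΓD ∪ ΓN)) = 0

/-- `P` is a plane part of `∂Ω` lying in the plane `H`: a subset of `∂Ω`, not of surface measure
zero, that is contained in the two-dimensional affine subspace `H`. -/
structure IsPlanePart (Ω : Set E3) (H : AffineSubspace ℝ E3) (P : Set E3) : Prop where
  finrank_direction : Module.finrank ℝ H.direction = 2
  subset_frontier : P ⊆ frontier Ω
  subset_plane : P ⊆ H
  pos_measure : surfaceMeasure Ω P ≠ 0

/-- The union of all plane parts of `∂Ω` whose plane is parallel (possibly equal) to `H`. -/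
def parallelPlaneParts (Ω : Set E3) (H : AffineSubspace ℝ E3) : Set E3 :=
  {x | ∃ (H' : AffineSubspace ℝ E3) (P : Set E3), IsPlanePart Ω H' P ∧ H'.Parallel H ∧ x ∈ P}

/-! Write λ for the k-th mixed eigenvalue and let F be the span of the mixed eigenfunctions with
eigenvalues up to λ, so that dim F ≥ k. Two planes in ℝ³ have a common direction ξ, |ξ| = 1. The
plane wave e(x) = exp(i√λ ⟨ξ, x⟩) satisfies |∇e|² = λ|e|² pointwise and -Δe = λe, and its normal
derivative i√λ ⟨ξ, ν⟩ e vanishes on Γ_N because ξ is tangential there. Green's formula gives ∫ ∇e ·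
conj ∇v = λ ∫ e conj v for every v in H¹ with zero trace on Γ_D. Hence all cross terms with F
balance, and the Rayleigh quotient is at most λ on F + ℂe. Since |e| = 1 while elements of F vanish
on Γ_D, e is not in F. The sum has dimension at least k + 1 inside H¹(Ω), and min-max for the
Neumann problem gives μ_{k+1} ≤ λ.

The dimension count is `rank_add_one_le_rank_formSpan`, Green's formula is
`inner_smoothPair_planeWave`, and e ∉ F is `smoothPair_notMem_formDomain`.

H¹(Ω) is realized as the closed space of pairs (u, ∇u), normed by ‖u‖² + ‖∇u‖², with J the
projection to u. A Laplace eigenvalue t becomes a form eigenvalue 1 + t of ⟪w, v⟫ = s ⟪Jw, Jv⟫, that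
is, an eigenvalue 1/s of J*J. The spectral theory of compact selfadjoint operators then applies once
J is compact (`exists_friedrichs`, from the cone condition and a translation estimate).

No normal vector and no exact divergence theorem are needed. It suffices to have
`enorm_integral_fderiv_le`: the integral of ∂_ξ φ over Ω is at most three times the integral of |φ|
over the boundary outside a set Z whose sweep along ξ is null. With Z the union of the planes
carrying Γ_N, the right side vanishes in the limit for functions with zero trace on Γ_D. Traces are
handled by closing the graph of restriction on smooth functions. Density of smooth functions in
H¹(Ω) is not used, since only the inclusion of the mixed form domain in H¹(Ω) matters. -/

/-! ### Min-max principle for a form eigenvalue problem with compact embedding. -/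

section FormSpectral

open Module.End

variable {V H : Type*} [NormedAddCommGroup V] [InnerProductSpace ℂ V]
  [NormedAddCommGroup H] [InnerProductSpace ℂ H]

/-- The span of the eigenvectors, with eigenvalues at most `r`, of the generalized eigenvalue
problem `⟪w, v⟫ = s ⟪J w, J v⟫`. -/
noncomputable def formSpan (J : V →L[ℂ] H) (r : ℝ) : Submodule ℂ V :=
  Submodule.span ℂ {v | ∃ s : ℝ, s ≤ r ∧ ∀ w, inner ℂ w v = (s : ℂ) * inner ℂ (J w) (J v)}

/-- A subspace on which a compact operator is bounded below is finite-dimensional. -/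
theorem finiteDimensional_of_isCompactOperator_of_le [CompleteSpace V] {J : V →L[ℂ] H} (hJ :
    IsCompactOperator J)
    (W : Submodule ℂ V) (C : ℝ) (hW : ∀ w ∈ W, ‖w‖ ≤ C * ‖J w‖) : FiniteDimensional ℂ W := by
  have hcl : ∀ w ∈ W.topologicalClosure, ‖w‖ ≤ C * ‖J w‖ := by
    intro w hw
    have hc : IsClosed {w : V | ‖w‖ ≤ C * ‖J w‖} :=
      isClosed_le continuous_norm (continuous_const.mul (J.continuous.norm))
    exact closure_minimal (fun x hx => hW x hx) hc hw
  set W' := W.topologicalClosure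
  have : CompleteSpace W' := W.isClosed_topologicalClosure.completeSpace_coe
  set J' : W' →L[ℂ] H := J.comp W'.subtypeL
  have hJ' : IsCompactOperator J' := hJ.comp_clm W'.subtypeL
  have hanti : AntilipschitzWith (Real.toNNReal C) J' := by
    refine AddMonoidHomClass.antilipschitz_of_bound J' fun x => ?_
    refine (hcl x x.2).trans ?_
    exact mul_le_mul_of_nonneg_right (Real.le_coe_toNNReal C) (norm_nonneg _)
  have hemb := hanti.isClosedEmbedding J'.uniformContinuous
  -- An operator bounded below on a complete space is a closed embedding, so compactness pulls back
  -- to the unit ball of the closure of `W`.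
  have hid : IsCompactOperator (id : W' → W') := by
    obtain ⟨K, hK, hmem⟩ := hJ'
    exact ⟨J' ⁻¹' K, hemb.isCompact_preimage hK, hmem⟩
  have := FiniteDimensional.of_isCompactOperator_id (𝕜 := ℂ) hid
  exact Submodule.finiteDimensional_of_le W.le_topologicalClosure

variable (J : V →L[ℂ] H)

theorem inner_adjoint_comp_self [CompleteSpace V] [CompleteSpace H] (w v : V) :
    inner ℂ w ((ContinuousLinearMap.adjoint J ∘L J) v) = inner ℂ (J w) (J v) := by
  simp [ContinuousLinearMap.adjoint_inner_right]

theorem isSymmetric_adjoint_comp_self [CompleteSpace V] [CompleteSpace H] :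
    ((ContinuousLinearMap.adjoint J ∘L J : V →L[ℂ] V)).IsSymmetric := by
  intro x y
  simp [ContinuousLinearMap.adjoint_inner_right, ContinuousLinearMap.adjoint_inner_left]

theorem pos_of_form_eigenvector {s : ℝ} {v : V} (hv : v ≠ 0)
    (h : ∀ w, inner ℂ w v = (s : ℂ) * inner ℂ (J w) (J v)) : 0 < s := by
  have h1 := h v
  rw [inner_self_eq_norm_sq_to_K, inner_self_eq_norm_sq_to_K] at h1
  have h2 : ‖v‖ ^ 2 = s * ‖J v‖ ^ 2 := by
    apply Complex.ofReal_injective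
    push_cast
    exact h1
  have h3 : 0 < ‖v‖ ^ 2 := by positivity
  rw [h2] at h3
  exact pos_of_mul_pos_left h3 (by positivity)

/-- Since ⟪w, J*J v⟫ = ⟪Jw, Jv⟫, inverting the eigenvalue turns the form problem into the spectral
problem of the symmetric operator J*J. -/
theorem form_eigenvector_iff [CompleteSpace V] [CompleteSpace H] {s : ℝ} (hs : 0 < s) (v : V) :
    (∀ w, inner ℂ w v = (s : ℂ) * inner ℂ (J w) (J v)) ↔
      v ∈ eigenspace ((ContinuousLinearMap.adjoint J ∘L J : V →L[ℂ] V) : V →ₗ[ℂ] V)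
        ((s⁻¹ : ℝ) : ℂ) := by
  rw [mem_eigenspace_iff]
  have hs' : (s : ℂ) ≠ 0 := by exact_mod_cast hs.ne'
  constructor
  · intro h
    refine ext_inner_left ℂ fun w => ?_
    rw [inner_smul_right, h w, ContinuousLinearMap.coe_coe, inner_adjoint_comp_self]
    push_cast
    field_simp
  · intro h w
    rw [← inner_adjoint_comp_self, ← ContinuousLinearMap.coe_coe, h, inner_smul_right]
    push_cast
    field_simp

theorem formSpan_eq_iSup [CompleteSpace V] [CompleteSpace H] (r : ℝ) :
    formSpan J r = ⨆ s : {s : ℝ // 0 < s ∧ s ≤ r},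
      eigenspace ((ContinuousLinearMap.adjoint J ∘L J : V →L[ℂ] V) : V →ₗ[ℂ] V)
        (((s : ℝ)⁻¹ : ℝ) : ℂ) := by
  apply le_antisymm
  · refine Submodule.span_le.2 ?_
    rintro v ⟨s, hs, h⟩
    -- The zero vector solves the equation for every `s`, even a negative one, so positivity of `s`
    -- is available only for `v ≠ 0`.
    by_cases hv : v = 0
    · simp [hv]
    have h0 := pos_of_form_eigenvector J hv h
    exact Submodule.mem_iSup_of_mem (⟨s, h0, hs⟩ : {s : ℝ // 0 < s ∧ s ≤ r})
      ((form_eigenvector_iff J h0 v).1 h)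
  · refine iSup_le fun s v hv => Submodule.subset_span ?_
    exact ⟨s, s.2.2, (form_eigenvector_iff J s.2.1 v).2 hv⟩

/-- On `formSpan J r` the Rayleigh quotient is at most `r`. -/
theorem norm_sq_le_of_mem_formSpan [CompleteSpace V] [CompleteSpace H] {r : ℝ} {v : V} (hv : v ∈
    formSpan J r) :
    ‖v‖ ^ 2 ≤ r * ‖J v‖ ^ 2 := by
  set K : V →ₗ[ℂ] V := ((ContinuousLinearMap.adjoint J ∘L J : V →L[ℂ] V) : V →ₗ[ℂ] V) with hK
  have hsym : K.IsSymmetric := isSymmetric_adjoint_comp_self J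
  -- Different `s` give different eigenvalues `s⁻¹` of a symmetric operator, hence orthogonal
  -- eigenspaces. Both squared norms then split over the components, and each component satisfies
  -- the bound because `s ≤ r`.
  have horth : OrthogonalFamily ℂ (fun s : {s : ℝ // 0 < s ∧ s ≤ r} =>
      eigenspace K (((s : ℝ)⁻¹ : ℝ) : ℂ)) fun s => (eigenspace K _).subtypeₗᵢ := by
    refine hsym.orthogonalFamily_eigenspaces.comp (f := fun s : {s : ℝ // 0 < s ∧ s ≤ r} =>
      (((s : ℝ)⁻¹ : ℝ) : ℂ)) ?_
    intro a b hab
    simpa [Subtype.ext_iff] using hab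
  rw [formSpan_eq_iSup, Submodule.mem_iSup_iff_exists_finsupp] at hv
  obtain ⟨f, hf, rfl⟩ := hv
  set l : ∀ s : {s : ℝ // 0 < s ∧ s ≤ r}, eigenspace K (((s : ℝ)⁻¹ : ℝ) : ℂ) :=
    fun s => ⟨f s, hf s⟩
  have hsum : f.sum (fun _ x => x) = ∑ s ∈ f.support,
      (eigenspace K (((s : ℝ)⁻¹ : ℝ) : ℂ)).subtypeₗᵢ (l s) := rfl
  have hJ : ∀ v : V, ‖J v‖ ^ 2 = RCLike.re (inner ℂ v (K v)) := by
    intro v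
    rw [hK, ContinuousLinearMap.coe_coe, inner_adjoint_comp_self, inner_self_eq_norm_sq]
  have hKsum : K (∑ s ∈ f.support, (eigenspace K (((s : ℝ)⁻¹ : ℝ) : ℂ)).subtypeₗᵢ (l s)) =
      ∑ s ∈ f.support, (eigenspace K (((s : ℝ)⁻¹ : ℝ) : ℂ)).subtypeₗᵢ
        ((((s : ℝ)⁻¹ : ℝ) : ℂ) • l s) := by
    rw [map_sum]
    refine Finset.sum_congr rfl fun s _ => ?_
    have := mem_eigenspace_iff.1 (hf s)
    simpa [l, hK] using this
  rw [hsum, hJ, hKsum, horth.norm_sum, horth.inner_sum]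
  simp only [inner_smul_right, inner_self_eq_norm_sq_to_K]
  rw [map_sum, Finset.mul_sum]
  refine Finset.sum_le_sum fun s _ => ?_
  have h1 : 1 ≤ r * (s : ℝ)⁻¹ := by
    rw [← div_eq_mul_inv, le_div_iff₀ s.2.1]; linarith [s.2.2]
  have h2 : RCLike.re ((((s : ℝ)⁻¹ : ℝ) : ℂ) * ((‖l s‖ : ℝ) : ℂ) ^ 2) =
      (s : ℝ)⁻¹ * ‖l s‖ ^ 2 := by
    rw [← Complex.ofReal_pow, ← Complex.ofReal_mul]; exact Complex.ofReal_re _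
  refine le_of_le_of_eq ?_ (congrArg (r * ·) h2.symm)
  calc ‖l s‖ ^ 2 = 1 * ‖l s‖ ^ 2 := (one_mul _).symm
    _ ≤ (r * (s : ℝ)⁻¹) * ‖l s‖ ^ 2 := by gcongr
    _ = _ := by ring

theorem finiteDimensional_formSpan [CompleteSpace V] [CompleteSpace H] (hJ : IsCompactOperator J)
    (r : ℝ) :
    FiniteDimensional ℂ (formSpan J r) := by
  refine finiteDimensional_of_isCompactOperator_of_le hJ _ (Real.sqrt (max r 0)) fun w hw => ?_
  have h := norm_sq_le_of_mem_formSpan J hw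
  refine abs_le_of_sq_le_sq' ?_ (by positivity) |>.2
  rw [mul_pow, Real.sq_sqrt (le_max_right _ _)]
  exact h.trans (mul_le_mul_of_nonneg_right (le_max_left _ _) (by positivity))

/-- Every nonzero vector orthogonal to `formSpan J r` has Rayleigh quotient greater than `r`. -/
theorem lt_norm_sq_of_mem_orthogonal_formSpan [CompleteSpace V] [CompleteSpace H] (hJ :
    IsCompactOperator J) {r : ℝ} (hr : 0 < r)
    {w : V} (hw : w ∈ (formSpan J r)ᗮ) (hw0 : w ≠ 0) : r * ‖J w‖ ^ 2 < ‖w‖ ^ 2 := by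
  set K : V →L[ℂ] V := ContinuousLinearMap.adjoint J ∘L J with hK
  have hKc : IsCompactOperator K := hJ.clm_comp (ContinuousLinearMap.adjoint J)
  have hsym : (K : V →ₗ[ℂ] V).IsSymmetric := isSymmetric_adjoint_comp_self J
  have hJK : ∀ v : V, ‖J v‖ ^ 2 = RCLike.re (inner ℂ (K v) v) := by
    intro v
    rw [← inner_conj_symm, hK, inner_adjoint_comp_self, inner_self_eq_norm_sq_to_K]
    simp [← Complex.ofReal_pow]
  have hinv : ∀ v ∈ (formSpan J r)ᗮ, K v ∈ (formSpan J r)ᗮ := by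
    intro v hv
    rw [formSpan_eq_iSup, ← Submodule.iInf_orthogonal, Submodule.mem_iInf] at hv ⊢
    exact fun s => hsym.invariant_orthogonalComplement_eigenspace _ v (hv s)
  set S : (formSpan J r)ᗮ →L[ℂ] (formSpan J r)ᗮ := K.restrict hinv
  have hSc : IsCompactOperator S := hKc.restrict' hinv
  have hSs : S.IsSymmetric := hsym.restrict_invariant hinv
  have : Nontrivial (formSpan J r)ᗮ := ⟨⟨⟨w, hw⟩, 0, by simpa [Subtype.ext_iff] using hw0⟩⟩
  have hray : ∀ x : (formSpan J r)ᗮ, S.reApplyInnerSelf x = ‖J x‖ ^ 2 := by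
    intro x
    rw [hJK]; rfl
  -- For a compact operator ‖S‖ is an eigenvalue or a resolvent point. As an eigenvalue at least
  -- `r⁻¹` its eigenvector would lie in `formSpan J r` and in its orthogonal complement. As a
  -- resolvent point it would keep the Rayleigh quotients, whose supremum is ‖S‖, below ‖S‖ - ε.
  have hnorm : ‖S‖ < r⁻¹ := by
    by_contra! hle
    have hpos : 0 < ‖S‖ := lt_of_lt_of_le (by positivity) hle
    have hne : ((‖S‖ : ℝ) : ℂ) ≠ 0 := by exact_mod_cast hpos.ne'
    rcases hSc.hasEigenvalue_or_mem_resolventSet hne with h | h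
    · obtain ⟨x, hx, hx0⟩ := h.exists_hasEigenvector
      apply hx0
      have hx1 : (x : V) ∈ formSpan J r := by
        refine (formSpan_eq_iSup J r).ge ?_
        refine Submodule.mem_iSup_of_mem (⟨‖S‖⁻¹, by positivity, ?_⟩ :
          {s : ℝ // 0 < s ∧ s ≤ r}) ?_
        · exact inv_le_of_inv_le₀ hr hle
        · rw [inv_inv, mem_eigenspace_iff]
          have := mem_eigenspace_iff.1 hx
          exact congrArg Subtype.val this
      have := Submodule.inner_left_of_mem_orthogonal hx1 x.2
      ext
      simpa using this
    · obtain ⟨ε, hε, hle'⟩ := S.rayleighQuotient_le_of_norm_mem_resolventSet h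
      have h1 := S.norm_eq_iSup_rayleighQuotient hSs
      have h2 : ‖S‖ ≤ ‖S‖ - ε := by
        conv_lhs => rw [h1]
        refine ciSup_le fun x => ?_
        rw [abs_of_nonneg]
        · exact hle' x
        · rw [ContinuousLinearMap.rayleighQuotient, hray]; positivity
      linarith
  have h1 := S.rayleighQuotient_le_norm ⟨w, hw⟩
  rw [ContinuousLinearMap.rayleighQuotient, hray] at h1
  have hwn : 0 < ‖w‖ ^ 2 := by positivity
  have h2 : ‖J w‖ ^ 2 / ‖w‖ ^ 2 < r⁻¹ := lt_of_le_of_lt ((le_abs_self _).trans h1) hnorm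
  rw [div_lt_iff₀ hwn, inv_mul_eq_div, lt_div_iff₀ hr] at h2
  linarith

/-- **Min-max principle**: a subspace on which the Rayleigh quotient is at most `r` has dimension
at most that of `formSpan J r`. -/
theorem rank_le_rank_formSpan [CompleteSpace V] [CompleteSpace H] (hJ : IsCompactOperator J) {r :
    ℝ} (W : Submodule ℂ V)
    (hW : ∀ w ∈ W, ‖w‖ ^ 2 ≤ r * ‖J w‖ ^ 2) : Module.rank ℂ W ≤ Module.rank ℂ (formSpan J r) := by
  rcases le_or_gt r 0 with hr | hr
  · have : W = ⊥ := by
      refine (Submodule.eq_bot_iff _).2 fun w hw => ?_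
      have h1 := hW w hw
      have h2 : r * ‖J w‖ ^ 2 ≤ 0 := mul_nonpos_of_nonpos_of_nonneg hr (by positivity)
      have h3 : ‖w‖ ^ 2 = 0 := le_antisymm (h1.trans h2) (by positivity)
      simpa using h3
    rw [this]; simp
  have := finiteDimensional_formSpan J hJ r
  -- The projection onto `formSpan J r` is injective on `W`: a nonzero vector in its kernel would
  -- have Rayleigh quotient both at most `r` and greater than `r`.
  refine LinearMap.rank_le_of_injective
    (((formSpan J r).orthogonalProjectionOnto : V →ₗ[ℂ] _) ∘ₗ W.subtype) ?_
  rw [← LinearMap.ker_eq_bot, LinearMap.ker_eq_bot']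
  intro w hw
  have hw' : (w : V) ∈ (formSpan J r)ᗮ := by
    simpa using hw
  by_contra hne
  have := lt_norm_sq_of_mem_orthogonal_formSpan J hJ hr hw' (by simpa using hne)
  exact absurd (hW w w.2) (not_le.2 this)

/-- Some `formSpan J r` has dimension at least `k`. -/
theorem exists_le_rank_formSpan [CompleteSpace V] [CompleteSpace H] (hJ : IsCompactOperator J)
    (hinj : Function.Injective J)
    (hV : ¬ FiniteDimensional ℂ V) (k : ℕ) : ∃ r, (k : Cardinal) ≤ Module.rank ℂ (formSpan J r) :=
      by
  have hk : (k : Cardinal) ≤ Module.rank ℂ V := by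
    by_contra! h
    exact hV (Module.rank_lt_aleph0_iff.1 (h.trans (Cardinal.natCast_lt_aleph0)))
  obtain ⟨b, hb⟩ := (le_rank_iff_exists_linearIndependent_finset).1 hk
  set W : Submodule ℂ V := Submodule.span ℂ (b : Set V)
  have hWr : Module.rank ℂ W = k := by
    rw [rank_span_set hb.2]; simp [hb.1]
  have hfin : FiniteDimensional ℂ W := FiniteDimensional.span_finset ℂ b
  -- An injective map on a finite-dimensional space is bounded below, so the Rayleigh quotient on
  -- `W` is at most `C ^ 2`.
  have : ∃ C : ℝ, ∀ w ∈ W, ‖w‖ ≤ C * ‖J w‖ := by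
    have hi : LinearMap.ker ((J : V →ₗ[ℂ] H) ∘ₗ W.subtype) = ⊥ :=
      LinearMap.ker_eq_bot.2 (hinj.comp Subtype.val_injective)
    obtain ⟨C, -, hC⟩ := LinearMap.exists_antilipschitzWith _ hi
    refine ⟨C, fun w hw => ?_⟩
    have := hC.le_mul_dist ⟨w, hw⟩ 0
    rw [map_zero, dist_zero_right, dist_zero_right] at this
    exact this
  obtain ⟨C, hC⟩ := this
  refine ⟨C ^ 2, hWr.symm.le.trans (rank_le_rank_formSpan J hJ W fun w hw => ?_)⟩
  rw [← mul_pow]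
  exact pow_le_pow_left₀ (norm_nonneg _) (hC w hw) 2

/-- The `k`-th eigenvalue of the generalized eigenvalue problem exists. -/
theorem exists_isLeast_rank_formSpan [CompleteSpace V] [CompleteSpace H] (hJ : IsCompactOperator J)
    (hinj : Function.Injective J)
    (hV : ¬ FiniteDimensional ℂ V) (k : ℕ) (hk : 1 ≤ k) :
    ∃ l, IsLeast {r : ℝ | (k : Cardinal) ≤ Module.rank ℂ (formSpan J r)} l := by
  obtain ⟨r₀, hr₀⟩ := exists_le_rank_formSpan J hJ hinj hV k
  have hmono : Monotone (formSpan J) := fun a b hab =>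
    Submodule.span_mono fun v ⟨s, hs, h⟩ => ⟨s, hs.trans hab, h⟩
  -- the eigenvalues below `r₀`
  set E : Set ℝ := {s | s ≤ r₀ ∧ ∃ v : V, v ≠ 0 ∧
    ∀ w, inner ℂ w v = (s : ℂ) * inner ℂ (J w) (J v)} with hE
  have hEfin : E.Finite := by
    -- Eigenvectors for different eigenvalues are independent, and all of them lie in the
    -- finite-dimensional `formSpan J r₀`.
    have hfd := finiteDimensional_formSpan J hJ r₀
    choose! v hv0 hv using fun s (hs : s ∈ E) => hs.2
    have hli : LinearIndependent ℂ (fun s : E => v s) := by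
      refine Module.End.eigenvectors_linearIndependent'
        ((ContinuousLinearMap.adjoint J ∘L J : V →L[ℂ] V) : V →ₗ[ℂ] V)
        (fun s : E => (((s : ℝ)⁻¹ : ℝ) : ℂ)) ?_ _ fun s => ⟨?_, hv0 s s.2⟩
      · intro a b hab
        simpa [Subtype.ext_iff] using hab
      · exact (form_eigenvector_iff J (pos_of_form_eigenvector J (hv0 s s.2) (hv s s.2)) _).1
          (hv s s.2)
    have hli' : LinearIndependent ℂ (fun s : E => (⟨v s, Submodule.subset_span
        ⟨s, s.2.1, hv s s.2⟩⟩ : formSpan J r₀)) := by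
      refine LinearIndependent.of_comp (formSpan J r₀).subtype ?_
      exact hli
    have := hli'.finite
    exact Set.toFinite E
  set A : Set ℝ := {r | (k : Cardinal) ≤ Module.rank ℂ (formSpan J r)} with hA
  -- Lowering `r` to the largest eigenvalue not exceeding it leaves the span unchanged, so a least
  -- element of `A` may be sought in the finite set `E ∩ A`.
  have key : ∀ r ∈ A, r ≤ r₀ → ∃ s ∈ E ∩ A, s ≤ r := by
    intro r hr hrr
    set E' := {s ∈ E | s ≤ r} with hE'
    have hE'fin : E'.Finite := hEfin.subset (fun s hs => hs.1)
    have hspan : ∀ m, (∀ s ∈ E', s ≤ m) → formSpan J r ≤ formSpan J m := by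
      intro m hm
      refine Submodule.span_le.2 ?_
      rintro v ⟨s, hs, h⟩
      by_cases hv : v = 0
      · simp [hv]
      exact Submodule.subset_span ⟨s, hm s ⟨⟨hs.trans hrr, v, hv, h⟩, hs⟩, h⟩
    -- Here `1 ≤ k` matters: without eigenvalues up to `r` the span is zero, and for `k = 0` the set
    -- `A` would be all of ℝ.
    have hne : E'.Nonempty := by
      by_contra hemp
      rw [Set.not_nonempty_iff_eq_empty] at hemp
      have h0 : formSpan J r = ⊥ := by
        refine Submodule.span_eq_bot.2 ?_
        rintro v ⟨s, hs, h⟩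
        by_contra hv
        have : s ∈ E' := ⟨⟨hs.trans hrr, v, hv, h⟩, hs⟩
        simp [hemp] at this
      have : Module.rank ℂ (⊥ : Submodule ℂ V) ≥ k := by
        have := hr
        rw [hA, Set.mem_ofPred_eq, h0] at this
        exact this
      have : k = 0 := by simpa using this
      omega
    obtain ⟨m, hm, hmax⟩ := hE'fin.exists_maximal hne
    have hmax' : ∀ s ∈ E', s ≤ m := fun s hs => by
      rcases le_total s m with h | h
      · exact h
      · exact hmax hs h
    have hmA : m ∈ A := by
      rw [hA, Set.mem_ofPred_eq] at hr ⊢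
      exact hr.trans (Submodule.rank_mono (hspan m hmax'))
    exact ⟨m, ⟨hm.1, hmA⟩, hm.2⟩
  obtain ⟨s₀, hs₀, -⟩ := key r₀ hr₀ le_rfl
  obtain ⟨l, hl, hmin⟩ := (hEfin.inter_of_left A).exists_minimal ⟨s₀, hs₀⟩
  refine ⟨l, hl.2, fun r hr => ?_⟩
  rcases le_total r r₀ with h | h
  · obtain ⟨s, hs, hsr⟩ := key r hr h
    rcases le_total l s with h' | h'
    · exact h'.trans hsr
    · exact (hmin hs h').trans hsr
  · exact hl.1.1.trans h

end FormSpectral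

/-! ### Graph coordinates -/

section Charts

open scoped ENNReal

/-- The first two coordinates after applying `T`. -/
noncomputable def baseProj (T : E3 ≃ₗᵢ[ℝ] E3) (x : E3) : Fin 2 → ℝ := ![T x 0, T x 1]

/-- The point with coordinates `(y, s)` with respect to `T`. -/
noncomputable def ofCoords (T : E3 ≃ₗᵢ[ℝ] E3) (y : Fin 2 → ℝ) (s : ℝ) : E3 :=
  T.symm !₂[y 0, y 1, s]

/-- The unit vector in the vertical direction of the coordinates given by `T`. -/
noncomputable def vertical (T : E3 ≃ₗᵢ[ℝ] E3) : E3 := T.symm (EuclideanSpace.single 2 1)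

variable (T : E3 ≃ₗᵢ[ℝ] E3)

@[simp] theorem norm_vertical : ‖vertical T‖ = 1 := by simp [vertical]

@[simp] theorem apply_vertical : T (vertical T) = EuclideanSpace.single 2 1 := by simp [vertical]

@[simp] theorem baseProj_ofCoords (y : Fin 2 → ℝ) (s : ℝ) : baseProj T (ofCoords T y s) = y := by
  ext i; fin_cases i <;> simp [baseProj, ofCoords]

@[simp] theorem height_ofCoords (y : Fin 2 → ℝ) (s : ℝ) : T (ofCoords T y s) 2 = s := by
  simp [ofCoords]

@[simp] theorem ofCoords_baseProj (x : E3) : ofCoords T (baseProj T x) (T x 2) = x := by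
  have : (!₂[T x 0, T x 1, T x 2] : E3) = T x := by
    ext i; fin_cases i <;> simp
  simp [baseProj, ofCoords, this]

@[simp] theorem baseProj_sub_smul_vertical (x : E3) (s : ℝ) :
    baseProj T (x - s • vertical T) = baseProj T x := by
  ext i; fin_cases i <;> simp [baseProj]

@[simp] theorem baseProj_add_smul_vertical (x : E3) (s : ℝ) :
    baseProj T (x + s • vertical T) = baseProj T x := by
  ext i; fin_cases i <;> simp [baseProj]

@[simp] theorem height_sub_smul_vertical (x : E3) (s : ℝ) :
    T (x - s • vertical T) 2 = T x 2 - s := by simp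

theorem ofCoords_sub (y : Fin 2 → ℝ) (s t : ℝ) :
    ofCoords T y (s - t) = ofCoords T y s - t • vertical T := by
  apply T.injective
  ext i; fin_cases i <;> simp [ofCoords]

theorem abs_baseProj_sub_le (x y : E3) (i : Fin 2) :
    |baseProj T x i - baseProj T y i| ≤ ‖x - y‖ := by
  have h : ∀ j : Fin 3, |T x j - T y j| ≤ ‖x - y‖ := by
    intro j
    have := PiLp.norm_apply_le (T x - T y) j
    rwa [← map_sub, T.norm_map, map_sub] at this
  fin_cases i
  · exact h 0
  · exact h 1

theorem lipschitzWith_baseProj : LipschitzWith 1 (baseProj T) := by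
  refine LipschitzWith.of_dist_le_mul fun x y => ?_
  rw [NNReal.coe_one, one_mul, dist_eq_norm, dist_eq_norm]
  exact (pi_norm_le_iff_of_nonneg (norm_nonneg _)).2 fun i => abs_baseProj_sub_le T x y i

/-- The sup metric on `Fin 2 → ℝ` makes the two measures agree without a constant. This is why base
points are not taken in `EuclideanSpace`. -/
theorem hausdorffMeasure_two_eq_volume :
    (Measure.hausdorffMeasure 2 : Measure (Fin 2 → ℝ)) = volume := by
  have := hausdorffMeasure_pi_real (ι := Fin 2)
  simpa using this

/-- Projection from the Euclidean to the sup norm is 1-Lipschitz. This is the source of all lower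
bounds on surface measure. -/
theorem volume_baseProj_image_le (A : Set E3) :
    volume (baseProj T '' A) ≤ Measure.hausdorffMeasure 2 A := by
  rw [← hausdorffMeasure_two_eq_volume]
  simpa using (lipschitzWith_baseProj T).hausdorffMeasure_image_le (d := 2) (by norm_num) A

theorem measurePreserving_ofCoords :
    MeasurePreserving (fun q : (Fin 2 → ℝ) × ℝ => ofCoords T q.1 q.2) := by
  -- Splitting off the last coordinate puts it first in the product, hence the swap below.
  have h1 := (volume_preserving_piFinSuccAbove (fun _ : Fin 3 => ℝ) 2).symm
  have h2 := PiLp.volume_preserving_toLp (Fin 3)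
  have h3 := T.symm.measurePreserving
  have h4 : MeasurePreserving (Prod.swap : (Fin 2 → ℝ) × ℝ → ℝ × (Fin 2 → ℝ)) volume volume :=
    Measure.measurePreserving_swap
  have h5 := (h3.comp h2).comp (h1.comp h4)
  suffices heq : (fun q : (Fin 2 → ℝ) × ℝ => ofCoords T q.1 q.2) =
      (T.symm ∘ WithLp.toLp 2) ∘
        ((MeasurableEquiv.piFinSuccAbove (fun _ => ℝ) 2).symm ∘ Prod.swap) by
    rw [heq]; exact h5
  funext q
  refine congrArg T.symm ?_
  ext i
  fin_cases i <;> simp [MeasurableEquiv.piFinSuccAbove, Fin.insertNthEquiv, Fin.insertNth,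
    Fin.succAboveCases]

theorem continuous_baseProj : Continuous (baseProj T) := (lipschitzWith_baseProj T).continuous

theorem continuous_ofCoords : Continuous fun q : (Fin 2 → ℝ) × ℝ => ofCoords T q.1 q.2 := by
  unfold ofCoords
  refine T.symm.continuous.comp ?_
  refine (PiLp.continuous_toLp 2 _).comp ?_
  refine continuous_pi fun i => ?_
  fin_cases i <;> simp <;> fun_prop

theorem norm_ofCoords_sub_le (y z : Fin 2 → ℝ) (s t : ℝ) :
    ‖ofCoords T y s - ofCoords T z t‖ ≤ |y 0 - z 0| + |y 1 - z 1| + |s - t| := by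
  rw [ofCoords, ofCoords, ← map_sub, LinearIsometryEquiv.norm_map]
  refine abs_le_of_sq_le_sq' ?_ (by positivity) |>.2
  rw [EuclideanSpace.norm_sq_eq, Fin.sum_univ_three]
  simp only [PiLp.sub_apply, Real.norm_eq_abs]
  simp
  nlinarith [abs_nonneg (y 0 - z 0), abs_nonneg (y 1 - z 1), abs_nonneg (s - t),
    sq_abs (y 0 - z 0), sq_abs (y 1 - z 1), sq_abs (s - t),
    mul_nonneg (abs_nonneg (y 0 - z 0)) (abs_nonneg (y 1 - z 1)),
    mul_nonneg (abs_nonneg (y 0 - z 0)) (abs_nonneg (s - t)),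
    mul_nonneg (abs_nonneg (y 1 - z 1)) (abs_nonneg (s - t))]

/-- Inside the open set `U`, the set `Ω` is the strict subgraph of the Lipschitz function `h` in the
coordinates given by `T`. -/
structure IsGraphChart (Ω : Set E3) (T : E3 ≃ₗᵢ[ℝ] E3) (h : (Fin 2 → ℝ) → ℝ) (K : ℝ≥0)
    (U : Set E3) : Prop where
  lipschitz : LipschitzWith K h
  isOpen : IsOpen U
  mem_iff : ∀ x ∈ U, (x ∈ Ω ↔ T x 2 < h (baseProj T x))

theorem IsBoundedLipschitzDomain.exists_chart {Ω : Set E3} (hΩ : IsBoundedLipschitzDomain Ω)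
    {p : E3} (hp : p ∈ frontier Ω) : ∃ T h K U, IsGraphChart Ω T h K U ∧ p ∈ U := by
  obtain ⟨T, h, K, U, hh, hU, hpU, hiff⟩ := hΩ.isLipschitz p hp
  have := hh.comp (PiLp.lipschitzWith_toLp 2 (fun _ : Fin 2 => ℝ))
  refine ⟨T, _, _, U, ⟨this, hU, fun x hx => ?_⟩, hpU⟩
  rw [hiff x hx]
  rfl

/-- The parametrization of the graph of `h`. -/
noncomputable def graphMap (h : (Fin 2 → ℝ) → ℝ) (y : Fin 2 → ℝ) : E3 := ofCoords T y (h y)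

variable {T} {Ω : Set E3} {h : (Fin 2 → ℝ) → ℝ} {K : ℝ≥0} {U : Set E3}

/-- The Euclidean distance is bounded by the sum of the coordinate differences: one unit for each
base coordinate and `K` for the height. -/
theorem lipschitzWith_graphMap (hh : LipschitzWith K h) : LipschitzWith (2 + K) (graphMap T h) := by
  refine LipschitzWith.of_dist_le_mul fun y z => ?_
  rw [dist_eq_norm]
  refine (norm_ofCoords_sub_le T y z _ _).trans ?_
  have h1 := hh.dist_le_mul y z
  rw [Real.dist_eq] at h1
  have h2 : ∀ i, |y i - z i| ≤ dist y z := fun i => by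
    rw [← Real.dist_eq]; exact dist_le_pi_dist y z i
  push_cast
  linarith [h2 0, h2 1]

namespace IsGraphChart

/-- Strictly below the graph a point lies in the open set Ω; strictly above it has a neighbourhood
missing Ω. -/
theorem height_eq_of_mem_frontier (hc : IsGraphChart Ω T h K U) (hΩ : IsOpen Ω) {x : E3}
    (hxU : x ∈ U) (hx : x ∈ frontier Ω) : T x 2 = h (baseProj T x) := by
  have hcont : Continuous fun x => h (baseProj T x) :=
    hc.lipschitz.continuous.comp (continuous_baseProj T)
  have hcont' : Continuous fun x => T x 2 := by fun_prop
  rw [hΩ.frontier_eq] at hx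
  rcases lt_trichotomy (T x 2) (h (baseProj T x)) with hlt | heq | hgt
  · exact absurd ((hc.mem_iff x hxU).2 hlt) hx.2
  · exact heq
  · have hopen : IsOpen (U ∩ {x | h (baseProj T x) < T x 2}) :=
      hc.isOpen.inter (isOpen_lt hcont hcont')
    obtain ⟨y, hy, hyΩ⟩ := mem_closure_iff.1 hx.1 _ hopen ⟨hxU, hgt⟩
    exact absurd ((hc.mem_iff y hy.1).1 hyΩ) (not_lt.2 (le_of_lt hy.2))

theorem mem_frontier_of_height_eq (hc : IsGraphChart Ω T h K U) (hΩ : IsOpen Ω) {x : E3}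
    (hxU : x ∈ U) (hx : T x 2 = h (baseProj T x)) : x ∈ frontier Ω := by
  rw [hΩ.frontier_eq]
  refine ⟨?_, fun hxΩ => ((hc.mem_iff x hxU).1 hxΩ).ne hx⟩
  have hlim : Tendsto (fun s : ℝ => x - s • vertical T) (𝓝[>] 0) (𝓝 x) := by
    have : Continuous fun s : ℝ => x - s • vertical T := by fun_prop
    have := this.tendsto 0
    simp only [zero_smul, sub_zero] at this
    exact this.mono_left nhdsWithin_le_nhds
  -- The points just below `x` belong to Ω and converge to `x`.
  refine mem_closure_of_tendsto hlim ?_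
  filter_upwards [hlim (hc.isOpen.mem_nhds hxU), self_mem_nhdsWithin] with s hsU hs
  rw [hc.mem_iff _ hsU, baseProj_sub_smul_vertical, height_sub_smul_vertical, ← hx]
  exact sub_lt_self _ hs

theorem graphMap_baseProj (hc : IsGraphChart Ω T h K U) (hΩ : IsOpen Ω) {x : E3}
    (hxU : x ∈ U) (hx : x ∈ frontier Ω) : graphMap T h (baseProj T x) = x := by
  rw [graphMap, ← hc.height_eq_of_mem_frontier hΩ hxU hx, ofCoords_baseProj]

/-- In a chart the surface measure is dominated by the image of the Lebesgue measure. -/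
theorem surfaceMeasure_le (hc : IsGraphChart Ω T h K U) (hΩ : IsOpen Ω) (A : Set E3) :
    Measure.hausdorffMeasure 2 (A ∩ U ∩ frontier Ω) ≤
      ((2 + K : ℝ≥0) : ℝ≥0∞) ^ 2 * volume (graphMap T h ⁻¹' (A ∩ U ∩ frontier Ω)) := by
  set S := A ∩ U ∩ frontier Ω
  -- On the boundary inside the chart, `graphMap` inverts the projection, so `S` is a Lipschitz
  -- image of a plane set. The square in the bound is the dimension.
  have hS : S = graphMap T h '' (baseProj T '' S) := by
    rw [Set.image_image]
    ext x
    constructor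
    · exact fun hx => ⟨x, hx, hc.graphMap_baseProj hΩ hx.1.2 hx.2⟩
    · rintro ⟨z, hz, rfl⟩
      beta_reduce
      rwa [hc.graphMap_baseProj hΩ hz.1.2 hz.2]
  have hS' : baseProj T '' S ⊆ graphMap T h ⁻¹' S := by
    rintro _ ⟨z, hz, rfl⟩
    rwa [Set.mem_preimage, hc.graphMap_baseProj hΩ hz.1.2 hz.2]
  have h1 := (lipschitzWith_graphMap (T := T) hc.lipschitz).hausdorffMeasure_image_le (d := 2)
    (by norm_num) (baseProj T '' S)
  rw [← hS, hausdorffMeasure_two_eq_volume] at h1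
  refine h1.trans ?_
  rw [show (2 : ℝ) = ((2 : ℕ) : ℝ) by norm_num, ENNReal.rpow_natCast]
  gcongr

end IsGraphChart

theorem IsBoundedLipschitzDomain.isCompact_frontier (hΩ : IsBoundedLipschitzDomain Ω) :
    IsCompact (frontier Ω) :=
  Metric.isCompact_of_isClosed_isBounded isClosed_frontier
    (hΩ.isBounded.closure.subset frontier_subset_closure)

/-- By compactness it is enough to argue near one point, where the boundary is a Lipschitz image of
a bounded plane set. -/
theorem IsBoundedLipschitzDomain.hausdorffMeasure_frontier_lt_top
    (hΩ : IsBoundedLipschitzDomain Ω) : (Measure.hausdorffMeasure 2 : Measure E3) (frontier Ω) < ⊤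
      := by
  refine hΩ.isCompact_frontier.measure_lt_top_of_nhdsWithin fun p hp => ?_
  obtain ⟨T, h, K, U, hc, hpU⟩ := hΩ.exists_chart hp
  refine ⟨Metric.ball p 1 ∩ U ∩ frontier Ω, ?_, ?_⟩
  · exact inter_mem (mem_nhdsWithin_of_mem_nhds
      (inter_mem (Metric.ball_mem_nhds p one_pos) (hc.isOpen.mem_nhds hpU))) self_mem_nhdsWithin
  · refine (hc.surfaceMeasure_le hΩ.isOpen _).trans_lt ?_
    refine ENNReal.mul_lt_top (by simp) ?_
    have hsub : graphMap T h ⁻¹' (Metric.ball p 1 ∩ U ∩ frontier Ω) ⊆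
        baseProj T '' (Metric.ball p 1) := by
      intro y hy
      exact ⟨graphMap T h y, hy.1.1, by simp [graphMap]⟩
    refine (measure_mono hsub).trans_lt ?_
    exact (((lipschitzWith_baseProj T).isBounded_image Metric.isBounded_ball)).measure_lt_top

theorem IsBoundedLipschitzDomain.isFiniteMeasure_surfaceMeasure
    (hΩ : IsBoundedLipschitzDomain Ω) : IsFiniteMeasure (surfaceMeasure Ω) :=
  ⟨by simpa [surfaceMeasure] using hΩ.hausdorffMeasure_frontier_lt_top⟩

/-- A nonempty relatively open subset of the boundary has positive surface measure. -/
theorem IsBoundedLipschitzDomain.surfaceMeasure_ne_zero (hΩ : IsBoundedLipschitzDomain Ω)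
    {Γ : Set E3} (hΓ : IsRelOpenInFrontier Ω Γ) (hne : Γ.Nonempty) : surfaceMeasure Ω Γ ≠ 0 := by
  obtain ⟨O, hO, rfl⟩ := hΓ
  obtain ⟨p, hpO, hp⟩ := hne
  obtain ⟨T, h, K, U, hc, hpU⟩ := hΩ.exists_chart hp
  have hopen : IsOpen (graphMap T h ⁻¹' (O ∩ U)) :=
    (hO.inter hc.isOpen).preimage (lipschitzWith_graphMap hc.lipschitz).continuous
  have hpos := hopen.measure_pos volume ⟨baseProj T p, by
    rw [Set.mem_preimage, hc.graphMap_baseProj hΩ.isOpen hpU hp]; exact ⟨hpO, hpU⟩⟩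
  -- The shadow of Γ in the base contains a nonempty open set, and projecting does not increase the
  -- measure.
  have hsub : graphMap T h ⁻¹' (O ∩ U) ⊆ baseProj T '' (O ∩ frontier Ω) := by
    intro y hy
    refine ⟨graphMap T h y, ⟨hy.1, ?_⟩, by simp [graphMap]⟩
    exact hc.mem_frontier_of_height_eq hΩ.isOpen hy.2 (by simp [graphMap])
  have h1 := (measure_mono hsub).trans (volume_baseProj_image_le T _)
  rw [surfaceMeasure, Measure.restrict_apply' isClosed_frontier.measurableSet, Set.inter_assoc,
    Set.inter_self]
  exact (hpos.trans_le h1).ne'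

end Charts

/-! ### The divergence theorem as an estimate -/

section Divergence

open scoped ENNReal

/-- Every unit vector is the vertical direction of some orthogonal coordinate system. -/
theorem exists_vertical_eq (ξ : E3) (hξ : ‖ξ‖ = 1) : ∃ T : E3 ≃ₗᵢ[ℝ] E3, vertical T = ξ := by
  -- Reflection in the hyperplane bisecting ξ and the third basis vector interchanges these two unit
  -- vectors and is its own inverse.
  refine ⟨(Submodule.reflection (ℝ ∙ (ξ - EuclideanSpace.single 2 1))ᗮ), ?_⟩
  rw [vertical, Submodule.reflection_symm]
  have h := Submodule.reflection_sub (v := ξ) (w := EuclideanSpace.single 2 1) (by simp [hξ])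
  calc _ = _ := congrArg _ h.symm
    _ = ξ := Submodule.reflection_reflection _ _

theorem measurableEmbedding_ofCoords (T : E3 ≃ₗᵢ[ℝ] E3) :
    MeasurableEmbedding fun q : (Fin 2 → ℝ) × ℝ => ofCoords T q.1 q.2 := by
  refine (continuous_ofCoords T).measurableEmbedding fun q r hqr => ?_
  have h1 := congrArg (baseProj T) hqr
  have h2 := congrArg (fun x => T x 2) hqr
  simp only [baseProj_ofCoords, height_ofCoords] at h1 h2
  exact Prod.ext h1 h2

/-- The set of all `a + s ξ` with `a ∈ A` and `0 ≤ s ≤ t`. -/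
def tube (A : Set E3) (ξ : E3) (t : ℝ) : Set E3 := {x | ∃ a ∈ A, ∃ s ∈ Set.Icc 0 t, x = a + s • ξ}

/-- With ξ vertical, the tube lies over the projection of `A`. Heights in `A` differ by at most `t`
from that of a fixed point, and the shift adds at most `t`, so an interval of length `3 * t`
contains them all. -/
theorem volume_tube_le {A : Set E3} {ξ : E3} (hξ : ‖ξ‖ = 1) {t : ℝ}
    (hA : ∀ x ∈ A, ∀ y ∈ A, dist x y ≤ t) :
    volume (tube A ξ t) ≤ ENNReal.ofReal (3 * t) * Measure.hausdorffMeasure 2 A := by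
  rcases A.eq_empty_or_nonempty with rfl | ⟨a₀, ha₀⟩
  · simp [tube]
  obtain ⟨T, rfl⟩ := exists_vertical_eq ξ hξ
  have hsub : (fun q : (Fin 2 → ℝ) × ℝ => ofCoords T q.1 q.2) ⁻¹' tube A (vertical T) t ⊆
      (baseProj T '' A) ×ˢ Set.Icc (T a₀ 2 - t) (T a₀ 2 + 2 * t) := by
    rintro ⟨y, r⟩ ⟨a, ha, s, hs, heq⟩
    have h1 := congrArg (baseProj T) heq
    have h2 := congrArg (fun x => T x 2) heq
    simp only [baseProj_ofCoords, height_ofCoords, baseProj_add_smul_vertical] at h1 h2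
    have h3 : |T a 2 - T a₀ 2| ≤ t := by
      have := PiLp.norm_apply_le (T a - T a₀) 2
      rw [← map_sub, T.norm_map, map_sub, ← dist_eq_norm] at this
      exact this.trans (hA a ha a₀ ha₀)
    rw [abs_le] at h3
    have h4 : r = T a 2 + s := by simpa using h2
    refine ⟨⟨a, ha, h1.symm⟩, ?_, ?_⟩ <;> simp only [h4] <;> linarith [hs.1, hs.2]
  rw [← (measurePreserving_ofCoords T).measure_preimage_emb (measurableEmbedding_ofCoords T)]
  refine (measure_mono hsub).trans ?_
  rw [Measure.volume_eq_prod, Measure.prod_prod, Real.volume_Icc, mul_comm]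
  refine mul_le_mul' (le_of_eq ?_) (volume_baseProj_image_le T A)
  congr 1; ring

/-- A set without frontier points on a segment contains both endpoints or neither. -/
theorem exists_mem_frontier_of_mem_of_notMem {Ω : Set E3} {x ξ : E3} {t : ℝ} (ht : 0 ≤ t)
    (h : ¬ (x ∈ Ω ↔ x - t • ξ ∈ Ω)) : ∃ s ∈ Set.Icc 0 t, x - s • ξ ∈ frontier Ω := by
  by_contra! hcon
  apply h
  have hcont : Continuous fun s : ℝ => x - s • ξ := by fun_prop
  set f : Set.Icc (0 : ℝ) t → E3 := fun s => x - (s : ℝ) • ξ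
  have hf : Continuous f := hcont.comp continuous_subtype_val
  have hfr : frontier (f ⁻¹' Ω) = ∅ := by
    refine Set.eq_empty_of_subset_empty ((hf.frontier_preimage_subset Ω).trans ?_)
    intro s hs
    exact hcon s s.2 hs
  have : PreconnectedSpace (Set.Icc (0 : ℝ) t) := Subtype.preconnectedSpace isPreconnected_Icc
  have h0 : x ∈ Ω ↔ (⟨0, le_rfl, ht⟩ : Set.Icc (0 : ℝ) t) ∈ f ⁻¹' Ω := by simp [f]
  have h1 : x - t • ξ ∈ Ω ↔ (⟨t, ht, le_rfl⟩ : Set.Icc (0 : ℝ) t) ∈ f ⁻¹' Ω := by simp [f]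
  rw [h0, h1]
  rcases frontier_eq_empty_iff.1 hfr with h | h <;> simp [h]

/-- A countable measurable partition of `E3` into sets of diameter at most `t`. -/
theorem exists_partition_dist_le {t : ℝ} (ht : 0 < t) :
    ∃ B : ℕ → Set E3, (∀ n, MeasurableSet (B n)) ∧ Pairwise (Function.onFun Disjoint B) ∧
      (⋃ n, B n) = Set.univ ∧ ∀ n, ∀ x ∈ B n, ∀ y ∈ B n, dist x y ≤ t := by
  refine ⟨disjointed fun n => Metric.ball (TopologicalSpace.denseSeq E3 n) (t / 2), ?_,
    disjoint_disjointed _, ?_, ?_⟩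
  · exact fun n => MeasurableSet.disjointed (fun n => measurableSet_ball) n
  · rw [iUnion_disjointed, Set.eq_univ_iff_forall]
    intro x
    obtain ⟨n, hn⟩ := (TopologicalSpace.denseRange_denseSeq E3).exists_dist_lt x (half_pos ht)
    exact Set.mem_iUnion.2 ⟨n, hn⟩
  · intro n x hx y hy
    have hx' := disjointed_subset _ n hx
    have hy' := disjointed_subset _ n hy
    rw [Metric.mem_ball] at hx' hy'
    linarith [dist_triangle_right x y (TopologicalSpace.denseSeq E3 n)]

/-- Any point of the tube is within `2 * t` of every point of `A`: at most `t` along ξ and `t`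
inside `A`. By the Lipschitz bound |φ| on the tube is at most the infimum over `A` of |φ| + 2Mt, and
`volume_tube_le` converts volume into area. -/
theorem setLIntegral_tube_le {A : Set E3} (hA : MeasurableSet A) {ξ : E3} (hξ : ‖ξ‖ = 1) {t : ℝ}
    (ht : 0 ≤ t) (hAt : ∀ x ∈ A, ∀ y ∈ A, dist x y ≤ t) {φ : E3 → ℂ} {M : ℝ≥0}
    (hφ : LipschitzWith M φ) :
    ∫⁻ x in tube A ξ t, ‖φ x‖ₑ ≤ ENNReal.ofReal (3 * t) *
      ∫⁻ x in A, (‖φ x‖ₑ + ENNReal.ofReal (M * (2 * t))) ∂(Measure.hausdorffMeasure 2) := by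
  set g : E3 → ℝ≥0∞ := fun x => ‖φ x‖ₑ + ENNReal.ofReal (M * (2 * t)) with hg
  set c : ℝ≥0∞ := ⨅ a ∈ A, g a with hc
  -- Measurability of the tube is not established, so the pointwise bound is placed on its
  -- measurable hull, cut down to where the bound holds.
  set S := toMeasurable volume (tube A ξ t) ∩ {x | ‖φ x‖ₑ ≤ c} with hS
  have hφm : Measurable φ := hφ.continuous.measurable
  have hSm : MeasurableSet S :=
    (measurableSet_toMeasurable _ _).inter (measurableSet_le hφm.enorm measurable_const)
  have hsub : tube A ξ t ⊆ S := by
    intro x hx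
    refine ⟨subset_toMeasurable _ _ hx, ?_⟩
    rw [Set.mem_ofPred_eq, hc]
    refine le_iInf₂ fun a ha => ?_
    obtain ⟨b, hb, s, hs, rfl⟩ := hx
    have h1 : dist (b + s • ξ) a ≤ 2 * t := by
      calc dist (b + s • ξ) a ≤ dist (b + s • ξ) b + dist b a := dist_triangle _ _ _
        _ ≤ s + t := by
          refine add_le_add ?_ (hAt b hb a ha)
          rw [dist_eq_norm, add_sub_cancel_left, norm_smul, hξ, mul_one, Real.norm_eq_abs,
            abs_of_nonneg hs.1]
        _ ≤ 2 * t := by linarith [hs.2]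
    have h2 : ‖φ (b + s • ξ)‖ ≤ ‖φ a‖ + M * (2 * t) := by
      have h3 := hφ.dist_le_mul (b + s • ξ) a
      rw [dist_eq_norm] at h3
      have h4 : ‖φ (b + s • ξ)‖ ≤ ‖φ a‖ + ‖φ (b + s • ξ) - φ a‖ := norm_le_norm_add_norm_sub' _ _
      have h5 : (M : ℝ) * dist (b + s • ξ) a ≤ M * (2 * t) := by gcongr
      linarith
    rw [hg]
    simp only [← ofReal_norm]
    rw [← ENNReal.ofReal_add (norm_nonneg _) (by positivity)]
    exact ENNReal.ofReal_le_ofReal h2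
  calc ∫⁻ x in tube A ξ t, ‖φ x‖ₑ ≤ ∫⁻ x in S, ‖φ x‖ₑ := lintegral_mono_set hsub
    _ ≤ ∫⁻ x in S, c := setLIntegral_mono' hSm fun x hx => hx.2
    _ = c * volume S := by simp
    _ ≤ c * volume (tube A ξ t) := by
      refine mul_le_mul_right ?_ c
      exact (measure_mono Set.inter_subset_left).trans (measure_toMeasurable _).le
    _ ≤ c * (ENNReal.ofReal (3 * t) * Measure.hausdorffMeasure 2 A) := by
      gcongr
      exact volume_tube_le hξ hAt
    _ = ENNReal.ofReal (3 * t) * ∫⁻ x in A, c ∂(Measure.hausdorffMeasure 2) := by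
      simp; ring
    _ ≤ _ := by
      gcongr ENNReal.ofReal (3 * t) * ?_
      exact setLIntegral_mono' hA fun x hx => iInf₂_le x hx

/-- Moving the shift from φ to Ω leaves an integral over the symmetric difference of Ω and Ω + tξ.
Each of its points is reached from a boundary point by moving at most `t` along ξ. Crossings in `Z`
fill only a null set; the others lie in tubes over small pieces of the boundary. -/
theorem enorm_integral_shift_sub_le {Ω : Set E3} (hΩ : MeasurableSet Ω) {ξ : E3} (hξ : ‖ξ‖ = 1)
    {t : ℝ} (ht : 0 < t) {φ : E3 → ℂ} {M : ℝ≥0} (hφ : LipschitzWith M φ)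
    (hsupp : HasCompactSupport φ) {Z : Set E3} (hZm : MeasurableSet Z)
    (hZ : volume {x | ∃ z ∈ Z, ∃ s : ℝ, x = z + s • ξ} = 0) :
    ‖∫ x in Ω, (φ (x + t • ξ) - φ x)‖ₑ ≤ ENNReal.ofReal (3 * t) *
      ∫⁻ x in frontier Ω \ Z, (‖φ x‖ₑ + ENNReal.ofReal (M * (2 * t)))
        ∂(Measure.hausdorffMeasure 2) := by
  have hint : Integrable φ := hφ.continuous.integrable_of_hasCompactSupport hsupp
  have hint' : Integrable fun x => φ (x + t • ξ) := hint.comp_add_right _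
  set S := {x | ¬ (x ∈ Ω ↔ x - t • ξ ∈ Ω)} with hS
  have hpre : MeasurableSet ((· - t • ξ) ⁻¹' Ω) := hΩ.preimage (measurable_id.sub_const _)
  have h1 : ∫ x in Ω, (φ (x + t • ξ) - φ x) =
      ∫ x, (((· - t • ξ) ⁻¹' Ω).indicator φ x - Ω.indicator φ x) := by
    rw [integral_sub hint'.integrableOn hint.integrableOn,
      integral_sub (hint.indicator hpre) (hint.indicator hΩ),
      integral_indicator hΩ, ← integral_indicator hΩ]
    congr 1
    rw [← integral_sub_right_eq_self (fun x => Ω.indicator (fun x => φ (x + t • ξ)) x) (t • ξ)]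
    congr 1
    funext x
    simp only [Set.indicator, sub_add_cancel]
    rfl
  have hSm : MeasurableSet S := by
    have h3 : MeasurableSet ((· - t • ξ) ⁻¹' Ω) := hΩ.preimage (measurable_id.sub_const _)
    have : S = symmDiff Ω ((· - t • ξ) ⁻¹' Ω) := by
      ext x
      simp only [hS, Set.mem_ofPred_eq, Set.mem_symmDiff, Set.mem_preimage]
      tauto
    rw [this]
    exact hΩ.symmDiff h3
  have h2 : ∀ x, ‖((· - t • ξ) ⁻¹' Ω).indicator φ x - Ω.indicator φ x‖ₑ ≤
      S.indicator (fun x => ‖φ x‖ₑ) x := by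
    intro x
    by_cases hx1 : x ∈ Ω <;> by_cases hx2 : x - t • ξ ∈ Ω <;> simp [hx1, hx2, hS]
  obtain ⟨B, hBm, hBd, hBu, hBt⟩ := exists_partition_dist_le ht
  set A : ℕ → Set E3 := fun n => B n ∩ (frontier Ω \ Z) with hA
  have hFm : MeasurableSet (frontier Ω \ Z) := isClosed_frontier.measurableSet.diff hZm
  have hAm : ∀ n, MeasurableSet (A n) := fun n => (hBm n).inter hFm
  have hAu : (⋃ n, A n) = frontier Ω \ Z := by
    rw [hA, ← Set.iUnion_inter, hBu, Set.univ_inter]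
  have hcover : S ⊆ {x | ∃ z ∈ Z, ∃ s : ℝ, x = z + s • ξ} ∪ ⋃ n, tube (A n) ξ t := by
    intro x hx
    obtain ⟨s, hs, hxs⟩ := exists_mem_frontier_of_mem_of_notMem ht.le hx
    have hxeq : x = (x - s • ξ) + s • ξ := by abel
    by_cases hxZ : x - s • ξ ∈ Z
    · exact Or.inl ⟨_, hxZ, s, hxeq⟩
    · have : x - s • ξ ∈ ⋃ n, A n := by rw [hAu]; exact ⟨hxs, hxZ⟩
      obtain ⟨n, hn⟩ := Set.mem_iUnion.1 this
      exact Or.inr (Set.mem_iUnion.2 ⟨n, _, hn, s, hs, hxeq⟩)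
  rw [h1]
  calc ‖∫ x, (((· - t • ξ) ⁻¹' Ω).indicator φ x - Ω.indicator φ x)‖ₑ
      ≤ ∫⁻ x, ‖((· - t • ξ) ⁻¹' Ω).indicator φ x - Ω.indicator φ x‖ₑ :=
        enorm_integral_le_lintegral_enorm _
    _ ≤ ∫⁻ x, S.indicator (fun x => ‖φ x‖ₑ) x := lintegral_mono h2
    _ = ∫⁻ x in S, ‖φ x‖ₑ := lintegral_indicator hSm _
    _ ≤ ∫⁻ x in {x | ∃ z ∈ Z, ∃ s : ℝ, x = z + s • ξ} ∪ ⋃ n, tube (A n) ξ t, ‖φ x‖ₑ :=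
        lintegral_mono_set hcover
    _ ≤ (∫⁻ x in {x | ∃ z ∈ Z, ∃ s : ℝ, x = z + s • ξ}, ‖φ x‖ₑ) +
          ∫⁻ x in ⋃ n, tube (A n) ξ t, ‖φ x‖ₑ := lintegral_union_le _ _ _
    _ = ∫⁻ x in ⋃ n, tube (A n) ξ t, ‖φ x‖ₑ := by
        rw [setLIntegral_measure_zero _ _ hZ, zero_add]
    _ ≤ ∑' n, ∫⁻ x in tube (A n) ξ t, ‖φ x‖ₑ := lintegral_iUnion_le _ _
    _ ≤ ∑' n, ENNReal.ofReal (3 * t) * ∫⁻ x in A n, (‖φ x‖ₑ + ENNReal.ofReal (M * (2 * t)))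
          ∂(Measure.hausdorffMeasure 2) :=
        ENNReal.tsum_le_tsum fun n => setLIntegral_tube_le (hAm n) hξ ht.le
          (fun x hx y hy => hBt n x hx.1 y hy.1) hφ
    _ = _ := by
        rw [ENNReal.tsum_mul_left, ← lintegral_iUnion hAm, hAu]
        exact fun i j hij => (hBd hij).mono Set.inter_subset_left Set.inter_subset_left

/-- **Divergence estimate**: the integral over `Ω` of a directional derivative is controlled by the
boundary values on the part of the boundary that is not swept out tangentially. -/
theorem enorm_integral_fderiv_le {Ω : Set E3} (hΩ : IsOpen Ω) (hbd : Bornology.IsBounded Ω)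
    (hfin : (Measure.hausdorffMeasure 2 : Measure E3) (frontier Ω) ≠ ⊤) {ξ : E3} (hξ : ‖ξ‖ = 1)
    {φ : E3 → ℂ} (hφ : ContDiff ℝ 1 φ) (hsupp : HasCompactSupport φ) {Z : Set E3}
    (hZm : MeasurableSet Z) (hZ : volume {x | ∃ z ∈ Z, ∃ s : ℝ, x = z + s • ξ} = 0) :
    ‖∫ x in Ω, fderiv ℝ φ x ξ‖ₑ ≤ 3 * ∫⁻ x in frontier Ω \ Z, ‖φ x‖ₑ
        ∂(Measure.hausdorffMeasure 2) := by
  obtain ⟨M, hM⟩ := hφ.lipschitzWith_of_hasCompactSupport hsupp one_ne_zero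
  have hvol : volume Ω ≠ ⊤ := hbd.measure_lt_top.ne
  have : IsFiniteMeasure (volume.restrict Ω) := ⟨by simpa using hbd.measure_lt_top⟩
  set I : ℝ≥0∞ := ∫⁻ x in frontier Ω \ Z, ‖φ x‖ₑ ∂(Measure.hausdorffMeasure 2) with hI
  set m : ℝ≥0∞ := Measure.hausdorffMeasure 2 (frontier Ω \ Z) with hm
  have hm' : m ≠ ⊤ := ((measure_mono Set.sdiff_subset).trans_lt hfin.lt_top).ne
  -- Difference quotients of φ are dominated by its Lipschitz constant, which is integrable on the
  -- bounded set Ω.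
  have hlim : Tendsto (fun t : ℝ => ∫ x in Ω, t⁻¹ • (φ (x + t • ξ) - φ x)) (𝓝[>] 0)
      (𝓝 (∫ x in Ω, fderiv ℝ φ x ξ)) := by
    refine tendsto_integral_filter_of_dominated_convergence (fun _ => (M : ℝ)) ?_ ?_
      (integrable_const _) ?_
    · refine Eventually.of_forall fun t => ?_
      have : Continuous fun x => t⁻¹ • (φ (x + t • ξ) - φ x) := by
        have := hφ.continuous
        fun_prop
      exact this.aestronglyMeasurable
    · filter_upwards [self_mem_nhdsWithin] with t ht
      refine Eventually.of_forall fun x => ?_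
      have ht : 0 < t := ht
      have h1 := hM.dist_le_mul (x + t • ξ) x
      rw [dist_eq_norm, dist_eq_norm, add_sub_cancel_left, norm_smul, hξ, mul_one,
        Real.norm_eq_abs, abs_of_pos ht] at h1
      rw [norm_smul, norm_inv, Real.norm_eq_abs, abs_of_pos ht, inv_mul_le_iff₀ ht, mul_comm]
      exact h1
    · refine Eventually.of_forall fun x => ?_
      have h1 : HasFDerivAt φ (fderiv ℝ φ x) x :=
        (hφ.differentiable one_ne_zero x).hasFDerivAt
      have h2 := h1.hasLineDerivAt ξ
      exact h2.tendsto_slope_zero_right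
  -- The factor `t⁻¹` cancels the thickness `3 * t` of the tubes. The remaining error vanishes as `t
  -- → 0` because the boundary has finite area.
  have hbound : ∀ᶠ t : ℝ in 𝓝[>] 0, ‖∫ x in Ω, t⁻¹ • (φ (x + t • ξ) - φ x)‖ₑ ≤
      3 * (I + ENNReal.ofReal (M * (2 * t)) * m) := by
    filter_upwards [self_mem_nhdsWithin] with t ht
    have ht : 0 < t := ht
    have h1 := enorm_integral_shift_sub_le hΩ.measurableSet hξ ht hM hsupp hZm hZ
    rw [lintegral_add_right _ measurable_const, setLIntegral_const, ← hI, ← hm] at h1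
    rw [integral_smul, enorm_smul]
    calc ‖t⁻¹‖ₑ * ‖∫ x in Ω, (φ (x + t • ξ) - φ x)‖ₑ
        ≤ ‖t⁻¹‖ₑ * (ENNReal.ofReal (3 * t) * (I + ENNReal.ofReal (M * (2 * t)) * m)) := by gcongr
      _ = 3 * (I + ENNReal.ofReal (M * (2 * t)) * m) := by
        rw [← mul_assoc]
        congr 1
        rw [Real.enorm_eq_ofReal (by positivity), ← ENNReal.ofReal_mul (by positivity)]
        rw [show t⁻¹ * (3 * t) = 3 by field_simp]
        simp
  have hlim2 : Tendsto (fun t : ℝ => 3 * (I + ENNReal.ofReal (M * (2 * t)) * m)) (𝓝[>] 0)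
      (𝓝 (3 * (I + ENNReal.ofReal (M * (2 * 0)) * m))) := by
    refine ENNReal.Tendsto.const_mul ?_ (Or.inr (by simp))
    refine tendsto_const_nhds.add ?_
    refine ENNReal.Tendsto.mul_const ?_ (Or.inr hm')
    refine (ENNReal.tendsto_ofReal ?_).mono_left nhdsWithin_le_nhds
    have : Continuous fun t : ℝ => (M : ℝ) * (2 * t) := by fun_prop
    exact this.tendsto 0
  have := le_of_tendsto_of_tendsto hlim.enorm hlim2 hbound
  simpa using this

end Divergence

/-! ### The trace inequality -/

section TraceInequality

open scoped ENNReal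

/-- Integrate the derivative of (1 - s/r)|ψ(s)|²: the weight is 1 at 0 and kills the other endpoint.
Its slope produces `r⁻¹`, and the product term is absorbed by 2ab ≤ a² + b². -/
theorem sq_norm_zero_le_integral {ψ : ℝ → ℂ} (hψ : ContDiff ℝ 1 ψ) {r : ℝ} (hr : 0 < r) :
    ‖ψ 0‖ ^ 2 ≤ ∫ s in (0 : ℝ)..r, (r⁻¹ + 1) * (‖ψ s‖ ^ 2 + ‖deriv ψ s‖ ^ 2) := by
  have hd : ∀ s, HasDerivAt ψ (deriv ψ s) s := fun s =>
    (hψ.differentiable one_ne_zero s).hasDerivAt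
  have hψc : Continuous ψ := hψ.continuous
  have hdc : Continuous (deriv ψ) := hψ.continuous_deriv le_rfl
  set g : ℝ → ℝ := fun s => (1 - s / r) * ‖ψ s‖ ^ 2
  set g' : ℝ → ℝ := fun s => (-(1 / r)) * ‖ψ s‖ ^ 2 + (1 - s / r) * (2 * inner ℝ (ψ s) (deriv ψ s))
  have hg : ∀ s, HasDerivAt g (g' s) s := by
    intro s
    have h1 : HasDerivAt (fun s : ℝ => 1 - s / r) (-(1 / r)) s := by
      simpa using ((hasDerivAt_id s).div_const r).const_sub 1
    have h2 : HasDerivAt (fun s => ‖ψ s‖ ^ 2) (2 * inner ℝ (ψ s) (deriv ψ s)) s := (hd s).norm_sq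
    exact h1.mul h2
  have hg'c : Continuous g' := by fun_prop
  have hFTC : ∫ s in (0 : ℝ)..r, g' s = g r - g 0 :=
    intervalIntegral.integral_eq_sub_of_hasDerivAt (fun s _ => hg s) (hg'c.intervalIntegrable _ _)
  have h0 : g r - g 0 = -‖ψ 0‖ ^ 2 := by simp [g, hr.ne']
  have h1 : ‖ψ 0‖ ^ 2 = ∫ s in (0 : ℝ)..r, -g' s := by
    rw [intervalIntegral.integral_neg, hFTC, h0, neg_neg]
  rw [h1]
  refine intervalIntegral.integral_mono_on hr.le (hg'c.neg.intervalIntegrable _ _) ?_ ?_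
  · refine Continuous.intervalIntegrable ?_ _ _
    fun_prop
  · intro s hs
    have h2 : |(1 - s / r) * (2 * inner ℝ (ψ s) (deriv ψ s))| ≤
        ‖ψ s‖ ^ 2 + ‖deriv ψ s‖ ^ 2 := by
      have h3 : |1 - s / r| ≤ 1 := by
        have h4 : 0 ≤ s / r := div_nonneg hs.1 hr.le
        have h5 : s / r ≤ 1 := (div_le_one hr).2 hs.2
        rw [abs_le]; constructor <;> linarith
      have h4 := abs_real_inner_le_norm (ψ s) (deriv ψ s)
      rw [abs_mul, abs_mul, abs_two]
      nlinarith [sq_nonneg (‖ψ s‖ - ‖deriv ψ s‖), abs_nonneg (1 - s / r),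
        abs_nonneg (inner ℝ (ψ s) (deriv ψ s))]
    have h3 := neg_abs_le ((1 - s / r) * (2 * inner ℝ (ψ s) (deriv ψ s)))
    have h4 : 0 ≤ r⁻¹ * ‖deriv ψ s‖ ^ 2 := by positivity
    simp only [g', one_div]
    nlinarith

theorem enorm_sq_zero_le_lintegral {ψ : ℝ → ℂ} (hψ : ContDiff ℝ 1 ψ) {r : ℝ} (hr : 0 < r) :
    ‖ψ 0‖ₑ ^ 2 ≤ ENNReal.ofReal (r⁻¹ + 1) *
      ∫⁻ s in Set.Ioc 0 r, (‖ψ s‖ₑ ^ 2 + ‖deriv ψ s‖ₑ ^ 2) := by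
  have h1 := sq_norm_zero_le_integral hψ hr
  have hψc : Continuous ψ := hψ.continuous
  have hdc : Continuous (deriv ψ) := hψ.continuous_deriv le_rfl
  have hc : Continuous fun s => (r⁻¹ + 1) * (‖ψ s‖ ^ 2 + ‖deriv ψ s‖ ^ 2) := by fun_prop
  rw [intervalIntegral.integral_of_le hr.le] at h1
  have h2 := ENNReal.ofReal_le_ofReal h1
  rw [ofReal_integral_eq_lintegral_ofReal hc.integrableOn_Ioc
    (Eventually.of_forall fun s => by positivity)] at h2
  have h3 : ∀ z : ℂ, ENNReal.ofReal (‖z‖ ^ 2) = ‖z‖ₑ ^ 2 := fun z => by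
    rw [ENNReal.ofReal_pow (norm_nonneg _), ofReal_norm]
  rw [← lintegral_const_mul _ (by fun_prop)]
  rw [h3] at h2
  refine h2.trans (le_of_eq (lintegral_congr fun s => ?_))
  rw [ENNReal.ofReal_mul (by positivity), ENNReal.ofReal_add (sq_nonneg ‖ψ s‖) (sq_nonneg ‖deriv ψ
    s‖),
    h3, h3]

/-- The density of the squared `H¹` norm. -/
noncomputable def sobolevDensity (φ : E3 → ℂ) (x : E3) : ℝ≥0∞ := ‖φ x‖ₑ ^ 2 + ‖fderiv ℝ φ x‖ₑ ^ 2

theorem measurable_sobolevDensity {φ : E3 → ℂ} (hφ : ContDiff ℝ 1 φ) :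
    Measurable (sobolevDensity φ) := by
  have h1 : Continuous φ := hφ.continuous
  have h2 : Continuous (fderiv ℝ φ) := hφ.continuous_fderiv one_ne_zero
  unfold sobolevDensity
  exact (by fun_prop : Continuous fun x => ‖φ x‖ₑ ^ 2 + ‖fderiv ℝ φ x‖ₑ ^ 2).measurable

/-- Flattens the graph: on each vertical fibre the map is a reflection followed by a shift. Only
continuity of `h` is needed, and no Jacobian appears. -/
theorem measurePreserving_graph_sub (T : E3 ≃ₗᵢ[ℝ] E3) {h : (Fin 2 → ℝ) → ℝ} (hh : Continuous h) :
    MeasurePreserving (fun q : (Fin 2 → ℝ) × ℝ => ofCoords T q.1 (h q.1 - q.2)) := by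
  have h1 : MeasurePreserving (fun q : (Fin 2 → ℝ) × ℝ => (q.1, h q.1 - q.2))
      (volume.prod volume) (volume.prod volume) := by
    refine (MeasurePreserving.id volume).skew_product (g := fun y s => h y - s) ?_ ?_
    · exact (by fun_prop : Continuous (Function.uncurry fun y s => h y - s)).measurable
    · exact Eventually.of_forall fun y => (Measure.measurePreserving_sub_left volume (h y)).map_eq
  exact (measurePreserving_ofCoords T).comp h1

variable {T : E3 ≃ₗᵢ[ℝ] E3} {Ω : Set E3} {h : (Fin 2 → ℝ) → ℝ} {K : ℝ≥0} {U : Set E3}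

/-- The one-dimensional inequality is applied on the vertical segment of length `r` below each
boundary point. From the ball of radius `r` these segments stay in the ball of radius `2 * r`, hence
in the chart and in Ω, and Fubini sums them. -/
theorem IsGraphChart.setLIntegral_le (hc : IsGraphChart Ω T h K U) (hΩ : IsOpen Ω) {p : E3} {r : ℝ}
    (hr : 0 < r) (hU : Metric.ball p (2 * r) ⊆ U) {φ : E3 → ℂ} (hφ : ContDiff ℝ 1 φ) :
    ∫⁻ x in Metric.ball p r ∩ frontier Ω, ‖φ x‖ₑ ^ 2 ∂(Measure.hausdorffMeasure 2) ≤
      ((2 + K : ℝ≥0) : ℝ≥0∞) ^ 2 * ENNReal.ofReal (r⁻¹ + 1) * ∫⁻ x in Ω, sobolevDensity φ x := by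
  set S := Metric.ball p r ∩ frontier Ω with hS
  have hSU : S ⊆ U := fun x hx => hU (Metric.ball_subset_ball (by linarith) hx.1)
  have hSm : MeasurableSet S := measurableSet_ball.inter isClosed_frontier.measurableSet
  have hγ : Continuous (graphMap T h) := (lipschitzWith_graphMap hc.lipschitz).continuous
  have hγm : MeasurableSet (graphMap T h ⁻¹' S) := hγ.measurable hSm
  set L : ℝ≥0∞ := ((2 + K : ℝ≥0) : ℝ≥0∞) ^ 2 with hL
  have hle : (Measure.hausdorffMeasure 2 : Measure E3).restrict S ≤
      L • (volume.restrict (graphMap T h ⁻¹' S)).map (graphMap T h) := by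
    refine Measure.le_iff.2 fun A hA => ?_
    rw [Measure.restrict_apply hA, Measure.smul_apply, Measure.map_apply hγ.measurable hA,
      Measure.restrict_apply (hγ.measurable hA), smul_eq_mul, ← Set.preimage_inter]
    have h1 := hc.surfaceMeasure_le hΩ (A ∩ S)
    have h2 : A ∩ S ∩ U ∩ frontier Ω = A ∩ S := by
      ext x
      constructor
      · exact fun hx => hx.1.1
      · exact fun hx => ⟨⟨hx, hSU hx.2⟩, hx.2.2⟩
    rwa [h2] at h1
  have hφm : Measurable fun x => ‖φ x‖ₑ ^ 2 := by
    have := hφ.continuous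
    exact (by fun_prop : Continuous fun x => ‖φ x‖ₑ ^ 2).measurable
  have hfib : ∀ y, ‖φ (graphMap T h y)‖ₑ ^ 2 ≤ ENNReal.ofReal (r⁻¹ + 1) *
      ∫⁻ s in Set.Ioc 0 r, sobolevDensity φ (ofCoords T y (h y - s)) := by
    intro y
    set ψ : ℝ → ℂ := fun s => φ (graphMap T h y - s • vertical T) with hψ
    have hline : ∀ s, HasDerivAt (fun s : ℝ => graphMap T h y - s • vertical T) (-vertical T) s :=
      by
      intro s
      simpa using ((hasDerivAt_id s).smul_const (vertical T)).const_sub (graphMap T h y)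
    have hψd : ContDiff ℝ 1 ψ := by
      refine hφ.comp ?_
      fun_prop
    have hder : ∀ s, deriv ψ s = fderiv ℝ φ (graphMap T h y - s • vertical T) (-vertical T) := by
      intro s
      exact ((hφ.differentiable one_ne_zero _).hasFDerivAt.comp_hasDerivAt s (hline s)).deriv
    have h1 := enorm_sq_zero_le_lintegral hψd hr
    have h0 : ψ 0 = φ (graphMap T h y) := by simp [hψ]
    rw [h0] at h1
    refine h1.trans ?_
    refine mul_le_mul_right (lintegral_mono fun s => ?_) _
    rw [ofCoords_sub]
    unfold sobolevDensity
    gcongr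
    · exact le_rfl
    · rw [hder]
      refine (ContinuousLinearMap.le_opENorm _ _).trans ?_
      rw [enorm_neg, ← ofReal_norm (vertical T), norm_vertical]
      simp [graphMap]
  calc ∫⁻ x in S, ‖φ x‖ₑ ^ 2 ∂(Measure.hausdorffMeasure 2)
      ≤ ∫⁻ x, ‖φ x‖ₑ ^ 2 ∂(L • (volume.restrict (graphMap T h ⁻¹' S)).map (graphMap T h)) :=
        lintegral_mono' hle le_rfl
    _ = L * ∫⁻ y in graphMap T h ⁻¹' S, ‖φ (graphMap T h y)‖ₑ ^ 2 := by
        rw [lintegral_smul_measure, lintegral_map hφm hγ.measurable, smul_eq_mul]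
    _ ≤ L * ∫⁻ y in graphMap T h ⁻¹' S, ENNReal.ofReal (r⁻¹ + 1) *
          ∫⁻ s in Set.Ioc 0 r, sobolevDensity φ (ofCoords T y (h y - s)) := by
        gcongr with y
        exact hfib y
    _ = L * ENNReal.ofReal (r⁻¹ + 1) * ∫⁻ y in graphMap T h ⁻¹' S,
          ∫⁻ s in Set.Ioc 0 r, sobolevDensity φ (ofCoords T y (h y - s)) := by
        rw [lintegral_const_mul' _ _ (by simp), mul_assoc]
    _ ≤ _ := by
        refine mul_le_mul_right ?_ _
        have hm := measurePreserving_graph_sub T hc.lipschitz.continuous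
        have hFm := measurable_sobolevDensity hφ
        have hFΦ : Measurable fun q : (Fin 2 → ℝ) × ℝ =>
          sobolevDensity φ (ofCoords T q.1 (h q.1 - q.2)) := hFm.comp hm.measurable
        rw [← setLIntegral_prod _ hFΦ.aemeasurable, ← lintegral_indicator hΩ.measurableSet,
          ← hm.lintegral_comp (hFm.indicator hΩ.measurableSet),
          ← lintegral_indicator (hγm.prod measurableSet_Ioc), ← Measure.volume_eq_prod]
        refine lintegral_mono fun q => ?_
        by_cases hq : q ∈ (graphMap T h ⁻¹' S) ×ˢ Set.Ioc 0 r
        swap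
        · rw [Set.indicator_of_notMem hq]; exact zero_le
        rw [Set.indicator_of_mem hq]
        have hmem : ofCoords T q.1 (h q.1 - q.2) ∈ Ω := by
          have h1 : graphMap T h q.1 - q.2 • vertical T ∈ U := by
            apply hU
            have h2 := Metric.mem_ball.1 hq.1.1
            rw [Metric.mem_ball]
            calc dist (graphMap T h q.1 - q.2 • vertical T) p
                ≤ dist (graphMap T h q.1 - q.2 • vertical T) (graphMap T h q.1) +
                  dist (graphMap T h q.1) p := dist_triangle _ _ _
              _ < r + r := by
                refine add_lt_add_of_le_of_lt ?_ h2
                rw [dist_eq_norm, sub_sub_cancel_left, norm_neg, norm_smul, norm_vertical, mul_one,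
                  Real.norm_eq_abs, abs_of_pos hq.2.1]
                exact hq.2.2
              _ = 2 * r := by ring
          rw [ofCoords_sub]
          refine (hc.mem_iff _ h1).2 ?_
          rw [baseProj_sub_smul_vertical, height_sub_smul_vertical]
          simp only [graphMap, height_ofCoords, baseProj_ofCoords]
          exact sub_lt_self _ hq.2.1
        rw [Set.indicator_of_mem hmem]

/-- **Trace inequality** for functions that are continuously differentiable up to the boundary. -/
theorem IsBoundedLipschitzDomain.exists_trace_inequality (hΩ : IsBoundedLipschitzDomain Ω) :
    ∃ C : ℝ≥0, ∀ φ : E3 → ℂ, ContDiff ℝ 1 φ →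
      ∫⁻ x, ‖φ x‖ₑ ^ 2 ∂(surfaceMeasure Ω) ≤ C * ∫⁻ x in Ω, sobolevDensity φ x := by
  have key := hΩ.isCompact_frontier.induction_on (p := fun S => ∃ C : ℝ≥0, ∀ φ : E3 → ℂ,
    ContDiff ℝ 1 φ → ∫⁻ x in S ∩ frontier Ω, ‖φ x‖ₑ ^ 2 ∂(Measure.hausdorffMeasure 2) ≤
      C * ∫⁻ x in Ω, sobolevDensity φ x) ?_ ?_ ?_ ?_
  · simpa [surfaceMeasure] using key
  · exact ⟨0, by simp⟩
  · rintro S S' hS ⟨C, hC⟩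
    exact ⟨C, fun φ hφ => (lintegral_mono_set (Set.inter_subset_inter_left _ hS)).trans (hC φ hφ)⟩
  · rintro S S' ⟨C, hC⟩ ⟨C', hC'⟩
    refine ⟨C + C', fun φ hφ => ?_⟩
    rw [Set.union_inter_distrib_right, ENNReal.coe_add, add_mul]
    exact (lintegral_union_le _ _ _).trans (add_le_add (hC φ hφ) (hC' φ hφ))
  · intro p hp
    obtain ⟨T, h, K, U, hc, hpU⟩ := hΩ.exists_chart hp
    obtain ⟨ε, hε, hεU⟩ := Metric.isOpen_iff.1 hc.isOpen p hpU
    refine ⟨Metric.ball p (ε / 2), mem_nhdsWithin_of_mem_nhds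
      (Metric.ball_mem_nhds p (half_pos hε)), (2 + K) ^ 2 * Real.toNNReal ((ε / 2)⁻¹ + 1),
      fun φ hφ => ?_⟩
    have := hc.setLIntegral_le hΩ.isOpen (p := p) (half_pos hε)
      (by rwa [mul_div_cancel₀ _ (two_ne_zero)]) hφ
    simpa [ENNReal.ofReal] using this

end TraceInequality

/-! ### Weak gradients -/

section WeakGradient

open scoped ENNReal ComplexConjugate

variable {Ω : Set E3}

/-- Pairings with test functions become inner products with the conjugate of ψ, which makes their
linearity and continuity in `u` immediate. -/
theorem exists_inner_eq_integral {ψ : E3 → ℂ} (hψ : MemLp ψ 2 (volume.restrict Ω)) :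
    ∃ c : L2 Ω, ‖c‖ = (eLpNorm ψ 2 (volume.restrict Ω)).toReal ∧
      ∀ u : L2 Ω, ∫ x in Ω, u x * ψ x = inner ℂ c u := by
  have hc : MemLp (fun x => conj (ψ x)) 2 (volume.restrict Ω) := hψ.star
  refine ⟨hc.toLp _, ?_, fun u => ?_⟩
  · rw [Lp.norm_toLp]
    congr 1
    refine eLpNorm_congr_norm_ae (Eventually.of_forall fun x => ?_)
    simp
  · rw [L2.inner_def]
    refine integral_congr_ae ?_
    filter_upwards [hc.coeFn_toLp] with x hx
    rw [hx, RCLike.inner_apply, RingHomCompTriple.comp_apply, RingHom.id_apply]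

namespace IsTestFunction

variable {φ ψ : E3 → ℂ}

theorem memLp (hφ : IsTestFunction Ω φ) (μ : Measure E3) [IsFiniteMeasureOnCompacts μ] :
    MemLp φ 2 μ := hφ.contDiff.continuous.memLp_of_hasCompactSupport hφ.hasCompactSupport

theorem add (hφ : IsTestFunction Ω φ) (hψ : IsTestFunction Ω ψ) :
    IsTestFunction Ω (fun x => φ x + ψ x) :=
  ⟨hφ.contDiff.add hψ.contDiff, hφ.hasCompactSupport.add hψ.hasCompactSupport,
    (tsupport_add φ ψ).trans (Set.union_subset hφ.tsupport_subset hψ.tsupport_subset)⟩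

theorem const_mul (hφ : IsTestFunction Ω φ) (c : ℂ) : IsTestFunction Ω (fun x => c * φ x) :=
  ⟨contDiff_const.mul hφ.contDiff, hφ.hasCompactSupport.mul_left,
    (closure_mono (Function.support_mul_subset_right _ _)).trans hφ.tsupport_subset⟩

theorem partialDeriv (hφ : IsTestFunction Ω φ) (j : Fin 3) :
    IsTestFunction Ω (partialDeriv j φ) :=
  ⟨(hφ.contDiff.fderiv_right (m := ∞) (by simp)).clm_apply contDiff_const,
    hφ.hasCompactSupport.fderiv_apply ℝ _,
    (tsupport_fderiv_apply_subset ℝ _).trans hφ.tsupport_subset⟩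

theorem star (hφ : IsTestFunction Ω φ) : IsTestFunction Ω (fun x => conj (φ x)) :=
  ⟨Complex.conjCLE.contDiff.comp hφ.contDiff,
    hφ.hasCompactSupport.comp_left (g := fun z : ℂ => conj z) (map_zero _),
    (closure_mono (fun x hx => by
      simpa using hx)).trans hφ.tsupport_subset⟩

end IsTestFunction

theorem eq_zero_of_integral_mul_test_eq_zero (hΩ : IsOpen Ω) (u : L2 Ω)
    (h : ∀ φ, IsTestFunction Ω φ → ∫ x in Ω, u x * φ x = 0) : u = 0 := by
  have hloc : LocallyIntegrableOn u Ω volume :=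
    locallyIntegrableOn_of_locallyIntegrable_restrict ((Lp.memLp u).locallyIntegrable one_le_two)
  have key := hΩ.ae_eq_zero_of_integral_contDiff_smul_eq_zero hloc ?_
  · refine (Lp.eq_zero_iff_ae_eq_zero).2 ?_
    exact (ae_restrict_iff' hΩ.measurableSet).2 key
  · intro g hg hgc hgs
    have hφ : IsTestFunction Ω (fun x => (g x : ℂ)) :=
      ⟨Complex.ofRealCLM.contDiff.comp hg, hgc.comp_left (g := fun r : ℝ => (r : ℂ)) (by simp),
        (closure_mono (fun x hx => by simpa using hx)).trans hgs⟩
    rw [← h _ hφ, setIntegral_eq_integral_of_forall_compl_eq_zero]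
    · refine integral_congr_ae (Eventually.of_forall fun x => ?_)
      simp [mul_comm]
    · intro x hx
      have : g x = 0 := image_eq_zero_of_notMem_tsupport fun hx' => hx (hgs hx')
      simp [this]

/-- The subspace of `L²(Ω)` formed by the test functions. -/
noncomputable def testSubmodule (Ω : Set E3) : Submodule ℂ (L2 Ω) where
  carrier := {c | ∃ φ, IsTestFunction Ω φ ∧ c =ᵐ[volume.restrict Ω] φ}
  zero_mem' := ⟨fun _ => 0, ⟨contDiff_const, HasCompactSupport.zero, by simp [tsupport]⟩,
    Lp.coeFn_zero _ _ _⟩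
  add_mem' := by
    rintro a b ⟨φ, hφ, ha⟩ ⟨ψ, hψ, hb⟩
    exact ⟨_, hφ.add hψ, (Lp.coeFn_add a b).trans (ha.add hb)⟩
  smul_mem' := by
    rintro c a ⟨φ, hφ, ha⟩
    exact ⟨_, hφ.const_mul c, (Lp.coeFn_smul c a).trans (ha.const_smul c)⟩

theorem testSubmodule_dense (hΩ : IsOpen Ω) : (testSubmodule Ω).topologicalClosure = ⊤ := by
  rw [Submodule.topologicalClosure_eq_top_iff, Submodule.eq_bot_iff]
  intro u hu
  refine eq_zero_of_integral_mul_test_eq_zero hΩ u fun φ hφ => ?_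
  have hφc := hφ.star.memLp (volume.restrict Ω)
  have h1 := hu (hφc.toLp _) ⟨_, hφ.star, hφc.coeFn_toLp⟩
  rw [L2.inner_def] at h1
  rw [← h1]
  refine integral_congr_ae ?_
  filter_upwards [hφc.coeFn_toLp] with x hx
  simp [hx]

/-- The bound on a functional over test functions bounds the norm of the representing function. -/
theorem norm_le_of_forall_test (hΩ : IsOpen Ω) (D : L2 Ω) {R : ℝ} (hR : 0 ≤ R)
    (h : ∀ φ, IsTestFunction Ω φ →
      ‖∫ x in Ω, D x * φ x‖ ≤ R * (eLpNorm φ 2 (volume.restrict Ω)).toReal) : ‖D‖ ≤ R := by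
  have hcl : IsClosed {c : L2 Ω | ‖inner ℂ c D‖ ≤ R * ‖c‖} :=
    isClosed_le (by fun_prop) (by fun_prop)
  have hsub : (testSubmodule Ω : Set (L2 Ω)) ⊆ {c : L2 Ω | ‖inner ℂ c D‖ ≤ R * ‖c‖} := by
    rintro c ⟨φ, hφ, hc⟩
    have h1 := h _ hφ.star
    have h2 : ∫ x in Ω, D x * conj (φ x) = inner ℂ c D := by
      rw [L2.inner_def]
      refine integral_congr_ae ?_
      filter_upwards [hc] with x hx
      simp [hx]
    have h3 : (eLpNorm (fun x => conj (φ x)) 2 (volume.restrict Ω)).toReal = ‖c‖ := by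
      rw [Lp.norm_def]
      congr 1
      refine eLpNorm_congr_norm_ae ?_
      filter_upwards [hc] with x hx
      simp [hx]
    rwa [h2, h3] at h1
  have hD : D ∈ closure (testSubmodule Ω : Set (L2 Ω)) := by
    have : D ∈ (testSubmodule Ω).topologicalClosure := by rw [testSubmodule_dense hΩ]; trivial
    exact this
  -- By density the bound holds for every `c` in L², in particular for `c = D`.
  have h1 : ‖inner ℂ D D‖ ≤ R * ‖D‖ := closure_minimal hsub hcl hD
  rw [inner_self_eq_norm_sq_to_K, norm_pow, RCLike.norm_ofReal, abs_norm, sq] at h1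
  rcases (norm_nonneg D).eq_or_lt with h0 | h0
  · rw [← h0]
    exact hR
  · exact le_of_mul_le_mul_right h1 h0

theorem HasWeakGradient.unique (hΩ : IsOpen Ω) {u : L2 Ω} {G G' : Fin 3 → L2 Ω}
    (h : HasWeakGradient Ω u G) (h' : HasWeakGradient Ω u G') : G = G' := by
  funext j
  rw [← sub_eq_zero]
  refine eq_zero_of_integral_mul_test_eq_zero hΩ _ fun φ hφ => ?_
  obtain ⟨c, -, hc⟩ := exists_inner_eq_integral (hφ.memLp (volume.restrict Ω))
  have h1 := h φ hφ j
  rw [h' φ hφ j, hc, hc, neg_inj] at h1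
  rw [hc, inner_sub_right, h1, sub_self]

/-- The ambient Hilbert space of pairs `(u, G)` in `L²(Ω) × L²(Ω)³`. -/
abbrev SobolevPair (Ω : Set E3) : Type := WithLp 2 (L2 Ω × PiLp 2 fun _ : Fin 3 => L2 Ω)

/-- The Sobolev space `H¹(Ω)`, as the space of pairs of a function and its weak gradient. -/
noncomputable def sobolevH1 (Ω : Set E3) : Submodule ℂ (SobolevPair Ω) where
  carrier := {x | HasWeakGradient Ω x.fst x.snd}
  zero_mem' := by
    intro φ hφ j
    obtain ⟨c, -, hc⟩ := exists_inner_eq_integral (hφ.memLp (volume.restrict Ω))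
    obtain ⟨c', -, hc'⟩ := exists_inner_eq_integral ((hφ.partialDeriv j).memLp (volume.restrict Ω))
    rw [hc, hc']
    simp
  add_mem' := by
    intro x y hx hy φ hφ j
    have hx := hx φ hφ j
    have hy := hy φ hφ j
    obtain ⟨c, -, hc⟩ := exists_inner_eq_integral (hφ.memLp (volume.restrict Ω))
    obtain ⟨c', -, hc'⟩ := exists_inner_eq_integral ((hφ.partialDeriv j).memLp (volume.restrict Ω))
    rw [hc, hc'] at *
    rw [WithLp.add_fst, WithLp.add_snd, PiLp.add_apply, inner_add_right, inner_add_right, hx, hy]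
    ring
  smul_mem' := by
    intro a x hx φ hφ j
    have hx := hx φ hφ j
    obtain ⟨c, -, hc⟩ := exists_inner_eq_integral (hφ.memLp (volume.restrict Ω))
    obtain ⟨c', -, hc'⟩ := exists_inner_eq_integral ((hφ.partialDeriv j).memLp (volume.restrict Ω))
    rw [hc, hc'] at *
    rw [WithLp.smul_fst, WithLp.smul_snd, PiLp.smul_apply, inner_smul_right, inner_smul_right, hx]
    ring

theorem mem_sobolevH1 {x : SobolevPair Ω} :
    x ∈ sobolevH1 Ω ↔ HasWeakGradient Ω x.fst x.snd := Iff.rfl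

/-- Each test function and index impose an equation between two continuous functionals. Closedness
supplies the completeness required by the spectral theory. -/
theorem isClosed_sobolevH1 (Ω : Set E3) : IsClosed (sobolevH1 Ω : Set (SobolevPair Ω)) := by
  have : (sobolevH1 Ω : Set (SobolevPair Ω)) = ⋂ φ : {φ // IsTestFunction Ω φ}, ⋂ j : Fin 3,
      {x | ∫ y in Ω, x.fst y * partialDeriv j φ.1 y = -∫ y in Ω, x.snd j y * φ.1 y} := by
    ext x
    simp only [SetLike.mem_coe, mem_sobolevH1, Set.mem_iInter, Set.mem_ofPred_eq, Subtype.forall]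
    rfl
  rw [this]
  refine isClosed_iInter fun φ => isClosed_iInter fun j => ?_
  obtain ⟨c, -, hc⟩ := exists_inner_eq_integral (φ.2.memLp (volume.restrict Ω))
  obtain ⟨c', -, hc'⟩ := exists_inner_eq_integral ((φ.2.partialDeriv j).memLp (volume.restrict Ω))
  simp only [hc, hc']
  have h1 : Continuous fun x : SobolevPair Ω => x.fst := by fun_prop
  have h2 : Continuous fun x : SobolevPair Ω => x.snd j := by fun_prop
  exact isClosed_eq (by fun_prop) (by fun_prop)

end WeakGradient

/-! ### Translation estimate -/

section Translation

open scoped ENNReal ComplexConjugate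

variable {Ω : Set E3}

theorem IsTestFunction.comp_add {A : Set E3} {φ : E3 → ℂ} (hφ : IsTestFunction A φ) (w : E3)
    (h : ∀ x ∈ A, x - w ∈ Ω) : IsTestFunction Ω (fun x => φ (x + w)) := by
  refine ⟨hφ.contDiff.comp (contDiff_id.add contDiff_const),
    hφ.hasCompactSupport.comp_homeomorph (Homeomorph.addRight w), ?_⟩
  have := tsupport_comp_eq_preimage φ (Homeomorph.addRight w)
  intro x hx
  have hx' : x ∈ tsupport (φ ∘ Homeomorph.addRight w) := hx
  rw [this] at hx'
  have := h _ (hφ.tsupport_subset hx')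
  simpa using this

theorem fderiv_apply_eq_sum (φ : E3 → ℂ) (x v : E3) :
    fderiv ℝ φ x v = ∑ j, (v j : ℂ) * partialDeriv j φ x := by
  have hv : v = ∑ j, v j • EuclideanSpace.single j (1 : ℝ) := by
    have := (EuclideanSpace.basisFun (Fin 3) ℝ).sum_repr v
    simpa [EuclideanSpace.basisFun_apply] using this.symm
  conv_lhs => rw [hv]
  rw [map_sum]
  refine Finset.sum_congr rfl fun j _ => ?_
  rw [map_smul, Complex.real_smul]
  rfl

theorem norm_sum_mul_inner_le (v : E3) (c : L2 Ω) (G : PiLp 2 fun _ : Fin 3 => L2 Ω) :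
    ‖∑ j, (v j : ℂ) * inner ℂ c (G j)‖ ≤ ‖v‖ * ‖G‖ * ‖c‖ := by
  have h1 : ∑ j, |v j| * ‖G j‖ ≤ ‖v‖ * ‖G‖ := by
    refine abs_le_of_sq_le_sq' ?_ (by positivity) |>.2
    refine (Finset.sum_mul_sq_le_sq_mul_sq _ _ _).trans (le_of_eq ?_)
    rw [mul_pow, EuclideanSpace.norm_sq_eq, PiLp.norm_sq_eq_of_L2]
    simp
  calc ‖∑ j, (v j : ℂ) * inner ℂ c (G j)‖ ≤ ∑ j, ‖(v j : ℂ) * inner ℂ c (G j)‖ := norm_sum_le _ _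
    _ ≤ ∑ j, |v j| * ‖G j‖ * ‖c‖ := by
      refine Finset.sum_le_sum fun j _ => ?_
      rw [norm_mul, Complex.norm_real, Real.norm_eq_abs, mul_assoc]
      gcongr
      rw [mul_comm]
      exact norm_inner_le_norm _ _
    _ ≤ _ := by
      rw [← Finset.sum_mul]
      gcongr

/-- The translation falls on the test function, so `u` need not be approximated by smooth functions.
As τ runs through [0, 1] the shifted test function stays supported in Ω, and the weak gradient
computes the τ-derivative of the pairing. -/
theorem norm_integral_translate_sub_le (hbd : Bornology.IsBounded Ω) {u : L2 Ω}
    {G : PiLp 2 fun _ : Fin 3 => L2 Ω} (hu : HasWeakGradient Ω u G) {A : Set E3} {v : E3}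
    (hA : ∀ x ∈ A, ∀ τ ∈ Set.Icc (0 : ℝ) 1, x - τ • v ∈ Ω) {φ : E3 → ℂ} (hφ : IsTestFunction A φ) :
    ‖(∫ x in Ω, u x * φ (x + v)) - ∫ x in Ω, u x * φ x‖ ≤
      ‖v‖ * ‖G‖ * (eLpNorm φ 2 (volume.restrict A)).toReal := by
  have : IsFiniteMeasure (volume.restrict Ω) := ⟨by simpa using hbd.measure_lt_top⟩
  have hφc : Continuous φ := hφ.contDiff.continuous
  have hφd : Continuous (fderiv ℝ φ) := hφ.contDiff.continuous_fderiv (by simp)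
  have hui : Integrable u (volume.restrict Ω) := (Lp.memLp u).integrable one_le_two
  obtain ⟨B, hB⟩ := hφd.bounded_above_of_compact_support (hφ.hasCompactSupport.fderiv ℝ)
  obtain ⟨B', hB'⟩ := hφc.bounded_above_of_compact_support hφ.hasCompactSupport
  set m' : ℝ → ℂ := fun τ => ∫ x in Ω, u x * fderiv ℝ φ (x + τ • v) v with hm'
  have hder : ∀ τ : ℝ, HasDerivAt (fun τ : ℝ => ∫ x in Ω, u x * φ (x + τ • v)) (m' τ) τ := by
    intro τ
    refine (hasDerivAt_integral_of_dominated_loc_of_deriv_le (bound := fun x => ‖u x‖ * (B * ‖v‖))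
      (F := fun (τ : ℝ) x => u x * φ (x + τ • v))
      (F' := fun (τ : ℝ) x => u x * fderiv ℝ φ (x + τ • v) v)
      univ_mem ?_ ?_ ?_ ?_ ?_ ?_).2
    · refine Eventually.of_forall fun τ => hui.aestronglyMeasurable.mul ?_
      exact (by fun_prop : Continuous fun x => φ (x + τ • v)).aestronglyMeasurable
    · refine hui.mul_bdd (c := B') ?_ (Eventually.of_forall fun x => hB' _)
      exact (by fun_prop : Continuous fun x => φ (x + τ • v)).aestronglyMeasurable
    · refine hui.aestronglyMeasurable.mul ?_
      exact (by fun_prop : Continuous fun x => fderiv ℝ φ (x + τ • v) v).aestronglyMeasurable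
    · refine Eventually.of_forall fun x τ _ => ?_
      rw [norm_mul]
      gcongr
      exact (ContinuousLinearMap.le_opNorm _ _).trans (by gcongr; exact hB _)
    · exact hui.norm.mul_const _
    · refine Eventually.of_forall fun x τ _ => ?_
      refine HasDerivAt.const_mul _ ?_
      have h1 : HasDerivAt (fun τ : ℝ => x + τ • v) v τ := by
        simpa using ((hasDerivAt_id τ).smul_const v).const_add x
      exact (hφ.contDiff.differentiable (by simp) _).hasFDerivAt.comp_hasDerivAt τ h1
  have hbound : ∀ τ ∈ Set.Icc (0 : ℝ) 1,
      ‖m' τ‖ ≤ ‖v‖ * ‖G‖ * (eLpNorm φ 2 (volume.restrict A)).toReal := by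
    intro τ hτ
    have hφτ : IsTestFunction Ω (fun x => φ (x + τ • v)) :=
      hφ.comp_add _ fun x hx => hA x hx τ hτ
    obtain ⟨c, hcn, hc⟩ := exists_inner_eq_integral (hφτ.memLp (volume.restrict Ω))
    have h1 : m' τ = -∑ j, (v j : ℂ) * inner ℂ c (G j) := by
      have h2 : ∀ x, u x * fderiv ℝ φ (x + τ • v) v =
          ∑ j, (v j : ℂ) * (u x * partialDeriv j (fun x => φ (x + τ • v)) x) := by
        intro x
        rw [← fderiv_comp_add_right, fderiv_apply_eq_sum, Finset.mul_sum]
        refine Finset.sum_congr rfl fun j _ => by ring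
      rw [hm']
      simp only [h2]
      rw [integral_finsetSum, ← Finset.sum_neg_distrib]
      · refine Finset.sum_congr rfl fun j _ => ?_
        rw [integral_const_mul, hu _ hφτ j, hc, mul_neg]
      · intro j _
        refine Integrable.const_mul ?_ _
        exact (Lp.memLp u).integrable_mul ((hφτ.partialDeriv j).memLp (volume.restrict Ω))
    rw [h1, norm_neg]
    refine (norm_sum_mul_inner_le v c G).trans ?_
    gcongr
    rw [hcn]
    refine ENNReal.toReal_mono ((hφ.memLp (volume.restrict A)).eLpNorm_ne_top) ?_
    have h3 : eLpNorm φ 2 (volume.restrict A) = eLpNorm φ 2 volume :=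
      eLpNorm_restrict_eq_of_support_subset ((subset_tsupport φ).trans hφ.tsupport_subset)
    rw [h3, ← eLpNorm_comp_measurePreserving (f := fun x => x + τ • v) hφc.aestronglyMeasurable
      (measurePreserving_add_right volume (τ • v))]
    exact eLpNorm_mono_measure _ Measure.restrict_le_self
  have := norm_image_sub_le_of_norm_deriv_le_segment_01'
    (fun τ hτ => (hder τ).hasDerivWithinAt) (fun τ hτ => hbound τ ⟨hτ.1, hτ.2.le⟩)
  simpa using this

/-- Dual form of the preceding estimate: test functions on `A` determine the norm, and a
substitution moves the shift from φ back to `u`. -/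
theorem eLpNorm_translate_sub_le (hΩ : IsOpen Ω) (hbd : Bornology.IsBounded Ω) {u : L2 Ω}
    {G : PiLp 2 fun _ : Fin 3 => L2 Ω} (hu : HasWeakGradient Ω u G) {A : Set E3} (hAo : IsOpen A)
    {v : E3} (hA : ∀ x ∈ A, ∀ τ ∈ Set.Icc (0 : ℝ) 1, x - τ • v ∈ Ω) :
    eLpNorm (fun x => u x - u (x - v)) 2 (volume.restrict A) ≤ ENNReal.ofReal (‖v‖ * ‖G‖) := by
  have hAΩ : A ⊆ Ω := fun x hx => by simpa using hA x hx 0 (by simp)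
  have hAv : A ⊆ (fun x => x - v) ⁻¹' Ω := fun x hx => by simpa using hA x hx 1 (by simp)
  have hm : MeasurePreserving (fun x => x - v) (volume.restrict ((fun x => x - v) ⁻¹' Ω))
      (volume.restrict Ω) :=
    (measurePreserving_sub_right volume v).restrict_preimage hΩ.measurableSet
  have h1 : MemLp u 2 (volume.restrict A) := (Lp.memLp u).mono_measure (Measure.restrict_mono_set _
    hAΩ)
  have h2 : MemLp (fun x => u (x - v)) 2 (volume.restrict A) :=
    ((Lp.memLp u).comp_measurePreserving hm).mono_measure (Measure.restrict_mono_set _ hAv)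
  have hd : MemLp (fun x => u x - u (x - v)) 2 (volume.restrict A) := h1.sub h2
  set D : L2 A := hd.toLp _ with hD
  have key : ‖D‖ ≤ ‖v‖ * ‖G‖ := by
    refine norm_le_of_forall_test hAo D (by positivity) fun φ hφ => ?_
    have hφA := hφ.memLp (volume.restrict A)
    have h3 : ∫ x in A, D x * φ x = (∫ x in A, u x * φ x) - ∫ x in A, u (x - v) * φ x := by
      refine (integral_congr_ae ?_).trans
        (integral_sub (h1.integrable_mul hφA) (h2.integrable_mul hφA))
      filter_upwards [hd.coeFn_toLp] with x hx
      rw [hx, sub_mul]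
    have h0 : ∀ x, x ∉ A → φ x = 0 := fun x hx =>
      image_eq_zero_of_notMem_tsupport fun hx' => hx (hφ.tsupport_subset hx')
    have h4 : ∫ x in A, u x * φ x = ∫ x in Ω, u x * φ x :=
      (setIntegral_eq_of_subset_of_forall_sdiff_eq_zero hΩ.measurableSet hAΩ
        fun x hx => by rw [h0 x hx.2, mul_zero]).symm
    have h5 : ∫ x in A, u (x - v) * φ x = ∫ x in Ω, u x * φ (x + v) := by
      rw [← setIntegral_eq_of_subset_of_forall_sdiff_eq_zero
        (hΩ.measurableSet.preimage (measurePreserving_sub_right volume v).measurable) hAv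
        (f := fun x => u (x - v) * φ x) fun x hx => by rw [h0 x hx.2, mul_zero]]
      rw [← (measurePreserving_sub_right volume v).setIntegral_preimage_emb
        (measurableEmbedding_subRight v) (fun x => u x * φ (x + v)) Ω]
      simp
    rw [h3, h4, h5, norm_sub_rev]
    exact norm_integral_translate_sub_le hbd hu hA hφ
  rw [hD, Lp.norm_toLp] at key
  exact ENNReal.le_ofReal_iff_toReal_le hd.eLpNorm_ne_top (by positivity) |>.2 key

theorem lintegral_translate_sub_le (hΩ : IsOpen Ω) (hbd : Bornology.IsBounded Ω) {u : L2 Ω}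
    {G : PiLp 2 fun _ : Fin 3 => L2 Ω} (hu : HasWeakGradient Ω u G) {A : Set E3} (hAo : IsOpen A)
    {v : E3} (hA : ∀ x ∈ A, ∀ τ ∈ Set.Icc (0 : ℝ) 1, x - τ • v ∈ Ω) :
    ∫⁻ x in A, ‖u x - u (x - v)‖ₑ ^ 2 ≤ ENNReal.ofReal (‖v‖ * ‖G‖) ^ 2 := by
  have := eLpNorm_translate_sub_le hΩ hbd hu hAo hA
  have h2 := eLpNorm_nnreal_pow_eq_lintegral (μ := volume.restrict A)
    (f := fun x => u x - u (x - v)) (p := 2) two_ne_zero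
  simp only [NNReal.coe_ofNat, ENNReal.coe_ofNat, ENNReal.rpow_ofNat] at h2
  rw [← h2]
  gcongr

end Translation

/-! ### Compactness of the embedding `H¹(Ω) → L²(Ω)` -/

section Rellich

open scoped ENNReal

variable {Ω : Set E3}

theorem exists_finite_partition_dist_le {A : Set E3} (hA : Bornology.IsBounded A) {t : ℝ}
    (ht : 0 < t) : ∃ (n : ℕ) (B : Fin n → Set E3), (∀ i, MeasurableSet (B i)) ∧
      Pairwise (Function.onFun Disjoint B) ∧ A ⊆ (⋃ i, B i) ∧
      ∀ i, ∀ x ∈ B i, ∀ y ∈ B i, dist x y ≤ t := by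
  obtain ⟨s, -, hs, hcov⟩ := finite_cover_balls_of_compact
    (Metric.isCompact_of_isClosed_isBounded isClosed_closure hA.closure) (half_pos ht)
  obtain ⟨n, f, rfl⟩ : ∃ (n : ℕ) (f : Fin n → E3), Set.range f = s := by
    obtain ⟨n, f, hf⟩ := hs.fin_param
    exact ⟨n, f, hf.2⟩
  refine ⟨n, disjointed fun i => Metric.ball (f i) (t / 2), ?_, disjoint_disjointed _, ?_, ?_⟩
  · intro i
    rw [disjointed_apply, Finset.sup_set_eq_biUnion]
    exact measurableSet_ball.diff (Finset.measurableSet_biUnion _ fun j _ => measurableSet_ball)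
  · rw [iUnion_disjointed]
    refine (subset_closure.trans hcov).trans ?_
    simp
  · intro n x hx y hy
    have hx' := disjointed_subset _ n hx
    have hy' := disjointed_subset _ n hy
    rw [Metric.mem_ball] at hx' hy'
    linarith [dist_triangle_right x y (f n)]

theorem sq_setLIntegral_le {f : E3 → ℝ≥0∞} (hf : Measurable f) (D : Set E3) :
    (∫⁻ y in D, f y) ^ 2 ≤ volume D * ∫⁻ y in D, f y ^ 2 := by
  have h := ENNReal.lintegral_mul_le_Lp_mul_Lq (volume.restrict D) Real.HolderConjugate.two_two
    hf.aemeasurable (aemeasurable_const (b := (1 : ℝ≥0∞)))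
  simp only [Pi.mul_apply, mul_one, lintegral_const, one_pow, one_mul,
    Measure.restrict_apply_univ, ENNReal.rpow_ofNat] at h
  calc (∫⁻ y in D, f y) ^ 2
      ≤ ((∫⁻ y in D, f y ^ 2) ^ (1 / 2 : ℝ) * volume D ^ (1 / 2 : ℝ)) ^ 2 := by gcongr
    _ = volume D * ∫⁻ y in D, f y ^ 2 := by
      rw [mul_pow, ← ENNReal.rpow_natCast, ← ENNReal.rpow_natCast, ← ENNReal.rpow_mul,
        ← ENNReal.rpow_mul]
      norm_num
      ring

theorem enorm_sq_eq_ofReal (z : ℂ) : ‖z‖ₑ ^ 2 = ENNReal.ofReal (‖z‖ ^ 2) := by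
  rw [ENNReal.ofReal_pow (norm_nonneg _), ofReal_norm]

theorem enorm_add_sq_le (a b : ℂ) : ‖a + b‖ₑ ^ 2 ≤ 2 * ‖a‖ₑ ^ 2 + 2 * ‖b‖ₑ ^ 2 := by
  simp only [enorm_sq_eq_ofReal]
  rw [← ENNReal.ofReal_ofNat 2, ← ENNReal.ofReal_mul (by positivity),
    ← ENNReal.ofReal_mul (by positivity), ← ENNReal.ofReal_add (by positivity) (by positivity)]
  refine ENNReal.ofReal_le_ofReal ?_
  have := norm_add_le a b
  nlinarith [norm_nonneg a, norm_nonneg b, norm_nonneg (a + b), sq_nonneg (‖a‖ - ‖b‖)]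

/-- Comparison of the value at a point with the average over a ball. -/
theorem exists_average_functional {D : Set E3} (hD : MeasurableSet D) (hDΩ : D ⊆ Ω)
    (h0 : volume D ≠ 0) (htop : volume D ≠ ⊤) : ∃ c : L2 Ω, ∀ (u : L2 Ω) (z : ℂ),
      ‖z‖ₑ ^ 2 ≤ 2 * ((volume D)⁻¹ * ∫⁻ y in D, ‖z - u y‖ₑ ^ 2) + 2 * ‖(inner ℂ c u : ℂ)‖ₑ ^ 2 := by
  set V : ℝ := (volume D).toReal with hV
  have hVpos : 0 < V := ENNReal.toReal_pos h0 htop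
  have : IsFiniteMeasure (volume.restrict D) := ⟨by simpa using htop.lt_top⟩
  -- The element `c` represents the mean value over `D`; the first term of the bound is then
  -- Cauchy–Schwarz for the mean of `z - u`.
  have hψ : MemLp (D.indicator fun _ => ((V⁻¹ : ℝ) : ℂ)) 2 (volume.restrict Ω) :=
    (memLp_indicator_const 2 hD _ (Or.inr htop)).mono_measure Measure.restrict_le_self
  obtain ⟨c, -, hc⟩ := exists_inner_eq_integral hψ
  refine ⟨c, fun u z => ?_⟩
  have hui : IntegrableOn u D := by
    have : MemLp u 2 (volume.restrict D) := (Lp.memLp u).mono_measure (Measure.restrict_mono_set _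
      hDΩ)
    exact this.integrable one_le_two
  have h1 : inner ℂ c u = ((V⁻¹ : ℝ) : ℂ) * ∫ y in D, u y := by
    rw [← hc, ← integral_const_mul]
    have : ∀ x, u x * D.indicator (fun _ => ((V⁻¹ : ℝ) : ℂ)) x =
        D.indicator (fun x => ((V⁻¹ : ℝ) : ℂ) * u x) x := by
      intro x
      by_cases hx : x ∈ D <;> simp [hx, mul_comm]
    simp only [this]
    rw [setIntegral_indicator hD, Set.inter_eq_self_of_subset_right hDΩ]
  have h2 : z - inner ℂ c u = ((V⁻¹ : ℝ) : ℂ) * ∫ y in D, (z - u y) := by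
    have hVc : (V : ℂ) ≠ 0 := by exact_mod_cast hVpos.ne'
    rw [integral_sub (integrable_const _) hui, setIntegral_const, h1, Measure.real, ← hV,
      Complex.real_smul, mul_sub]
    push_cast
    field_simp
  have h3 : ‖z - inner ℂ c u‖ₑ ^ 2 ≤ (volume D)⁻¹ * ∫⁻ y in D, ‖z - u y‖ₑ ^ 2 := by
    have hum : Measurable fun y => ‖z - u y‖ₑ :=
      (measurable_const.sub (Lp.stronglyMeasurable u).measurable).enorm
    have hVe : ‖((V⁻¹ : ℝ) : ℂ)‖ₑ = (volume D)⁻¹ := by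
      rw [← ofReal_norm, Complex.norm_real, Real.norm_eq_abs, abs_of_pos (by positivity),
        ENNReal.ofReal_inv_of_pos hVpos, ENNReal.ofReal_toReal htop]
    calc ‖z - inner ℂ c u‖ₑ ^ 2 = ((volume D)⁻¹ * ‖∫ y in D, (z - u y)‖ₑ) ^ 2 := by
          rw [h2, enorm_mul, hVe]
      _ ≤ ((volume D)⁻¹ * ∫⁻ y in D, ‖z - u y‖ₑ) ^ 2 := by
          gcongr; exact enorm_integral_le_lintegral_enorm _
      _ = (volume D)⁻¹ * (volume D)⁻¹ * (∫⁻ y in D, ‖z - u y‖ₑ) ^ 2 := by ring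
      _ ≤ (volume D)⁻¹ * (volume D)⁻¹ * (volume D * ∫⁻ y in D, ‖z - u y‖ₑ ^ 2) := by
          gcongr; exact sq_setLIntegral_le hum D
      _ = (volume D)⁻¹ * ((volume D)⁻¹ * volume D) * ∫⁻ y in D, ‖z - u y‖ₑ ^ 2 := by ring
      _ = _ := by rw [ENNReal.inv_mul_cancel h0 htop, mul_one]
  calc ‖z‖ₑ ^ 2 = ‖(z - inner ℂ c u) + inner ℂ c u‖ₑ ^ 2 := by rw [sub_add_cancel]
    _ ≤ 2 * ‖z - inner ℂ c u‖ₑ ^ 2 + 2 * ‖(inner ℂ c u : ℂ)‖ₑ ^ 2 := enorm_add_sq_le _ _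
    _ ≤ _ := by gcongr

/-- The cone condition: near `p`, small cones with a fixed axis and vertex in `Ω` lie in `Ω`. -/
def HasInnerCone (Ω : Set E3) (p : E3) : Prop :=
  ∃ (r θ s₀ : ℝ) (e : E3), 0 < r ∧ 0 < θ ∧ θ ≤ 1 ∧ 0 < s₀ ∧ ‖e‖ ≤ 1 ∧
    ∀ x ∈ Ω, dist x p < r → ∀ s ∈ Set.Icc 0 s₀, ∀ z : E3, ‖z‖ ≤ θ * s → x - (s • e + z) ∈ Ω

theorem IsBoundedLipschitzDomain.hasInnerCone (hΩ : IsBoundedLipschitzDomain Ω) {p : E3}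
    (hp : p ∈ closure Ω) : HasInnerCone Ω p := by
  by_cases hpΩ : p ∈ Ω
  · obtain ⟨ε, hε, hsub⟩ := Metric.isOpen_iff.1 hΩ.isOpen p hpΩ
    -- At an interior point the axis may be zero, the cones then being balls.
    refine ⟨ε / 2, 1, ε / 4, 0, by positivity, one_pos, le_rfl, by positivity, by simp, ?_⟩
    intro x _ hxp s hs z hz
    apply hsub
    rw [smul_zero, zero_add, Metric.mem_ball]
    calc dist (x - z) p ≤ dist (x - z) x + dist x p := dist_triangle _ _ _
      _ < ε / 4 + ε / 2 := by
        refine add_lt_add_of_le_of_lt ?_ hxp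
        rw [dist_eq_norm, sub_sub_cancel_left, norm_neg]
        linarith [hs.2]
      _ < ε := by linarith
  · have hpf : p ∈ frontier Ω := by rw [hΩ.isOpen.frontier_eq]; exact ⟨hp, hpΩ⟩
    obtain ⟨T, h, K, U, hc, hpU⟩ := hΩ.exists_chart hpf
    obtain ⟨ε, hε, hsub⟩ := Metric.isOpen_iff.1 hc.isOpen p hpU
    have hθ : (0 : ℝ) < 1 / (1 + K) := by positivity
    -- A displacement `z` changes the graph function by at most `K * ‖z‖` and the height by at most
    -- `‖z‖`. The opening `1 / (1 + K)` keeps the total below the descent `s`.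
    refine ⟨ε / 2, 1 / (1 + K), ε / 8, vertical T, by positivity, hθ, ?_, by positivity,
      by simp, ?_⟩
    · rw [div_le_one (by positivity)]; linarith [K.coe_nonneg]
    intro x hx hxp s hs z hz
    have hθ1 : 1 / (1 + (K : ℝ)) ≤ 1 := by
      rw [div_le_one (by positivity)]; linarith [K.coe_nonneg]
    have hzs : ‖z‖ ≤ s := hz.trans (mul_le_of_le_one_left hs.1 hθ1)
    have hxU : x ∈ U := hsub (Metric.ball_subset_ball (by linarith) hxp)
    have hyU : x - (s • vertical T + z) ∈ U := by
      apply hsub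
      rw [Metric.mem_ball]
      calc dist (x - (s • vertical T + z)) p
          ≤ dist (x - (s • vertical T + z)) x + dist x p := dist_triangle _ _ _
        _ < ε / 4 + ε / 2 := by
          refine add_lt_add_of_le_of_lt ?_ hxp
          rw [dist_eq_norm, sub_sub_cancel_left, norm_neg]
          refine (norm_add_le _ _).trans ?_
          rw [norm_smul, norm_vertical, mul_one, Real.norm_eq_abs, abs_of_nonneg hs.1]
          linarith [hs.2]
        _ < ε := by linarith
    rcases hs.1.eq_or_lt with h0 | hspos
    · have hz0 : z = 0 := by
        rw [← norm_le_zero_iff]; simpa [← h0] using hz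
      simpa [← h0, hz0] using hx
    have h1 := (hc.mem_iff x hxU).1 hx
    rw [hc.mem_iff _ hyU]
    have h2 : baseProj T (x - (s • vertical T + z)) = baseProj T (x - z) := by
      rw [add_comm, ← sub_sub, baseProj_sub_smul_vertical]
    have h3 : T (x - (s • vertical T + z)) 2 = T x 2 - T z 2 - s := by
      simp; ring
    have h4 : |h (baseProj T x) - h (baseProj T (x - z))| ≤ K * ‖z‖ := by
      rw [← Real.dist_eq]
      refine (hc.lipschitz.dist_le_mul _ _).trans ?_
      gcongr
      have := (lipschitzWith_baseProj T).dist_le_mul x (x - z)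
      simpa [dist_eq_norm] using this
    have h5 : |T z 2| ≤ ‖z‖ := by
      have := PiLp.norm_apply_le (T z) 2
      rwa [T.norm_map] at this
    have h6 : (1 + K) * ‖z‖ ≤ s := by
      rw [div_mul_eq_mul_div, one_mul, le_div_iff₀ (by positivity)] at hz
      linarith
    rw [h2, h3]
    rw [abs_le] at h4 h5
    linarith [h4.1, h4.2, h5.1, h5.2]

theorem setLIntegral_ball_le_shift {D W : Set E3} (hDm : MeasurableSet D) (hWm : MeasurableSet W)
    {x : E3} (h : ∀ v, x - v ∈ D → v ∈ W) (f : E3 → ℝ≥0∞) :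
    ∫⁻ y in D, f y ≤ ∫⁻ v in W, f (x - v) := by
  rw [← lintegral_indicator hDm, ← lintegral_indicator hWm,
    ← lintegral_sub_left_eq_self (D.indicator f) x]
  refine lintegral_mono fun v => ?_
  by_cases hv : x - v ∈ D
  · simp [hv, h v hv]
  · simp [hv]

/-- Local form of Friedrichs' inequality. -/
theorem exists_local_friedrichs (hΩ : IsOpen Ω) (hbd : Bornology.IsBounded Ω) {p : E3} {r θ s₀ : ℝ}
    {e : E3} (hθ : 0 < θ) (hθ1 : θ ≤ 1) (hs₀ : 0 < s₀) (he : ‖e‖ ≤ 1)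
    (hcone : ∀ x ∈ Ω, dist x p < r → ∀ s ∈ Set.Icc 0 s₀, ∀ z : E3, ‖z‖ ≤ θ * s →
      x - (s • e + z) ∈ Ω) {ε : ℝ} (hε : 0 < ε) :
    ∃ (n : ℕ) (c : Fin n → L2 Ω), ∀ x ∈ sobolevH1 Ω,
      ∫⁻ y in Metric.ball p r ∩ Ω, ‖x.fst y‖ₑ ^ 2 ≤
        ENNReal.ofReal (ε * ‖x.snd‖ ^ 2 + ∑ i, ‖(inner ℂ (c i) x.fst : ℂ)‖ ^ 2) := by
  set A := Metric.ball p r ∩ Ω with hA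
  have hAo : IsOpen A := Metric.isOpen_ball.inter hΩ
  -- The constant is 64 = 2 · 8 · 2²: 2 from splitting off the mean, 8 from the volume ratio of `W`
  -- to a ball of radius δ, and 2² from translations of length at most `2 * s`.
  obtain ⟨s, hs, hss, hsε⟩ : ∃ s, 0 < s ∧ s ≤ s₀ ∧ 64 * s ^ 2 ≤ ε := by
    refine ⟨min s₀ (Real.sqrt ε / 8), by positivity, min_le_left _ _, ?_⟩
    have h1 : min s₀ (Real.sqrt ε / 8) ≤ Real.sqrt ε / 8 := min_le_right _ _
    have h2 : 0 < min s₀ (Real.sqrt ε / 8) := by positivity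
    have h3 := Real.sq_sqrt hε.le
    nlinarith
  -- Half the opening is spent on the averaging ball and half on the diameter of a cell, so that `2
  -- * δ = θ * s`.
  set δ := θ * s / 2 with hδ
  have hδpos : 0 < δ := by positivity
  obtain ⟨n, B, hBm, hBd, hBu, hBt⟩ := exists_finite_partition_dist_le
    (hbd.subset (Set.inter_subset_right : A ⊆ Ω)) hδpos
  set V : ℝ≥0∞ := volume (Metric.ball (0 : E3) δ) with hV
  have hV0 : V ≠ 0 := (Metric.measure_ball_pos volume 0 hδpos).ne'
  have hVt : V ≠ ⊤ := measure_ball_lt_top.ne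
  set Q : Fin n → Set E3 := fun i => A ∩ B i with hQ
  -- For `x` in a cell and `y` in the averaging ball of that cell, `x - y` lies in `W`, whatever the
  -- cell. Comparing `u` with its means thus becomes an average of translation differences.
  set W := Metric.ball (s • e) (2 * δ) with hW
  have hWV : volume W = 8 * V := by
    have h8 : ENNReal.ofReal (2 ^ Module.finrank ℝ E3) = 8 := by
      rw [finrank_euclideanSpace_fin]; norm_num
    rw [hW, Measure.addHaar_ball_mul volume _ (by norm_num) δ, h8]
  have hball : ∀ y, volume (Metric.ball y δ) = V := fun y => by
    exact Measure.addHaar_ball_center (volume : Measure E3) y δ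
  -- averaging functionals, one for each cell
  have hcell : ∀ i, ∃ c : L2 Ω, ∀ (u : L2 Ω), ∀ x ∈ Q i,
      ‖u x‖ₑ ^ 2 ≤ 2 * (V⁻¹ * ∫⁻ v in W, ‖u x - u (x - v)‖ₑ ^ 2) +
        2 * ‖(inner ℂ c u : ℂ)‖ₑ ^ 2 := by
    intro i
    rcases (Q i).eq_empty_or_nonempty with hemp | ⟨x₀, hx₀⟩
    · exact ⟨0, fun u x hx => by simp [hemp] at hx⟩
    set D := Metric.ball (x₀ - s • e) δ with hD
    have hDΩ : D ⊆ Ω := by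
      intro y hy
      have h1 := hcone x₀ hx₀.1.2 hx₀.1.1 s ⟨hs.le, hss⟩ (x₀ - s • e - y) ?_
      · convert h1 using 1; abel
      · rw [norm_sub_rev, ← dist_eq_norm]
        have := Metric.mem_ball.1 hy
        linarith
    obtain ⟨c, hc⟩ := exists_average_functional measurableSet_ball hDΩ
      ((hball _).trans_ne hV0) ((hball _).trans_ne hVt)
    refine ⟨c, fun u x hx => (hc u (u x)).trans ?_⟩
    rw [hball]
    gcongr 2 * (V⁻¹ * ?_) + _
    refine setLIntegral_ball_le_shift measurableSet_ball measurableSet_ball ?_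
      fun y => ‖u x - u y‖ₑ ^ 2
    intro v hv
    rw [Metric.mem_ball] at hv ⊢
    have h1 := hBt i x hx.2 x₀ hx₀.2
    calc dist v (s • e) = dist (x₀ - s • e) (x₀ - v) := by
          rw [dist_sub_left, dist_comm]
      _ ≤ dist (x₀ - s • e) (x - v) + dist (x - v) (x₀ - v) := dist_triangle _ _ _
      _ < δ + δ := by
          refine add_lt_add_of_lt_of_le (by rwa [dist_comm]) ?_
          rwa [dist_sub_right]
      _ = 2 * δ := by ring
  choose c hc using hcell
  set m : ℝ := (volume Ω).toReal with hm
  -- The scaling absorbs the factor 2 of the splitting and the bound `m` for the volume of a cell.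
  refine ⟨n, fun i => ((Real.sqrt (2 * m) : ℝ) : ℂ) • c i, fun x hx => ?_⟩
  set u := x.fst
  have hum : Measurable u := (Lp.stronglyMeasurable u).measurable
  set F : E3 → E3 → ℝ≥0∞ := fun x v => ‖u x - u (x - v)‖ₑ ^ 2 with hF
  have hFm : Measurable (Function.uncurry F) := by
    have h1 : Measurable fun q : E3 × E3 => u q.1 - u (q.1 - q.2) :=
      (hum.comp measurable_fst).sub (hum.comp (measurable_fst.sub measurable_snd))
    exact h1.enorm.pow_const 2
  have hQm : ∀ i, MeasurableSet (Q i) := fun i => hAo.measurableSet.inter (hBm i)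
  have hQu : A = ⋃ i, Q i := by
    rw [hQ, ← Set.inter_iUnion]; exact (Set.inter_eq_left.2 hBu).symm
  have hQd : Pairwise (Function.onFun Disjoint Q) := fun i j hij =>
    (hBd hij).mono Set.inter_subset_right Set.inter_subset_right
  have hInner : Measurable fun y => ∫⁻ v in W, F y v := hFm.lintegral_prod_right'
  -- Every `v` in `W` lies in the cone with axis `e`, so the segments from `y` to `y - v` stay in Ω
  -- and the translation estimate applies.
  have hW : ∫⁻ v in W, ∫⁻ y in A, F y v ≤ 8 * V * ENNReal.ofReal (2 * s * ‖x.snd‖) ^ 2 := by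
    calc ∫⁻ v in W, ∫⁻ y in A, F y v
        ≤ ∫⁻ v in W, ENNReal.ofReal (2 * s * ‖x.snd‖) ^ 2 := by
          refine setLIntegral_mono' measurableSet_ball fun v hv => ?_
          have hvs : ‖v - s • e‖ ≤ θ * s := by
            have := Metric.mem_ball.1 hv
            rw [dist_eq_norm] at this
            linarith
          have hvn : ‖v‖ ≤ 2 * s := by
            have h1 : ‖v‖ ≤ ‖s • e‖ + ‖v - s • e‖ := norm_le_norm_add_norm_sub' _ _
            rw [norm_smul, Real.norm_eq_abs, abs_of_pos hs] at h1
            nlinarith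
          refine (lintegral_translate_sub_le hΩ hbd hx hAo (v := v) ?_).trans ?_
          · intro y hy τ hτ
            have h1 := hcone y hy.2 hy.1 (τ * s) ⟨mul_nonneg hτ.1 hs.le, ?_⟩
              (τ • (v - s • e)) ?_
            · convert h1 using 2
              rw [mul_smul, ← smul_add, add_sub_cancel]
            · exact (mul_le_of_le_one_left hs.le hτ.2).trans hss
            · rw [norm_smul, Real.norm_eq_abs, abs_of_nonneg hτ.1]
              nlinarith [hτ.1]
          · gcongr
      _ = _ := by rw [setLIntegral_const, hWV, mul_comm]
  have h16 : ∀ t : ℝ, 2 * (8 * ENNReal.ofReal t) = ENNReal.ofReal (16 * t) := by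
    intro t
    rw [ENNReal.ofReal_mul (by norm_num), ← mul_assoc]
    norm_num
  have h2m : ∀ t : ℝ, 2 * ENNReal.ofReal t * ENNReal.ofReal m = ENNReal.ofReal (2 * m * t) := by
    intro t
    rw [ENNReal.ofReal_mul (mul_nonneg zero_le_two ENNReal.toReal_nonneg),
      ENNReal.ofReal_mul zero_le_two]
    norm_num
    ring
  have hmt : volume Ω ≠ ⊤ := hbd.measure_lt_top.ne
  calc ∫⁻ y in A, ‖u y‖ₑ ^ 2 = ∑ i, ∫⁻ y in Q i, ‖u y‖ₑ ^ 2 := by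
        rw [hQu, lintegral_iUnion hQm hQd, tsum_fintype]
    _ ≤ ∑ i, ∫⁻ y in Q i, (2 * (V⁻¹ * ∫⁻ v in W, F y v) + 2 * ‖(inner ℂ (c i) u : ℂ)‖ₑ ^ 2) :=
        Finset.sum_le_sum fun i _ => setLIntegral_mono' (hQm i) fun y hy => hc i u y hy
    _ = ∑ i, (∫⁻ y in Q i, 2 * (V⁻¹ * ∫⁻ v in W, F y v)) +
          ∑ i, 2 * ‖(inner ℂ (c i) u : ℂ)‖ₑ ^ 2 * volume (Q i) := by
        rw [← Finset.sum_add_distrib]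
        refine Finset.sum_congr rfl fun i _ => ?_
        rw [lintegral_add_right _ measurable_const, setLIntegral_const]
    _ = 2 * (V⁻¹ * ∫⁻ v in W, ∫⁻ y in A, F y v) +
          ∑ i, 2 * ‖(inner ℂ (c i) u : ℂ)‖ₑ ^ 2 * volume (Q i) := by
        congr 1
        rw [← lintegral_lintegral_swap hFm.aemeasurable, hQu,
          ← lintegral_const_mul _ hInner, ← lintegral_const_mul _ (hInner.const_mul _),
          lintegral_iUnion hQm hQd, tsum_fintype]
    _ ≤ 2 * (V⁻¹ * (8 * V * ENNReal.ofReal (2 * s * ‖x.snd‖) ^ 2)) +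
          ∑ i, 2 * ‖(inner ℂ (c i) u : ℂ)‖ₑ ^ 2 * volume Ω := by
        gcongr with i _
        exact Set.inter_subset_left.trans Set.inter_subset_right
    _ = ENNReal.ofReal (64 * s ^ 2 * ‖x.snd‖ ^ 2) +
          ∑ i, ENNReal.ofReal (2 * m * ‖(inner ℂ (c i) u : ℂ)‖ ^ 2) := by
        congr 1
        · rw [show V⁻¹ * (8 * V * ENNReal.ofReal (2 * s * ‖x.snd‖) ^ 2) =
            (V⁻¹ * V) * (8 * ENNReal.ofReal (2 * s * ‖x.snd‖) ^ 2) by ring,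
            ENNReal.inv_mul_cancel hV0 hVt, one_mul, ← ENNReal.ofReal_pow (by positivity), h16]
          congr 1; ring
        · refine Finset.sum_congr rfl fun i _ => ?_
          rw [enorm_sq_eq_ofReal, ← ENNReal.ofReal_toReal hmt, ← hm, h2m]
    _ = ENNReal.ofReal (64 * s ^ 2 * ‖x.snd‖ ^ 2 +
          ∑ i, 2 * m * ‖(inner ℂ (c i) u : ℂ)‖ ^ 2) := by
        have hm0 : 0 ≤ m := ENNReal.toReal_nonneg
        rw [← ENNReal.ofReal_sum_of_nonneg (fun i _ => by positivity),
          ← ENNReal.ofReal_add (by positivity) (Finset.sum_nonneg fun i _ => by positivity)]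
    _ ≤ _ := by
        have hm0 : 0 ≤ m := ENNReal.toReal_nonneg
        refine ENNReal.ofReal_le_ofReal (add_le_add (by gcongr) (le_of_eq ?_))
        refine Finset.sum_congr rfl fun i _ => ?_
        rw [inner_smul_left, norm_mul, mul_pow, RCLike.norm_conj, Complex.norm_real,
          Real.norm_eq_abs, sq_abs, Real.sq_sqrt (by positivity)]

theorem norm_sq_eq_lintegral {μ : Measure E3} (u : Lp ℂ 2 μ) :
    ENNReal.ofReal (‖u‖ ^ 2) = ∫⁻ y, ‖u y‖ₑ ^ 2 ∂μ := by
  have h2 := eLpNorm_nnreal_pow_eq_lintegral (μ := μ) (f := u) (p := 2) two_ne_zero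
  simp only [NNReal.coe_ofNat, ENNReal.coe_ofNat, ENNReal.rpow_ofNat] at h2
  rw [← h2, ENNReal.ofReal_pow (norm_nonneg _), Lp.norm_def,
    ENNReal.ofReal_toReal (Lp.eLpNorm_ne_top u)]

/-- **Friedrichs' inequality** on a bounded Lipschitz domain. -/
theorem IsBoundedLipschitzDomain.exists_friedrichs (hΩ : IsBoundedLipschitzDomain Ω) {ε : ℝ}
    (hε : 0 < ε) : ∃ (ι : Type) (_ : Fintype ι) (c : ι → L2 Ω), ∀ x ∈ sobolevH1 Ω,
      ‖x.fst‖ ^ 2 ≤ ε * ‖x.snd‖ ^ 2 + ∑ i, ‖(inner ℂ (c i) x.fst : ℂ)‖ ^ 2 := by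
  have hcomp : IsCompact (closure Ω) :=
    Metric.isCompact_of_isClosed_isBounded isClosed_closure hΩ.isBounded.closure
  -- The quantifier over `ε` belongs to the induction property, since a union of two sets costs a
  -- halving of `ε`.
  have key := hcomp.induction_on (p := fun S => ∀ ε > (0 : ℝ), ∃ (ι : Type) (_ : Fintype ι)
    (c : ι → L2 Ω), ∀ x ∈ sobolevH1 Ω, ∫⁻ y in S ∩ Ω, ‖x.fst y‖ₑ ^ 2 ≤
      ENNReal.ofReal (ε * ‖x.snd‖ ^ 2 + ∑ i, ‖(inner ℂ (c i) x.fst : ℂ)‖ ^ 2)) ?_ ?_ ?_ ?_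
  · obtain ⟨ι, hι, c, hc⟩ := key ε hε
    refine ⟨ι, hι, c, fun x hx => ?_⟩
    have h1 := hc x hx
    rw [Set.inter_eq_self_of_subset_right subset_closure, ← norm_sq_eq_lintegral] at h1
    rwa [ENNReal.ofReal_le_ofReal_iff
      (add_nonneg (by positivity) (Finset.sum_nonneg fun i _ => by positivity))] at h1
  · exact fun ε hε => ⟨Fin 0, inferInstance, fun _ => 0, fun x hx => by simp⟩
  · intro S S' hS h ε hε
    obtain ⟨ι, hι, c, hc⟩ := h ε hε
    exact ⟨ι, hι, c, fun x hx =>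
      (lintegral_mono_set (Set.inter_subset_inter_left _ hS)).trans (hc x hx)⟩
  · intro S S' h h' ε hε
    obtain ⟨ι, hι, c, hc⟩ := h (ε / 2) (half_pos hε)
    obtain ⟨ι', hι', c', hc'⟩ := h' (ε / 2) (half_pos hε)
    refine ⟨ι ⊕ ι', inferInstance, Sum.elim c c', fun x hx => ?_⟩
    rw [Set.union_inter_distrib_right]
    refine (lintegral_union_le _ _ _).trans ((add_le_add (hc x hx) (hc' x hx)).trans ?_)
    rw [← ENNReal.ofReal_add
      (add_nonneg (by positivity) (Finset.sum_nonneg fun i _ => by positivity))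
      (add_nonneg (by positivity) (Finset.sum_nonneg fun i _ => by positivity))]
    refine ENNReal.ofReal_le_ofReal (le_of_eq ?_)
    rw [Fintype.sum_sum_type]
    simp only [Sum.elim_inl, Sum.elim_inr]
    ring
  · intro p hp
    obtain ⟨r, θ, s₀, e, hr, hθ, hθ1, hs₀, he, hcone⟩ := hΩ.hasInnerCone hp
    refine ⟨Metric.ball p r, mem_nhdsWithin_of_mem_nhds (Metric.ball_mem_nhds p hr),
      fun ε hε => ?_⟩
    obtain ⟨n, c, hc⟩ := exists_local_friedrichs hΩ.isOpen hΩ.isBounded hθ hθ1 hs₀ he hcone hε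
    exact ⟨Fin n, inferInstance, c, hc⟩

/-- A compactness criterion for operators between Hilbert spaces. -/
theorem isCompactOperator_of_friedrichs {V H : Type*} [NormedAddCommGroup V]
    [InnerProductSpace ℂ V] [NormedAddCommGroup H] [InnerProductSpace ℂ H] [CompleteSpace H]
    (J : V →L[ℂ] H) (h : ∀ ε > (0 : ℝ), ∃ (ι : Type) (_ : Fintype ι) (c : ι → H), ∀ v,
      ‖J v‖ ^ 2 ≤ ε * ‖v‖ ^ 2 + ∑ i, ‖(inner ℂ (c i) (J v) : ℂ)‖ ^ 2) : IsCompactOperator J := by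
  refine (isCompactOperator_iff_isCompact_closure_image_closedBall (J : V →ₗ[ℂ] H) one_pos).2 ?_
  refine TotallyBounded.isCompact_of_isClosed (TotallyBounded.closure ?_) isClosed_closure
  rw [Metric.totallyBounded_iff]
  intro ε hε
  -- Two points of the unit ball differ by at most 2, so this term contributes at most `ε ^ 2 / 4`.
  -- The finitely many functionals in `P`, controlled by a net of radius `ε / 2`, contribute less
  -- than `ε ^ 2 / 4`.
  obtain ⟨ι, hι, c, hc⟩ := h (ε ^ 2 / 16) (by positivity)
  set P : V →L[ℂ] EuclideanSpace ℂ ι := LinearMap.toContinuousLinearMap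
    (PiLp.continuousLinearEquiv 2 ℂ (fun _ : ι => ℂ)).symm.toLinearMap ∘L
      ContinuousLinearMap.pi fun i => (innerSL ℂ (c i)) ∘L J with hP
  have hPn : ∀ v, ‖P v‖ ^ 2 = ∑ i, ‖(inner ℂ (c i) (J v) : ℂ)‖ ^ 2 := by
    intro v
    rw [EuclideanSpace.norm_sq_eq]
    rfl
  have hb : TotallyBounded (P '' Metric.closedBall 0 1) := by
    have hb0 : Bornology.IsBounded (P '' Metric.closedBall 0 1) :=
      P.lipschitz.isBounded_image Metric.isBounded_closedBall
    exact hb0.isCompact_closure.totallyBounded.subset subset_closure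
  obtain ⟨t, hts, htf, hcov⟩ := hb.exists_subset (Metric.dist_mem_uniformity (half_pos hε))
  choose! g hg hgP using fun y (hy : y ∈ t) => hts hy
  refine ⟨(fun y => J (g y)) '' t, htf.image _, ?_⟩
  rintro _ ⟨v, hv, rfl⟩
  obtain ⟨y, hyt, hy⟩ := Set.mem_iUnion₂.1 (hcov ⟨v, hv, rfl⟩)
  refine Set.mem_iUnion₂.2 ⟨J (g y), ⟨y, hyt, rfl⟩, ?_⟩
  have hy : dist (P v) y < ε / 2 := hy
  rw [← hgP y hyt, dist_eq_norm, ← map_sub] at hy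
  have h1 := hc (v - g y)
  rw [← hPn] at h1
  have h2 : ‖v - g y‖ ≤ 2 := by
    have h3 := mem_closedBall_zero_iff.1 hv
    have h4 := mem_closedBall_zero_iff.1 (hg y hyt)
    linarith [norm_sub_le v (g y)]
  have h3 : ‖v - g y‖ ^ 2 ≤ 2 ^ 2 := by gcongr
  have h4 : ‖P (v - g y)‖ ^ 2 < (ε / 2) ^ 2 := by gcongr
  rw [Metric.mem_ball, dist_eq_norm]
  have h5 : ‖J v - J (g y)‖ ^ 2 < ε ^ 2 := by
    rw [← map_sub]
    nlinarith
  exact lt_of_pow_lt_pow_left₀ 2 hε.le h5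

end Rellich

/-! ### Traces and the form domain of the mixed Laplacian -/

section Trace

open scoped ENNReal

variable {Ω : Set E3}

/-- The space of smooth functions on `ℝ³`. -/
def smoothFunctions : Submodule ℂ (E3 → ℂ) where
  carrier := {φ | ContDiff ℝ ∞ φ}
  zero_mem' := by
    rw [Set.mem_ofPred_eq]
    exact contDiff_const
  add_mem' := by
    intro φ ψ h h'
    rw [Set.mem_ofPred_eq] at *
    exact ContDiff.add h h'
  smul_mem' := by
    intro c φ h
    rw [Set.mem_ofPred_eq] at *
    exact contDiff_const.smul h

theorem mem_smoothFunctions {φ : E3 → ℂ} : φ ∈ smoothFunctions ↔ ContDiff ℝ ∞ φ :=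
  Set.mem_ofPred_eq.to_iff

theorem contDiff_coe (φ : smoothFunctions) : ContDiff ℝ ∞ (φ : E3 → ℂ) :=
  mem_smoothFunctions.1 φ.2

theorem ContDiff.continuous_partialDeriv {φ : E3 → ℂ} (hφ : ContDiff ℝ ∞ φ) (j : Fin 3) :
    Continuous (partialDeriv j φ) :=
  (hφ.continuous_fderiv (by simp)).clm_apply continuous_const

theorem partialDeriv_add {φ ψ : E3 → ℂ} (hφ : ContDiff ℝ ∞ φ) (hψ : ContDiff ℝ ∞ ψ) (j : Fin 3)
    (x : E3) : partialDeriv j (φ + ψ) x = partialDeriv j φ x + partialDeriv j ψ x := by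
  unfold partialDeriv
  rw [fderiv_add (hφ.differentiable (by simp) x) (hψ.differentiable (by simp) x)]
  rfl

theorem partialDeriv_const_smul {φ : E3 → ℂ} (hφ : ContDiff ℝ ∞ φ) (c : ℂ) (j : Fin 3)
    (x : E3) : partialDeriv j (c • φ) x = c * partialDeriv j φ x := by
  unfold partialDeriv
  rw [fderiv_const_smul (hφ.differentiable (by simp) x)]
  rfl

theorem Continuous.memLp_of_measure_compl_eq_zero {μ : Measure E3} [IsFiniteMeasure μ] {K : Set E3}
    (hK : IsCompact K) (hμ : μ Kᶜ = 0) {φ : E3 → ℂ} (hφ : Continuous φ) : MemLp φ 2 μ := by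
  obtain ⟨C, hC⟩ := hK.exists_bound_of_continuousOn hφ.continuousOn
  refine MemLp.of_bound hφ.aestronglyMeasurable C ?_
  have : ∀ᵐ x ∂μ, x ∈ K := hμ
  filter_upwards [this] with x hx using hC x hx

namespace IsBoundedLipschitzDomain

theorem isCompact_closure (hΩ : IsBoundedLipschitzDomain Ω) : IsCompact (closure Ω) :=
  Metric.isCompact_of_isClosed_isBounded isClosed_closure hΩ.isBounded.closure

theorem memLp_volume (hΩ : IsBoundedLipschitzDomain Ω) {φ : E3 → ℂ} (hφ : Continuous φ) : MemLp φ 2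
    (volume.restrict Ω) := by
  have : IsFiniteMeasure (volume.restrict Ω) := ⟨by simpa using hΩ.isBounded.measure_lt_top⟩
  refine hφ.memLp_of_measure_compl_eq_zero hΩ.isCompact_closure ?_
  rw [Measure.restrict_apply isClosed_closure.measurableSet.compl]
  convert measure_empty (μ := volume)
  rw [← Set.disjoint_iff_inter_eq_empty]
  exact Set.disjoint_compl_left_iff_subset.2 subset_closure

theorem memLp_surface (hΩ : IsBoundedLipschitzDomain Ω) {φ : E3 → ℂ} (hφ : Continuous φ) : MemLp φ
    2 (surfaceMeasure Ω) := by
  have := hΩ.isFiniteMeasure_surfaceMeasure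
  refine hφ.memLp_of_measure_compl_eq_zero hΩ.isCompact_closure ?_
  rw [surfaceMeasure, Measure.restrict_apply isClosed_closure.measurableSet.compl]
  convert measure_empty (μ := Measure.hausdorffMeasure 2)
  rw [← Set.disjoint_iff_inter_eq_empty]
  exact Set.disjoint_compl_left_iff_subset.2 frontier_subset_closure

variable (hΩ : IsBoundedLipschitzDomain Ω)

/-- A smooth function as an element of `H¹(Ω)`. -/
noncomputable def smoothPair : smoothFunctions →ₗ[ℂ] SobolevPair Ω where
  toFun φ := WithLp.toLp 2 ((hΩ.memLp_volume (contDiff_coe φ).continuous).toLp φ,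
    WithLp.toLp 2 fun j => (hΩ.memLp_volume ((contDiff_coe φ).continuous_partialDeriv j)).toLp _)
  map_add' φ ψ := by
    rw [← WithLp.toLp_add, Prod.mk_add_mk, ← WithLp.toLp_add]
    congr 4
    funext j
    exact (MemLp.toLp_congr _ ((hΩ.memLp_volume ((contDiff_coe φ).continuous_partialDeriv j)).add
      (hΩ.memLp_volume ((contDiff_coe ψ).continuous_partialDeriv j)))
      (Eventually.of_forall fun x => partialDeriv_add (contDiff_coe φ) (contDiff_coe ψ) j x)).trans
        (MemLp.toLp_add _ _)
  map_smul' c φ := by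
    rw [RingHom.id_apply, ← WithLp.toLp_smul, Prod.smul_mk, ← WithLp.toLp_smul]
    congr 4
    funext j
    exact (MemLp.toLp_congr _ ((hΩ.memLp_volume ((contDiff_coe φ).continuous_partialDeriv
      j)).const_smul c)
      (Eventually.of_forall fun x => partialDeriv_const_smul (contDiff_coe φ) c j x)).trans
      (MemLp.toLp_const_smul _ _)

/-- The boundary values of a smooth function. -/
noncomputable def smoothTrace : smoothFunctions →ₗ[ℂ] Lp ℂ 2 (surfaceMeasure Ω) where
  toFun φ := (hΩ.memLp_surface (contDiff_coe φ).continuous).toLp φ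
  map_add' φ ψ := MemLp.toLp_add (hΩ.memLp_surface (contDiff_coe φ).continuous) (hΩ.memLp_surface
    (contDiff_coe ψ).continuous)
  map_smul' c φ := MemLp.toLp_const_smul c (hΩ.memLp_surface (contDiff_coe φ).continuous)

theorem smoothPair_fst_ae (φ : smoothFunctions) :
    (hΩ.smoothPair φ).fst =ᵐ[volume.restrict Ω] (φ : E3 → ℂ) :=
  (hΩ.memLp_volume (contDiff_coe φ).continuous).coeFn_toLp

theorem smoothPair_snd_ae (φ : smoothFunctions) (j : Fin 3) :
    (hΩ.smoothPair φ).snd j =ᵐ[volume.restrict Ω] partialDeriv j φ :=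
  (hΩ.memLp_volume ((contDiff_coe φ).continuous_partialDeriv j)).coeFn_toLp

theorem smoothTrace_ae (φ : smoothFunctions) :
    hΩ.smoothTrace φ =ᵐ[surfaceMeasure Ω] (φ : E3 → ℂ) :=
  (hΩ.memLp_surface (contDiff_coe φ).continuous).coeFn_toLp

theorem smoothPair_mem_sobolevH1 (φ : smoothFunctions) : hΩ.smoothPair φ ∈ sobolevH1 Ω := by
  intro ψ hψ j
  have hz : ∀ x, x ∉ Ω → ψ x = 0 := fun x hx =>
    image_eq_zero_of_notMem_tsupport fun h => hx (hψ.tsupport_subset h)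
  have hz' : ∀ x, x ∉ Ω → partialDeriv j ψ x = 0 := fun x hx =>
    image_eq_zero_of_notMem_tsupport fun h => hx ((hψ.partialDeriv j).tsupport_subset h)
  have hφc : Continuous (φ : E3 → ℂ) := (contDiff_coe φ).continuous
  have hψc : Continuous ψ := hψ.contDiff.continuous
  have h1 : ∫ x in Ω, (hΩ.smoothPair φ).fst x * partialDeriv j ψ x =
      ∫ x, (φ : E3 → ℂ) x * partialDeriv j ψ x := by
    rw [← setIntegral_eq_integral_of_forall_compl_eq_zero (s := Ω)
      (f := fun x => (φ : E3 → ℂ) x * partialDeriv j ψ x)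
      (fun x hx => by rw [hz' x hx, mul_zero])]
    refine integral_congr_ae ?_
    filter_upwards [hΩ.smoothPair_fst_ae φ] with x hx
    rw [hx]
  have h2 : ∫ x in Ω, (hΩ.smoothPair φ).snd j x * ψ x =
      ∫ x, partialDeriv j (φ : E3 → ℂ) x * ψ x := by
    rw [← setIntegral_eq_integral_of_forall_compl_eq_zero (s := Ω)
      (f := fun x => partialDeriv j (φ : E3 → ℂ) x * ψ x)
      (fun x hx => by rw [hz x hx, mul_zero])]
    refine integral_congr_ae ?_
    filter_upwards [hΩ.smoothPair_snd_ae φ j] with x hx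
    rw [hx]
  rw [h1, h2]
  -- Both integrals were extended to ℝ³, where integration by parts has no boundary term.
  refine integral_mul_fderiv_eq_neg_fderiv_mul_of_integrable ?_ ?_ ?_ ?_ ?_
  · exact (((contDiff_coe φ).continuous_partialDeriv j).mul hψc).integrable_of_hasCompactSupport
      hψ.hasCompactSupport.mul_left
  · exact (hφc.mul (hψ.contDiff.continuous_partialDeriv j)).integrable_of_hasCompactSupport
      (hψ.partialDeriv j).hasCompactSupport.mul_left
  · exact (hφc.mul hψc).integrable_of_hasCompactSupport hψ.hasCompactSupport.mul_left
  · exact fun x _ => (contDiff_coe φ).differentiable (by simp) x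
  · exact fun x _ => hψ.contDiff.differentiable (by simp) x

theorem _root_.enorm_fderiv_sq_le (φ : E3 → ℂ) (x : E3) :
    ‖fderiv ℝ φ x‖ₑ ^ 2 ≤ ∑ j, ‖partialDeriv j φ x‖ₑ ^ 2 := by
  have h1 : ‖fderiv ℝ φ x‖ ≤ Real.sqrt (∑ j, ‖partialDeriv j φ x‖ ^ 2) := by
    refine ContinuousLinearMap.opNorm_le_bound _ (Real.sqrt_nonneg _) fun v => ?_
    rw [fderiv_apply_eq_sum]
    refine (norm_sum_le _ _).trans ?_
    refine abs_le_of_sq_le_sq' ?_ (by positivity) |>.2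
    simp only [norm_mul, Complex.norm_real]
    refine (Finset.sum_mul_sq_le_sq_mul_sq _ _ _).trans (le_of_eq ?_)
    rw [mul_pow, Real.sq_sqrt (Finset.sum_nonneg fun _ _ => by positivity),
      EuclideanSpace.norm_sq_eq, mul_comm]
  have h2 : ‖fderiv ℝ φ x‖ ^ 2 ≤ ∑ j, ‖partialDeriv j φ x‖ ^ 2 := by
    rw [← Real.sq_sqrt (Finset.sum_nonneg fun j (_ : j ∈ Finset.univ) =>
      sq_nonneg ‖partialDeriv j φ x‖)]
    gcongr
  simp only [enorm_sq_eq_ofReal]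
  rw [← ENNReal.ofReal_sum_of_nonneg (fun _ _ => by positivity), ← ofReal_norm,
    ← ENNReal.ofReal_pow (norm_nonneg _)]
  exact ENNReal.ofReal_le_ofReal h2

theorem exists_norm_smoothTrace_le :
    ∃ C : ℝ≥0, ∀ φ, ‖hΩ.smoothTrace φ‖ ≤ C * ‖hΩ.smoothPair φ‖ := by
  obtain ⟨C, hC⟩ := hΩ.exists_trace_inequality
  refine ⟨NNReal.sqrt C, fun φ => ?_⟩
  have h1 := hC φ ((contDiff_coe φ).of_le (by simp))
  have h2 : ∫⁻ x in Ω, sobolevDensity φ x ≤ ENNReal.ofReal (‖hΩ.smoothPair φ‖ ^ 2) := by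
    have h3 : ENNReal.ofReal (‖(hΩ.smoothPair φ).fst‖ ^ 2) = ∫⁻ x in Ω, ‖(φ : E3 → ℂ) x‖ₑ ^ 2 := by
      rw [norm_sq_eq_lintegral]
      refine lintegral_congr_ae ?_
      filter_upwards [hΩ.smoothPair_fst_ae φ] with x hx
      rw [hx]
    have h4 : ∀ j, ENNReal.ofReal (‖(hΩ.smoothPair φ).snd j‖ ^ 2) =
        ∫⁻ x in Ω, ‖partialDeriv j φ x‖ₑ ^ 2 := by
      intro j
      rw [norm_sq_eq_lintegral]
      refine lintegral_congr_ae ?_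
      filter_upwards [hΩ.smoothPair_snd_ae φ j] with x hx
      rw [hx]
    rw [WithLp.prod_norm_sq_eq_of_L2, PiLp.norm_sq_eq_of_L2,
      ENNReal.ofReal_add (by positivity) (Finset.sum_nonneg fun _ _ => by positivity),
      ENNReal.ofReal_sum_of_nonneg (fun _ _ => by positivity), h3]
    simp only [h4]
    have hm1 : Measurable fun x => ‖(φ : E3 → ℂ) x‖ₑ ^ 2 :=
      (contDiff_coe φ).continuous.measurable.enorm.pow_const 2
    have hm2 : ∀ j, Measurable fun x => ‖partialDeriv j φ x‖ₑ ^ 2 := fun j =>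
      ((contDiff_coe φ).continuous_partialDeriv j).measurable.enorm.pow_const 2
    rw [← lintegral_finsetSum _ (fun j _ => hm2 j), ← lintegral_add_left hm1]
    refine lintegral_mono fun x => ?_
    unfold sobolevDensity
    gcongr
    exact enorm_fderiv_sq_le _ _
  have h5 : ENNReal.ofReal (‖hΩ.smoothTrace φ‖ ^ 2) ≤
      ENNReal.ofReal (C * ‖hΩ.smoothPair φ‖ ^ 2) := by
    rw [norm_sq_eq_lintegral, ENNReal.ofReal_mul C.coe_nonneg, ENNReal.ofReal_coe_nnreal]
    refine le_trans (le_of_eq ?_) (h1.trans (by gcongr))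
    refine lintegral_congr_ae ?_
    filter_upwards [hΩ.smoothTrace_ae φ] with x hx
    rw [hx]
  rw [ENNReal.ofReal_le_ofReal_iff (by positivity)] at h5
  refine abs_le_of_sq_le_sq' ?_ (by positivity) |>.2
  rwa [mul_pow, ← NNReal.coe_pow, NNReal.sq_sqrt]

/-- The graph of the trace operator: the closure of the set of all pairs of a smooth function and
its boundary values. -/
noncomputable def traceGraph : Submodule ℂ (SobolevPair Ω × Lp ℂ 2 (surfaceMeasure Ω)) :=
  (LinearMap.range (hΩ.smoothPair.prod hΩ.smoothTrace)).topologicalClosure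

/-- The trace inequality survives the closure. It makes `traceGraph` the graph of a bounded
operator: the first component determines the second. -/
theorem exists_norm_le_of_mem_traceGraph :
    ∃ C : ℝ≥0, ∀ p ∈ hΩ.traceGraph, ‖p.2‖ ≤ C * ‖p.1‖ := by
  obtain ⟨C, hC⟩ := hΩ.exists_norm_smoothTrace_le
  refine ⟨C, fun p hp => ?_⟩
  have hcl : IsClosed {p : SobolevPair Ω × Lp ℂ 2 (surfaceMeasure Ω) | ‖p.2‖ ≤ C * ‖p.1‖} :=
    isClosed_le (by fun_prop) (by fun_prop)
  refine closure_minimal ?_ hcl hp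
  rintro _ ⟨φ, rfl⟩
  exact hC φ

theorem fst_mem_sobolevH1_of_mem_traceGraph
    {p : SobolevPair Ω × Lp ℂ 2 (surfaceMeasure Ω)} (hp : p ∈ hΩ.traceGraph) :
    p.1 ∈ sobolevH1 Ω := by
  have hcl : IsClosed {p : SobolevPair Ω × Lp ℂ 2 (surfaceMeasure Ω) | p.1 ∈ sobolevH1 Ω} :=
    (isClosed_sobolevH1 Ω).preimage continuous_fst
  refine closure_minimal ?_ hcl hp
  rintro _ ⟨φ, rfl⟩
  exact hΩ.smoothPair_mem_sobolevH1 φ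

/-- The form domain `H¹_{0,Γ}(Ω)`. -/
noncomputable def formDomain (Γ : Set E3) : Submodule ℂ (SobolevPair Ω) :=
  (hΩ.traceGraph ⊓ (LinearMap.ker (LpToLpRestrictCLM E3 ℂ ℂ (surfaceMeasure Ω) 2
    Γ).toLinearMap).comap
    (LinearMap.snd ℂ _ _)).map (LinearMap.fst ℂ _ _)

/-- On `traceGraph` the first component controls the whole pair, so the projection of a closed
subspace to the first component is again closed. -/
theorem isClosed_formDomain (Γ : Set E3) :
    IsClosed (hΩ.formDomain Γ : Set (SobolevPair Ω)) := by
  let D := hΩ.traceGraph ⊓ (LinearMap.ker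
    (LpToLpRestrictCLM E3 ℂ ℂ (surfaceMeasure Ω) 2 Γ).toLinearMap).comap
    (LinearMap.snd ℂ (SobolevPair Ω) _)
  have hDc : IsClosed (D : Set (SobolevPair Ω × Lp ℂ 2 (surfaceMeasure Ω))) := by
    refine IsClosed.inter (Submodule.isClosed_topologicalClosure _) ?_
    exact (LpToLpRestrictCLM E3 ℂ ℂ (surfaceMeasure Ω) 2 Γ).isClosed_ker.preimage continuous_snd
  have : CompleteSpace D := hDc.completeSpace_coe
  set F : D →L[ℂ] SobolevPair Ω := (ContinuousLinearMap.fst ℂ _ _).comp D.subtypeL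
  obtain ⟨C, hC⟩ := hΩ.exists_norm_le_of_mem_traceGraph
  have hanti : AntilipschitzWith (max 1 C) F := by
    refine AddMonoidHomClass.antilipschitz_of_bound F fun p => ?_
    rw [Submodule.coe_norm, Prod.norm_def, NNReal.coe_max, NNReal.coe_one]
    refine max_le ?_ ?_
    · exact le_mul_of_one_le_left (norm_nonneg _) (le_max_left _ _)
    · refine (hC p p.2.1).trans ?_
      exact mul_le_mul_of_nonneg_right (le_max_right _ _) (norm_nonneg _)
  have heq : (hΩ.formDomain Γ : Set (SobolevPair Ω)) = Set.range F := by
    ext x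
    constructor
    · rintro ⟨p, hp, rfl⟩
      exact ⟨⟨p, hp⟩, rfl⟩
    · rintro ⟨p, rfl⟩
      exact ⟨p, p.2, rfl⟩
  rw [heq]
  exact hanti.isClosed_range F.uniformContinuous

theorem formDomain_le_sobolevH1 (Γ : Set E3) : hΩ.formDomain Γ ≤ sobolevH1 Ω := by
  rintro _ ⟨p, hp, rfl⟩
  exact hΩ.fst_mem_sobolevH1_of_mem_traceGraph hp.1

theorem _root_.mem_ker_LpToLpRestrictCLM_iff {μ : Measure E3} {Γ : Set E3} (hΓ : MeasurableSet Γ)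
    (g : Lp ℂ 2 μ) : LpToLpRestrictCLM E3 ℂ ℂ μ 2 Γ g = 0 ↔ ∀ᵐ x ∂μ, x ∈ Γ → g x = 0 := by
  rw [Lp.eq_zero_iff_ae_eq_zero, ← ae_restrict_iff' hΓ]
  have h := LpToLpRestrictCLM_coeFn (μ := μ) (p := 2) ℂ Γ g
  constructor
  · intro h'
    filter_upwards [h, h'] with x hx hx'
    rw [← hx, hx']; rfl
  · intro h'
    filter_upwards [h, h'] with x hx hx'
    rw [hx, hx']; rfl

/-- Links the closure to the sequences in `HasTrace`: convergence in the product is convergence of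
every component. -/
theorem mem_traceGraph_iff {x : SobolevPair Ω} {g : Lp ℂ 2 (surfaceMeasure Ω)} :
    (x, g) ∈ hΩ.traceGraph ↔ ∃ φ : ℕ → E3 → ℂ, (∀ n, ContDiff ℝ ∞ (φ n)) ∧
      Tendsto (fun n => eLpNorm (fun y => φ n y - x.fst y) 2 (volume.restrict Ω)) atTop (𝓝 0) ∧
      (∀ j, Tendsto (fun n => eLpNorm (fun y => partialDeriv j (φ n) y - x.snd j y) 2
        (volume.restrict Ω)) atTop (𝓝 0)) ∧
      Tendsto (fun n => eLpNorm (fun y => φ n y - g y) 2 (surfaceMeasure Ω)) atTop (𝓝 0) := by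
  have key : ∀ φ : ℕ → smoothFunctions,
      Tendsto (fun n => (hΩ.smoothPair (φ n), hΩ.smoothTrace (φ n))) atTop (𝓝 (x, g)) ↔
      Tendsto (fun n => eLpNorm (fun y => (φ n : E3 → ℂ) y - x.fst y) 2 (volume.restrict Ω))
        atTop (𝓝 0) ∧
      (∀ j, Tendsto (fun n => eLpNorm (fun y => partialDeriv j (φ n) y - x.snd j y) 2
        (volume.restrict Ω)) atTop (𝓝 0)) ∧
      Tendsto (fun n => eLpNorm (fun y => (φ n : E3 → ℂ) y - g y) 2 (surfaceMeasure Ω))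
        atTop (𝓝 0) := by
    intro φ
    have h1 := Lp.tendsto_Lp_iff_tendsto_eLpNorm'' (fi := atTop) (fun n => (φ n : E3 → ℂ))
      (fun n => hΩ.memLp_volume (contDiff_coe (φ n)).continuous) x.fst (Lp.memLp _)
    have h2 := fun j => Lp.tendsto_Lp_iff_tendsto_eLpNorm'' (fi := atTop)
      (fun n => partialDeriv j (φ n))
      (fun n => hΩ.memLp_volume ((contDiff_coe (φ n)).continuous_partialDeriv j)) (x.snd j)
        (Lp.memLp _)
    have h3 := Lp.tendsto_Lp_iff_tendsto_eLpNorm'' (fi := atTop) (fun n => (φ n : E3 → ℂ))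
      (fun n => hΩ.memLp_surface (contDiff_coe (φ n)).continuous) g (Lp.memLp _)
    rw [Lp.toLp_coeFn] at h1 h3
    simp only [Lp.toLp_coeFn] at h2
    rw [nhds_prod_eq, tendsto_prod_iff']
    refine Iff.trans ?_ (and_congr h1 (and_congr (forall_congr' h2) h3))
    rw [← and_assoc]
    refine and_congr ?_ Iff.rfl
    constructor
    · intro h
      refine ⟨?_, fun j => ?_⟩
      · have hc : Continuous fun x : SobolevPair Ω => x.fst := by fun_prop
        exact (hc.tendsto x).comp h
      · have hc : Continuous fun x : SobolevPair Ω => x.snd j := by fun_prop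
        exact (hc.tendsto x).comp h
    · rintro ⟨h, h'⟩
      have hc : Continuous fun p : L2 Ω × (Fin 3 → L2 Ω) =>
          (WithLp.toLp 2 (p.1, WithLp.toLp 2 p.2) : SobolevPair Ω) := by fun_prop
      exact (hc.tendsto (x.fst, x.snd)).comp (h.prodMk_nhds (tendsto_pi_nhds.2 h'))
  constructor
  · intro h
    obtain ⟨p, hp, hlim⟩ := mem_closure_iff_seq_limit.1 h
    choose φ hφ using hp
    refine ⟨fun n => φ n, fun n => (contDiff_coe (φ n)), (key φ).1 ?_⟩
    convert hlim using 2 with n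
    exact hφ n
  · rintro ⟨φ, hφ, h⟩
    have := (key fun n => ⟨φ n, mem_smoothFunctions.2 (hφ n)⟩).2 h
    exact mem_closure_of_tendsto this (Eventually.of_forall fun n => ⟨⟨φ n, mem_smoothFunctions.2
      (hφ n)⟩, rfl⟩)

theorem mem_formDomain_iff {Γ : Set E3} (hΓ : MeasurableSet Γ) {x : SobolevPair Ω} :
    x ∈ hΩ.formDomain Γ ↔ x ∈ sobolevH1 Ω ∧ MemH1Zero Ω Γ x.fst := by
  constructor
  · intro hx
    refine ⟨hΩ.formDomain_le_sobolevH1 Γ hx, ?_⟩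
    obtain ⟨⟨y, g⟩, ⟨hp, hg⟩, rfl⟩ := hx
    exact ⟨g, ⟨y.snd, hΩ.fst_mem_sobolevH1_of_mem_traceGraph hp, hΩ.mem_traceGraph_iff.1 hp⟩,
      (mem_ker_LpToLpRestrictCLM_iff hΓ g).1 hg⟩
  · rintro ⟨hx, g, ⟨G, hG, hφ⟩, hg⟩
    obtain rfl : (x.snd : Fin 3 → L2 Ω) = G := HasWeakGradient.unique hΩ.isOpen hx hG
    exact ⟨(x, g), ⟨hΩ.mem_traceGraph_iff.2 hφ, (mem_ker_LpToLpRestrictCLM_iff hΓ g).2 hg⟩, rfl⟩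

/-- Test functions belong to every form domain. -/
theorem smoothPair_mem_formDomain {Γ : Set E3} (φ : smoothFunctions)
    (hφ : IsTestFunction Ω φ) : hΩ.smoothPair φ ∈ hΩ.formDomain Γ := by
  refine ⟨(hΩ.smoothPair φ, hΩ.smoothTrace φ), ⟨subset_closure ⟨φ, rfl⟩, ?_⟩, rfl⟩
  have h0 : hΩ.smoothTrace φ = 0 := by
    rw [Lp.eq_zero_iff_ae_eq_zero]
    refine (hΩ.smoothTrace_ae φ).trans ?_
    refine (ae_restrict_iff' isClosed_frontier.measurableSet).2 (Eventually.of_forall fun x hx =>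
      ?_)
    refine image_eq_zero_of_notMem_tsupport fun h => ?_
    rw [hΩ.isOpen.frontier_eq] at hx
    exact hx.2 (hφ.tsupport_subset h)
  change LpToLpRestrictCLM E3 ℂ ℂ (surfaceMeasure Ω) 2 Γ (hΩ.smoothTrace φ) = 0
  rw [h0, map_zero]

end IsBoundedLipschitzDomain

end Trace

/-! ### The operators and their forms -/

section Operators

open scoped ENNReal ComplexConjugate

variable {Ω : Set E3}

/-- Polynomials in the first coordinate stay independent on Ω: one vanishing almost everywhere on an
open set vanishes on a segment and so has infinitely many roots. -/
theorem not_finiteDimensional_L2 (hΩ : IsBoundedLipschitzDomain Ω) :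
    ¬ FiniteDimensional ℂ (L2 Ω) := by
  intro hfin
  have hcont : ∀ p : Polynomial ℂ, Continuous fun x : E3 => p.eval (x 0 : ℂ) := fun p =>
    p.continuous.comp (Complex.continuous_ofReal.comp (by fun_prop))
  let F : Polynomial ℂ →ₗ[ℂ] L2 Ω :=
    { toFun := fun p => (hΩ.memLp_volume (hcont p)).toLp _
      map_add' := fun p q => by
        rw [← MemLp.toLp_add]
        congr 1
        funext x
        simp
      map_smul' := fun c p => by
        rw [RingHom.id_apply, ← MemLp.toLp_const_smul]
        congr 1
        funext x
        simp }
  have hF : Function.Injective F := by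
    rw [← LinearMap.ker_eq_bot, LinearMap.ker_eq_bot']
    intro p hp
    have h1 : (fun x : E3 => p.eval (x 0 : ℂ)) =ᵐ[volume.restrict Ω] fun _ => 0 :=
      (hΩ.memLp_volume (hcont p)).coeFn_toLp.symm.trans (Lp.eq_zero_iff_ae_eq_zero.1 hp)
    have h2 := Measure.eqOn_open_of_ae_eq h1 hΩ.isOpen (hcont p).continuousOn continuousOn_const
    obtain ⟨a, ha⟩ := hΩ.isConnected.nonempty
    obtain ⟨ε, hε, hball⟩ := Metric.isOpen_iff.1 hΩ.isOpen a ha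
    refine Polynomial.eq_zero_of_infinite_isRoot p ?_
    refine Set.Infinite.mono (s := (fun t : ℝ => ((a 0 + t : ℝ) : ℂ)) '' Set.Ioo 0 ε) ?_ ?_
    · rintro _ ⟨t, ht, rfl⟩
      have hmem : a + t • EuclideanSpace.single (0 : Fin 3) (1 : ℝ) ∈ Ω := by
        apply hball
        rw [Metric.mem_ball, dist_eq_norm, add_sub_cancel_left, norm_smul,
          PiLp.norm_single, Real.norm_eq_abs, abs_of_pos ht.1]
        simpa using ht.2
      have := h2 hmem
      simpa [Polynomial.IsRoot] using this
    · refine (Set.Ioo_infinite hε).image ?_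
      intro s _ t _ hst
      have := Complex.ofReal_injective hst
      linarith
  exact Polynomial.not_finite (R := ℂ) (Module.Finite.of_injective F hF)

/-- Continuous linear maps of inner product spaces, with all structures derived from the inner
products. -/
abbrev InnerCLM (V H : Type*) [NormedAddCommGroup V] [InnerProductSpace ℂ V]
    [NormedAddCommGroup H] [InnerProductSpace ℂ H] : Type _ := V →L[ℂ] H

/-- The embedding of a space of pairs `(u, ∇u)` in `L²(Ω)`. -/
noncomputable def toL2 (V : Submodule ℂ (SobolevPair Ω)) : InnerCLM V (L2 Ω) :=
  (WithLp.fstL 2 ℂ _ _).comp V.subtypeL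

theorem toL2_apply (V : Submodule ℂ (SobolevPair Ω)) (x : V) : toL2 V x = (x : SobolevPair Ω).fst :=
  rfl

theorem norm_toL2_le (V : Submodule ℂ (SobolevPair Ω)) (x : V) : ‖toL2 V x‖ ≤ ‖x‖ := by
  have h := WithLp.prod_norm_sq_eq_of_L2 (x : SobolevPair Ω)
  rw [toL2_apply, Submodule.coe_norm]
  refine abs_le_of_sq_le_sq' ?_ (norm_nonneg _) |>.2
  rw [h]
  exact le_add_of_nonneg_right (sq_nonneg _)

theorem injective_toL2 (hΩ : IsOpen Ω) {V : Submodule ℂ (SobolevPair Ω)} (hV : V ≤ sobolevH1 Ω) :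
    Function.Injective (toL2 V) := by
  rintro ⟨x, hx⟩ ⟨y, hy⟩ hxy
  rw [toL2_apply, toL2_apply] at hxy
  have h1 := hV hx
  have h2 := hV hy
  rw [mem_sobolevH1] at h1 h2
  change x.fst = y.fst at hxy
  rw [hxy] at h1
  have h3 := HasWeakGradient.unique hΩ h1 h2
  refine Subtype.ext (WithLp.ofLp_injective 2 (Prod.ext hxy ?_))
  exact WithLp.ofLp_injective 2 h3

theorem IsBoundedLipschitzDomain.isCompactOperator_toL2 (hΩ : IsBoundedLipschitzDomain Ω)
    {V : Submodule ℂ (SobolevPair Ω)} (hV : V ≤ sobolevH1 Ω) : IsCompactOperator (toL2 V) := by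
  refine isCompactOperator_of_friedrichs (V := V) (H := L2 Ω) (toL2 V) fun ε hε => ?_
  obtain ⟨ι, hι, c, hc⟩ := hΩ.exists_friedrichs hε
  refine ⟨ι, hι, c, fun v => (hc v (hV v.2)).trans ?_⟩
  rw [toL2_apply]
  gcongr
  have := WithLp.prod_norm_sq_eq_of_L2 (v : SobolevPair Ω)
  rw [Submodule.coe_norm]
  nlinarith [sq_nonneg ‖(v : SobolevPair Ω).fst‖, norm_nonneg (v : SobolevPair Ω),
    norm_nonneg (v : SobolevPair Ω).snd]

/-- A finite-dimensional `V` would have a closed image in L², and that image contains the dense set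
of test functions. Infinite dimension guarantees that a `k`-th eigenvalue exists for every `k ≥ 1`.
-/
theorem IsBoundedLipschitzDomain.not_finiteDimensional (hΩ : IsBoundedLipschitzDomain Ω)
    {V : Submodule ℂ (SobolevPair Ω)}
    (hV : ∀ φ : smoothFunctions, IsTestFunction Ω φ → hΩ.smoothPair φ ∈ V) :
    ¬ FiniteDimensional ℂ V := by
  intro hfin
  have h1 : testSubmodule Ω ≤ LinearMap.range (toL2 V : V →ₗ[ℂ] L2 Ω) := by
    rintro c ⟨φ, hφ, hc⟩
    set φ' : smoothFunctions := ⟨φ, mem_smoothFunctions.2 hφ.contDiff⟩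
    refine ⟨⟨hΩ.smoothPair φ', hV φ' hφ⟩, ?_⟩
    refine Lp.ext ?_
    exact (hΩ.smoothPair_fst_ae φ').trans hc.symm
  have h2 := Submodule.topologicalClosure_minimal _ h1 (Submodule.closed_of_finiteDimensional _)
  rw [testSubmodule_dense hΩ.isOpen, top_le_iff] at h2
  exact not_finiteDimensional_L2 hΩ
    (Module.Finite.of_surjective (toL2 V : V →ₗ[ℂ] L2 Ω) (LinearMap.range_eq_top.1 h2))

/-- The graph of the operator associated with the Dirichlet form on `V`. -/
def FormGraph (V : Submodule ℂ (SobolevPair Ω)) (u f : L2 Ω) : Prop :=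
  ∃ x ∈ V, x.fst = u ∧ ∀ y ∈ V, inner ℂ y.snd x.snd = inner ℂ y.fst f

/-- The inner product of pairs is the L² product plus the Dirichlet form, which shifts every
eigenvalue by 1. -/
theorem spectralSpan_eq_map_formSpan {V : Submodule ℂ (SobolevPair Ω)} {A : L2 Ω → L2 Ω → Prop}
    (hA : ∀ u f, A u f ↔ FormGraph V u f) (t : ℝ) :
    spectralSpan A t = (formSpan (V := V) (H := L2 Ω) (toL2 V) (1 + t)).map (toL2 V : V →ₗ[ℂ] L2 Ω)
      := by
  rw [formSpan, Submodule.map_span]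
  unfold spectralSpan
  congr 1
  ext u
  constructor
  · rintro ⟨s, hs, h⟩
    obtain ⟨x, hx, rfl, hxy⟩ := (hA _ _).1 h
    refine ⟨⟨x, hx⟩, ⟨1 + s, by linarith, fun y => ?_⟩, rfl⟩
    rw [Submodule.coe_inner, WithLp.prod_inner_apply, toL2_apply, toL2_apply]
    have := hxy y y.2
    rw [inner_smul_right] at this
    change inner ℂ (y : SobolevPair Ω).fst x.fst + inner ℂ (y : SobolevPair Ω).snd x.snd =
      ((1 + s : ℝ) : ℂ) * inner ℂ (y : SobolevPair Ω).fst x.fst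
    rw [this]
    push_cast
    ring
  · rintro ⟨⟨x, hx⟩, ⟨s, hs, h⟩, rfl⟩
    refine ⟨s - 1, by linarith, (hA _ _).2 ⟨x, hx, rfl, fun y hy => ?_⟩⟩
    have := h ⟨y, hy⟩
    rw [Submodule.coe_inner, WithLp.prod_inner_apply, toL2_apply, toL2_apply] at this
    change inner ℂ y.fst x.fst + inner ℂ y.snd x.snd = (s : ℂ) * inner ℂ y.fst x.fst at this
    change inner ℂ y.snd x.snd = inner ℂ y.fst (((s - 1 : ℝ) : ℂ) • x.fst)
    rw [inner_smul_right, eq_sub_of_add_eq' this]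
    push_cast
    ring

theorem rank_spectralSpan (hΩ : IsOpen Ω) {V : Submodule ℂ (SobolevPair Ω)}
    (hV : V ≤ sobolevH1 Ω) {A : L2 Ω → L2 Ω → Prop}
    (hA : ∀ u f, A u f ↔ FormGraph V u f) (t : ℝ) :
    Module.rank ℂ (spectralSpan A t) = Module.rank ℂ (formSpan (V := V) (H := L2 Ω) (toL2 V) (1 +
      t)) := by
  rw [spectralSpan_eq_map_formSpan hA]
  exact (LinearEquiv.rank_eq (Submodule.equivMapOfInjective (toL2 V : V →ₗ[ℂ] L2 Ω)
    (injective_toL2 hΩ hV) _)).symm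

theorem IsBoundedLipschitzDomain.exists_isKthEigenvalue (hΩ : IsBoundedLipschitzDomain Ω)
    {V : Submodule ℂ (SobolevPair Ω)} (hVc : IsClosed (V : Set (SobolevPair Ω)))
    (hV : V ≤ sobolevH1 Ω)
    (hVt : ∀ φ : smoothFunctions, IsTestFunction Ω φ → hΩ.smoothPair φ ∈ V)
    {A : L2 Ω → L2 Ω → Prop} (hA : ∀ u f, A u f ↔ FormGraph V u f) {k : ℕ} (hk : 1 ≤ k) :
    ∃ l, IsKthEigenvalue A k l := by
  have : CompleteSpace V := hVc.completeSpace_coe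
  obtain ⟨r, hr, hmin⟩ := exists_isLeast_rank_formSpan (V := V) (H := L2 Ω) (toL2 V)
    (hΩ.isCompactOperator_toL2 hV) (injective_toL2 hΩ.isOpen hV) (hΩ.not_finiteDimensional hVt) k hk
  refine ⟨r - 1, ?_, fun t ht => ?_⟩
  · rw [Set.mem_ofPred_eq, rank_spectralSpan hΩ.isOpen hV hA, add_sub_cancel]
    exact hr
  · rw [Set.mem_ofPred_eq, rank_spectralSpan hΩ.isOpen hV hA] at ht
    have := hmin ht
    linarith

theorem laplacian_eq_sum_partialDeriv {φ : E3 → ℂ} (hφ : ContDiff ℝ ∞ φ) (x : E3) :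
    Laplacian.laplacian φ x = ∑ j, partialDeriv j (partialDeriv j φ) x := by
  rw [InnerProductSpace.laplacian_eq_iteratedFDeriv_orthonormalBasis φ
    (EuclideanSpace.basisFun (Fin 3) ℝ)]
  refine Finset.sum_congr rfl fun j _ => ?_
  rw [iteratedFDeriv_two_apply]
  have hd : DifferentiableAt ℝ (fderiv ℝ φ) x :=
    (hφ.fderiv_right (m := ∞) (by simp)).differentiable (by simp) x
  have : partialDeriv j φ = fun y => fderiv ℝ φ y (EuclideanSpace.single j 1) := rfl
  rw [partialDeriv, this, fderiv_clm_apply hd (differentiableAt_const _)]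
  simp

namespace IsBoundedLipschitzDomain

variable (hΩ : IsBoundedLipschitzDomain Ω)

theorem inner_smoothPair_fst (φ : smoothFunctions) (u : L2 Ω) :
    inner ℂ (hΩ.smoothPair φ).fst u = ∫ x in Ω, u x * conj ((φ : E3 → ℂ) x) := by
  rw [L2.inner_def]
  refine integral_congr_ae ?_
  filter_upwards [hΩ.smoothPair_fst_ae φ] with x hx
  rw [hx, RCLike.inner_apply]

theorem inner_smoothPair_snd (φ : smoothFunctions) (G : PiLp 2 fun _ : Fin 3 => L2 Ω) :
    inner ℂ (hΩ.smoothPair φ).snd G =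
      ∑ j, ∫ x in Ω, G j x * conj (partialDeriv j (φ : E3 → ℂ) x) := by
  rw [PiLp.inner_apply]
  refine Finset.sum_congr rfl fun j _ => ?_
  rw [L2.inner_def]
  refine integral_congr_ae ?_
  filter_upwards [hΩ.smoothPair_snd_ae φ j] with x hx
  rw [hx, RCLike.inner_apply]

theorem partialDeriv_conj {φ : E3 → ℂ} (hφ : ContDiff ℝ ∞ φ) (j : Fin 3) (x : E3) :
    partialDeriv j (fun y => conj (φ y)) x = conj (partialDeriv j φ x) := by
  unfold partialDeriv
  have h := (Complex.conjCLE.toContinuousLinearMap.hasFDerivAt.comp x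
    (hφ.differentiable (by simp) x).hasFDerivAt).fderiv
  have h2 : (⇑Complex.conjCLE.toContinuousLinearMap ∘ φ) = fun y => conj (φ y) := rfl
  rw [h2] at h
  rw [h]
  rfl

/-- The form identity is tested with conj φ, because the inner product is conjugate linear in its
first argument. The weak gradient of `x` then moves one more derivative onto ∂ⱼφ. -/
theorem hasWeakNegLaplacian {x : SobolevPair Ω} (hx : x ∈ sobolevH1 Ω) {f : L2 Ω}
    (h : ∀ φ : smoothFunctions, IsTestFunction Ω φ →
      inner ℂ (hΩ.smoothPair φ).snd x.snd = inner ℂ (hΩ.smoothPair φ).fst f) :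
    HasWeakNegLaplacian Ω x.fst f := by
  intro φ hφ
  have h1 := h ⟨fun y => conj (φ y), mem_smoothFunctions.2 hφ.star.contDiff⟩ hφ.star
  rw [inner_smoothPair_fst, inner_smoothPair_snd] at h1
  simp only [partialDeriv_conj hφ.contDiff, Complex.conj_conj] at h1
  rw [← h1, ← Finset.sum_neg_distrib]
  simp only [laplacian_eq_sum_partialDeriv hφ.contDiff, Finset.mul_sum]
  rw [integral_finsetSum]
  · refine Finset.sum_congr rfl fun j _ => ?_
    exact hx _ (hφ.partialDeriv j) j
  · intro j _
    have hL := ((hφ.partialDeriv j).partialDeriv j).memLp (volume.restrict Ω)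
    exact (Lp.memLp x.fst).integrable_mul hL

theorem neumannLaplacian_iff (hΩ : IsBoundedLipschitzDomain Ω) (u f : L2 Ω) :
    NeumannLaplacian Ω u f ↔ FormGraph (sobolevH1 Ω) u f := by
  constructor
  · rintro ⟨⟨G, hG⟩, -, hN⟩
    refine ⟨WithLp.toLp 2 (u, WithLp.toLp 2 G), hG, rfl, fun y hy => ?_⟩
    rw [PiLp.inner_apply]
    exact sub_eq_zero.1 (hN y.fst ⟨y.snd, hy⟩ G y.snd hG hy)
  · rintro ⟨x, hx, rfl, h⟩
    refine ⟨⟨x.snd, hx⟩, hΩ.hasWeakNegLaplacian hx fun φ _ =>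
      h _ (hΩ.smoothPair_mem_sobolevH1 φ), fun v _ G F hG hF => ?_⟩
    obtain rfl : (x.snd : Fin 3 → L2 Ω) = G := HasWeakGradient.unique hΩ.isOpen hx hG
    have := h (WithLp.toLp 2 (v, WithLp.toLp 2 F)) hF
    rw [PiLp.inner_apply] at this
    exact sub_eq_zero.2 this

end IsBoundedLipschitzDomain

theorem IsRelOpenInFrontier.measurableSet {Γ : Set E3} (h : IsRelOpenInFrontier Ω Γ) :
    MeasurableSet Γ := by
  obtain ⟨U, hU, rfl⟩ := h
  exact hU.measurableSet.inter isClosed_frontier.measurableSet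

theorem IsRelOpenInFrontier.subset_frontier {Γ : Set E3} (h : IsRelOpenInFrontier Ω Γ) :
    Γ ⊆ frontier Ω := by
  obtain ⟨U, hU, rfl⟩ := h
  exact Set.inter_subset_right

/-- The two boundary sets agree up to a null set: the relatively open Γ_D does not meet the closure
of the disjoint Γ_N, and what lies outside both is null. -/
theorem IsBoundaryDecomposition.memH1Zero_iff {ΓD ΓN : Set E3}
    (hΓ : IsBoundaryDecomposition Ω ΓD ΓN) (u : L2 Ω) :
    MemH1Zero Ω (frontier Ω \ closure ΓN) u ↔ MemH1Zero Ω ΓD u := by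
  have h1 : ∀ x ∈ ΓD, x ∈ frontier Ω \ closure ΓN := by
    intro x hx
    refine ⟨hΓ.relOpen_dirichlet.subset_frontier hx, fun hcl => ?_⟩
    obtain ⟨U, hU, hUΓ⟩ := hΓ.relOpen_dirichlet
    have hxU : x ∈ U := by
      rw [hUΓ] at hx
      exact hx.1
    obtain ⟨z, hzU, hzN⟩ := mem_closure_iff.1 hcl U hU hxU
    have hzD : z ∈ ΓD := by
      rw [hUΓ]
      exact ⟨hzU, hΓ.relOpen_neumann.subset_frontier hzN⟩
    exact Set.disjoint_left.1 hΓ.disjoint hzD hzN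
  have h2 : ∀ᵐ x ∂(surfaceMeasure Ω), x ∈ frontier Ω \ closure ΓN → x ∈ ΓD := by
    have h3 : ∀ᵐ x ∂(surfaceMeasure Ω), x ∉ frontier Ω \ (ΓD ∪ ΓN) :=
      measure_eq_zero_iff_ae_notMem.1 hΓ.null_remainder
    filter_upwards [h3] with x hx hx'
    by_contra hD
    exact hx ⟨hx'.1, fun h => h.elim hD fun hN => hx'.2 (subset_closure hN)⟩
  constructor
  · rintro ⟨g, hg, h0⟩
    refine ⟨g, hg, ?_⟩
    filter_upwards [h0] with x hx hxD using hx (h1 x hxD)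
  · rintro ⟨g, hg, h0⟩
    refine ⟨g, hg, ?_⟩
    filter_upwards [h0, h2] with x hx hx' hxc using hx (hx' hxc)

theorem IsBoundedLipschitzDomain.mixedLaplacian_iff (hΩ : IsBoundedLipschitzDomain Ω)
    {ΓD ΓN : Set E3} (hΓ : IsBoundaryDecomposition Ω ΓD ΓN) (u f : L2 Ω) :
    MixedLaplacian Ω ΓD ΓN u f ↔ FormGraph (hΩ.formDomain ΓD) u f := by
  have hm := hΓ.relOpen_dirichlet.measurableSet
  constructor
  · rintro ⟨hD, -, hN⟩
    obtain ⟨g, ⟨G, hG, -⟩, -⟩ := id hD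
    refine ⟨WithLp.toLp 2 (u, WithLp.toLp 2 G), (hΩ.mem_formDomain_iff hm).2 ⟨hG, hD⟩, rfl,
      fun y hy => ?_⟩
    obtain ⟨hy1, hy2⟩ := (hΩ.mem_formDomain_iff hm).1 hy
    rw [PiLp.inner_apply]
    exact sub_eq_zero.1 (hN y.fst ((hΓ.memH1Zero_iff _).2 hy2) G y.snd hG hy1)
  · rintro ⟨x, hx, rfl, h⟩
    obtain ⟨hx1, hx2⟩ := (hΩ.mem_formDomain_iff hm).1 hx
    refine ⟨hx2, hΩ.hasWeakNegLaplacian hx1 fun φ hφ =>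
      h _ (hΩ.smoothPair_mem_formDomain φ hφ), fun v hv G F hG hF => ?_⟩
    obtain rfl : (x.snd : Fin 3 → L2 Ω) = G := HasWeakGradient.unique hΩ.isOpen hx1 hG
    have := h (WithLp.toLp 2 (v, WithLp.toLp 2 F))
      ((hΩ.mem_formDomain_iff hm).2 ⟨hF, (hΓ.memH1Zero_iff _).1 hv⟩)
    rw [PiLp.inner_apply] at this
    exact sub_eq_zero.2 this

end Operators

/-! ### Adding a trial function to a spectral subspace -/

section TrialFunction

variable {V H : Type*} [NormedAddCommGroup V] [InnerProductSpace ℂ V]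
  [NormedAddCommGroup H] [InnerProductSpace ℂ H]

/-- In the quadratic form ‖·‖² - r‖J ·‖² the vector `e` is null and orthogonal to `v`, so adding it
changes nothing. -/
theorem norm_sq_add_le_of_form_eq (J : V →L[ℂ] H) {r : ℝ} {v e : V}
    (hv : ‖v‖ ^ 2 ≤ r * ‖J v‖ ^ 2) (he : ‖e‖ ^ 2 = r * ‖J e‖ ^ 2)
    (hev : inner ℂ e v = (r : ℂ) * inner ℂ (J e) (J v)) :
    ‖e + v‖ ^ 2 ≤ r * ‖J (e + v)‖ ^ 2 := by
  have h1 : RCLike.re (inner ℂ e v) = r * RCLike.re (inner ℂ (J e) (J v)) := by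
    rw [hev]
    exact Complex.re_ofReal_mul _ _
  rw [map_add, @norm_add_sq ℂ, @norm_add_sq ℂ, h1, he]
  nlinarith

/-- Min-max for ℂe ⊕ F: the assumptions on `e` keep the Rayleigh quotient at most `r` on the larger
space. `F` need not consist of eigenvectors of the problem on `V`; in the application it comes from
the mixed problem. -/
theorem rank_add_one_le_rank_formSpan [CompleteSpace V] [CompleteSpace H] {J : V →L[ℂ] H}
    (hJ : IsCompactOperator J) {r : ℝ} {F : Submodule ℂ V}
    (hF : ∀ v ∈ F, ‖v‖ ^ 2 ≤ r * ‖J v‖ ^ 2) {e : V} (he : ‖e‖ ^ 2 = r * ‖J e‖ ^ 2)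
    (hev : ∀ v ∈ F, inner ℂ e v = (r : ℂ) * inner ℂ (J e) (J v)) (heF : e ∉ F) :
    Module.rank ℂ F + 1 ≤ Module.rank ℂ (formSpan J r) := by
  have he0 : e ≠ 0 := fun h => heF (h ▸ F.zero_mem)
  have hdisj : (ℂ ∙ e) ⊓ F = ⊥ := by
    refine (Submodule.eq_bot_iff _).2 ?_
    rintro x ⟨hx, hxF⟩
    obtain ⟨c, rfl⟩ := Submodule.mem_span_singleton.1 hx
    by_cases hc : c = 0
    · simp [hc]
    · exact absurd ((F.smul_mem_iff hc).1 hxF) heF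
  have h1 := Submodule.rank_sup_add_rank_inf_eq (ℂ ∙ e) F
  have h2 : Module.rank ℂ (ℂ ∙ e) = 1 := by
    rw [← Module.finrank_eq_rank, finrank_span_singleton he0, Nat.cast_one]
  rw [hdisj, rank_bot, add_zero, h2] at h1
  rw [add_comm, ← h1]
  refine rank_le_rank_formSpan J hJ _ fun w hw => ?_
  obtain ⟨a, ha, v, hv, rfl⟩ := Submodule.mem_sup.1 hw
  obtain ⟨c, rfl⟩ := Submodule.mem_span_singleton.1 ha
  refine norm_sq_add_le_of_form_eq J (hF v hv) ?_ ?_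
  · rw [map_smul, norm_smul, norm_smul, mul_pow, mul_pow, he]
    ring
  · rw [map_smul, inner_smul_left, inner_smul_left, hev v hv]
    ring

/-- For a contraction `J` no Rayleigh quotient is below 1. After the shift by 1 this says that
Laplace eigenvalues are nonnegative, so that √λ makes sense as a wave number. -/
theorem one_le_of_one_le_rank_formSpan [CompleteSpace V] [CompleteSpace H] {J : V →L[ℂ] H}
    (hJ : ∀ v, ‖J v‖ ≤ ‖v‖) {r : ℝ} (hr : 1 ≤ Module.rank ℂ (formSpan J r)) : 1 ≤ r := by
  have hne : formSpan J r ≠ ⊥ := by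
    intro h
    rw [h, rank_bot] at hr
    exact absurd hr (by simp)
  obtain ⟨v, hv, hv0⟩ := Submodule.exists_mem_ne_zero_of_ne_bot hne
  have h1 := norm_sq_le_of_mem_formSpan J hv
  have h2 : 0 < ‖v‖ ^ 2 := by positivity
  have h3 : ‖J v‖ ^ 2 ≤ ‖v‖ ^ 2 := by
    gcongr
    exact hJ v
  by_contra! hlt
  have h4 : ‖J v‖ ^ 2 ≤ 0 := le_of_not_gt fun h => by nlinarith [mul_pos (sub_pos.2 hlt) h]
  rw [le_antisymm h4 (sq_nonneg _), mul_zero] at h1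
  linarith

end TrialFunction

/-! ### Plane waves -/

section PlaneWave

open scoped ENNReal ComplexConjugate

variable {Ω : Set E3}

/-- The plane wave `x ↦ exp (i κ ⟨ξ, x⟩)`. -/
noncomputable def planeWave (ξ : E3) (κ : ℝ) : smoothFunctions :=
  ⟨fun x => Complex.exp (((κ * inner ℝ ξ x : ℝ) : ℂ) * Complex.I), by
    refine mem_smoothFunctions.2 ?_
    refine Complex.contDiff_exp.comp ((Complex.ofRealCLM.contDiff.comp ?_).mul contDiff_const)
    exact contDiff_const.mul (contDiff_const.inner ℝ contDiff_id)⟩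

theorem norm_planeWave (ξ : E3) (κ : ℝ) (x : E3) : ‖(planeWave ξ κ : E3 → ℂ) x‖ = 1 :=
  Complex.norm_exp_ofReal_mul_I _

theorem fderiv_planeWave (ξ : E3) (κ : ℝ) (x v : E3) :
    fderiv ℝ (planeWave ξ κ : E3 → ℂ) x v =
      ((κ * inner ℝ ξ v : ℝ) : ℂ) * Complex.I * (planeWave ξ κ : E3 → ℂ) x := by
  have h1 : HasFDerivAt (fun x : E3 => κ * inner ℝ ξ x) (κ • innerSL ℝ ξ) x :=
    (innerSL ℝ ξ).hasFDerivAt.const_mul κ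
  have h2 := ((Complex.ofRealCLM.hasFDerivAt.comp x h1).mul_const Complex.I).cexp
  have h3 : HasFDerivAt (planeWave ξ κ : E3 → ℂ) _ x := h2
  rw [h3.fderiv]
  simp [planeWave]
  ring

theorem partialDeriv_planeWave (ξ : E3) (κ : ℝ) (j : Fin 3) (x : E3) :
    partialDeriv j (planeWave ξ κ : E3 → ℂ) x =
      ((κ * ξ j : ℝ) : ℂ) * Complex.I * (planeWave ξ κ : E3 → ℂ) x := by
  rw [partialDeriv, fderiv_planeWave, EuclideanSpace.inner_single_right]
  simp

theorem volume_inner_level_eq_zero {n : E3} (hn : n ≠ 0) (c : ℝ) :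
    volume {x : E3 | inner ℝ n x = c} = 0 := by
  rcases Set.eq_empty_or_nonempty {x : E3 | inner ℝ n x = c} with h | ⟨x₀, hx₀⟩
  · rw [h, measure_empty]
  · have hker : volume (LinearMap.ker (innerSL ℝ n : E3 →ₗ[ℝ] ℝ) : Set E3) = 0 := by
      refine Measure.addHaar_submodule _ _ fun h => hn ?_
      have : n ∈ LinearMap.ker (innerSL ℝ n : E3 →ₗ[ℝ] ℝ) := h ▸ Submodule.mem_top
      exact inner_self_eq_zero.1 this
    have heq : {x : E3 | inner ℝ n x = c} = (fun x => x + -x₀) ⁻¹'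
        (LinearMap.ker (innerSL ℝ n : E3 →ₗ[ℝ] ℝ) : Set E3) := by
      ext x
      rw [Set.mem_ofPred_eq] at hx₀
      simp [hx₀, ← sub_eq_add_neg, inner_sub_right, sub_eq_zero]
    rw [heq, measure_preimage_add_right, hker]

/-- The union of those planes orthogonal to `n` that meet the boundary in a set of positive surface
measure. -/
def heavyLevelPoints (Ω : Set E3) (n : E3) : Set E3 :=
  {x | inner ℝ n x ∈ {c | 0 < surfaceMeasure Ω {y | inner ℝ n y = c}}}

/-- A finite measure charges at most countably many of the disjoint levels. Hence the heavy planes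
together form a measurable Lebesgue null set. -/
theorem IsBoundedLipschitzDomain.countable_heavy_levels (hΩ : IsBoundedLipschitzDomain Ω) (n : E3) :
    {c : ℝ | 0 < surfaceMeasure Ω {y | inner ℝ n y = c}}.Countable := by
  have := hΩ.isFiniteMeasure_surfaceMeasure
  exact Measure.countable_meas_level_set_pos (by fun_prop)

theorem IsBoundedLipschitzDomain.measurableSet_heavyLevelPoints (hΩ : IsBoundedLipschitzDomain Ω)
    (n : E3) : MeasurableSet (heavyLevelPoints Ω n) :=
  (hΩ.countable_heavy_levels n).measurableSet.preimage (by fun_prop)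

theorem IsBoundedLipschitzDomain.volume_heavyLevelPoints (hΩ : IsBoundedLipschitzDomain Ω)
    {n : E3} (hn : n ≠ 0) : volume (heavyLevelPoints Ω n) = 0 := by
  have : heavyLevelPoints Ω n = ⋃ c ∈ {c : ℝ | 0 < surfaceMeasure Ω {y | inner ℝ n y = c}},
      {x | inner ℝ n x = c} := by
    ext x
    simp [heavyLevelPoints]
  rw [this, measure_biUnion_null_iff (hΩ.countable_heavy_levels n)]
  exact fun c _ => volume_inner_level_eq_zero hn c

theorem add_smul_mem_heavyLevelPoints {n ξ : E3} (h : inner ℝ n ξ = 0) (s : ℝ) {z : E3}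
    (hz : z ∈ heavyLevelPoints Ω n) : z + s • ξ ∈ heavyLevelPoints Ω n := by
  unfold heavyLevelPoints at *
  rw [Set.mem_ofPred_eq] at *
  rwa [inner_add_right, inner_smul_right, h, mul_zero, add_zero]

/-- A plane parallel to `H` lies in a single level of ⟨n, ·⟩, and a plane part contained in it gives
that level positive measure. -/
theorem parallelPlaneParts_subset_heavyLevelPoints {H : AffineSubspace ℝ E3} {n : E3}
    (hn : n ∈ H.directionᗮ) : parallelPlaneParts Ω H ⊆ heavyLevelPoints Ω n := by
  rintro x ⟨H', P, hP, hpar, hx⟩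
  have hsub : P ⊆ {y | inner ℝ n y = inner ℝ n x} := by
    intro y hy
    have h1 : y - x ∈ H.direction := by
      rw [← hpar.direction_eq]
      exact AffineSubspace.vsub_mem_direction (hP.subset_plane hy) (hP.subset_plane hx)
    have h2 : inner ℝ n (y - x) = 0 := (Submodule.mem_orthogonal' _ _).1 hn _ h1
    rw [inner_sub_right, sub_eq_zero] at h2
    exact h2
  exact (pos_iff_ne_zero.2 hP.pos_measure).trans_le (measure_mono hsub)

theorem subset_parallelPlaneParts {H : AffineSubspace ℝ E3} {P : Set E3} (hP : IsPlanePart Ω H P) :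
    P ⊆ parallelPlaneParts Ω H := fun _ hx => ⟨H, P, hP, AffineSubspace.Parallel.refl H, hx⟩

/-- Since 2 + 2 > 3 the intersection is nontrivial. This is why two families of parallel planes are
admissible. -/
theorem exists_unit_vector_mem_inf {U₁ U₂ : Submodule ℝ E3} (h₁ : Module.finrank ℝ U₁ = 2)
    (h₂ : Module.finrank ℝ U₂ = 2) : ∃ ξ ∈ U₁ ⊓ U₂, ‖ξ‖ = 1 := by
  have h := Submodule.finrank_sup_add_finrank_inf_eq U₁ U₂
  have h3 : Module.finrank ℝ ↥(U₁ ⊔ U₂) ≤ 3 := by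
    simpa using Submodule.finrank_le (U₁ ⊔ U₂)
  have hne : U₁ ⊓ U₂ ≠ ⊥ := by
    intro hbot
    rw [hbot, finrank_bot] at h
    omega
  obtain ⟨v, hv, hv0⟩ := Submodule.exists_mem_ne_zero_of_ne_bot hne
  exact ⟨(‖v‖⁻¹ : ℝ) • v, Submodule.smul_mem _ _ hv, norm_smul_inv_norm hv0⟩

theorem exists_ne_zero_mem_orthogonal {U : Submodule ℝ E3} (h : Module.finrank ℝ U = 2) :
    ∃ n ∈ Uᗮ, n ≠ 0 := by
  refine Submodule.exists_mem_ne_zero_of_ne_bot fun hbot => ?_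
  rw [Submodule.orthogonal_eq_bot_iff] at hbot
  rw [hbot] at h
  simp at h

namespace IsBoundedLipschitzDomain

variable (hΩ : IsBoundedLipschitzDomain Ω)

theorem smoothPair_planeWave_snd (ξ : E3) (κ : ℝ) (j : Fin 3) :
    (hΩ.smoothPair (planeWave ξ κ)).snd j =
      (((κ * ξ j : ℝ) : ℂ) * Complex.I) • (hΩ.smoothPair (planeWave ξ κ)).fst := by
  refine Lp.ext ?_
  filter_upwards [hΩ.smoothPair_snd_ae (planeWave ξ κ) j, hΩ.smoothPair_fst_ae (planeWave ξ κ),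
    Lp.coeFn_smul (((κ * ξ j : ℝ) : ℂ) * Complex.I) (hΩ.smoothPair (planeWave ξ κ)).fst]
    with x h1 h2 h3
  rw [h1, h3, Pi.smul_apply, h2, partialDeriv_planeWave, smul_eq_mul]

/-- The gradient is iκξ times the wave itself, so the Rayleigh quotient is exact without any
boundary condition. -/
theorem norm_sq_smoothPair_planeWave {ξ : E3} (hξ : ‖ξ‖ = 1) (κ : ℝ) :
    ‖hΩ.smoothPair (planeWave ξ κ)‖ ^ 2 =
      (1 + κ ^ 2) * ‖(hΩ.smoothPair (planeWave ξ κ)).fst‖ ^ 2 := by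
  have h1 : ∑ j, ξ j ^ 2 = 1 := by
    have := EuclideanSpace.norm_sq_eq ξ
    rw [hξ] at this
    simpa using this.symm
  rw [WithLp.prod_norm_sq_eq_of_L2, PiLp.norm_sq_eq_of_L2]
  simp only [smoothPair_planeWave_snd, norm_smul, norm_mul, Complex.norm_real, Complex.norm_I,
    mul_one, mul_pow, Real.norm_eq_abs, sq_abs]
  rw [← Finset.sum_mul, ← Finset.mul_sum, h1]
  ring

/-- Membership would give φ a trace vanishing on Γ. The trace is unique, so it equals the
restriction of φ, which has no zeros. -/
theorem smoothPair_notMem_formDomain {Γ : Set E3} (hΓ : MeasurableSet Γ)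
    (hΓ0 : surfaceMeasure Ω Γ ≠ 0) {φ : smoothFunctions} (hφ : ∀ x, (φ : E3 → ℂ) x ≠ 0) :
    hΩ.smoothPair φ ∉ hΩ.formDomain Γ := by
  rintro ⟨⟨y, g⟩, ⟨hp, hg⟩, hy⟩
  obtain rfl : y = hΩ.smoothPair φ := hy
  obtain ⟨C, hC⟩ := hΩ.exists_norm_le_of_mem_traceGraph
  have hmem : (hΩ.smoothPair φ, hΩ.smoothTrace φ) ∈ hΩ.traceGraph := subset_closure ⟨φ, rfl⟩
  have h1 := hC _ (hΩ.traceGraph.sub_mem hp hmem)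
  rw [Prod.mk_sub_mk, sub_self, norm_zero, mul_zero, norm_le_zero_iff, sub_eq_zero] at h1
  have h2 := (mem_ker_LpToLpRestrictCLM_iff hΓ g).1 hg
  refine hΓ0 (measure_eq_zero_iff_ae_notMem.2 ?_)
  rw [h1] at h2
  filter_upwards [h2, hΩ.smoothTrace_ae φ] with x hx hx' hxΓ
  rw [hx'] at hx
  exact hφ x (hx hxΓ)

/-- Compact support is dispensable, because a cutoff equal to 1 on the closure of Ω changes neither
side. -/
theorem enorm_integral_fderiv_le_of_contDiff (hΩ : IsBoundedLipschitzDomain Ω) {ξ : E3}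
    (hξ : ‖ξ‖ = 1) {φ : E3 → ℂ} (hφ : ContDiff ℝ ∞ φ) {Z : Set E3} (hZm : MeasurableSet Z)
    (hZ : volume {x | ∃ z ∈ Z, ∃ s : ℝ, x = z + s • ξ} = 0) :
    ‖∫ x in Ω, fderiv ℝ φ x ξ‖ₑ ≤ 3 * ∫⁻ x in frontier Ω \ Z, ‖φ x‖ₑ
        ∂(Measure.hausdorffMeasure 2) := by
  obtain ⟨R, hR, hball⟩ := hΩ.isCompact_closure.isBounded.subset_closedBall_lt 0 0
  let χ : ContDiffBump (0 : E3) := ⟨R, R + 1, hR, by linarith⟩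
  have hχ : ∀ x ∈ closure Ω, χ x = 1 := fun x hx => χ.one_of_mem_closedBall (hball hx)
  have h := enorm_integral_fderiv_le hΩ.isOpen hΩ.isBounded
    hΩ.hausdorffMeasure_frontier_lt_top.ne hξ
    (φ := fun x => (χ x : ℂ) * φ x)
    ((Complex.ofRealCLM.contDiff.comp χ.contDiff).mul (hφ.of_le (by simp)))
    ((χ.hasCompactSupport.comp_left (g := fun t : ℝ => (t : ℂ)) (by simp)).mul_right) hZm hZ
  have h1 : ∫ x in Ω, fderiv ℝ (fun x => (χ x : ℂ) * φ x) x ξ = ∫ x in Ω, fderiv ℝ φ x ξ := by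
    refine setIntegral_congr_fun hΩ.isOpen.measurableSet fun x hx => ?_
    have : (fun x => (χ x : ℂ) * φ x) =ᶠ[𝓝 x] φ := by
      filter_upwards [hΩ.isOpen.mem_nhds hx] with y hy
      rw [hχ y (subset_closure hy)]
      simp
    change fderiv ℝ (fun x => (χ x : ℂ) * φ x) x ξ = fderiv ℝ φ x ξ
    rw [this.fderiv_eq]
  have h2 : ∫⁻ x in frontier Ω \ Z, ‖(χ x : ℂ) * φ x‖ₑ ∂(Measure.hausdorffMeasure 2) =
      ∫⁻ x in frontier Ω \ Z, ‖φ x‖ₑ ∂(Measure.hausdorffMeasure 2) := by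
    refine setLIntegral_congr_fun (isClosed_frontier.measurableSet.diff hZm) fun x hx => ?_
    rw [hχ x (frontier_subset_closure hx.1)]
    simp
  rwa [h1, h2] at h

/-- Cauchy–Schwarz on the finite surface measure. The L¹ boundary term of the divergence estimate
becomes continuous in the L² trace and so passes to closures. -/
theorem exists_setLIntegral_le_norm (hΩ : IsBoundedLipschitzDomain Ω) (Z : Set E3) :
    ∃ C : ℝ≥0, ∀ g : Lp ℂ 2 (surfaceMeasure Ω),
      ∫⁻ x in Zᶜ, ‖g x‖ₑ ∂(surfaceMeasure Ω) ≤
        C * ‖LpToLpRestrictCLM E3 ℂ ℂ (surfaceMeasure Ω) 2 Zᶜ g‖ₑ := by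
  have := hΩ.isFiniteMeasure_surfaceMeasure
  set μ := (surfaceMeasure Ω).restrict Zᶜ
  refine ⟨((μ Set.univ) ^ (1 / 2 : ℝ)).toNNReal, fun g => ?_⟩
  have h1 := eLpNorm_le_eLpNorm_mul_rpow_measure_univ (p := 1) (q := 2) (μ := μ) one_le_two
    ((Lp.memLp g).restrict Zᶜ).aestronglyMeasurable
  have h2 : ‖LpToLpRestrictCLM E3 ℂ ℂ (surfaceMeasure Ω) 2 Zᶜ g‖ₑ = eLpNorm g 2 μ := by
    rw [Lp.enorm_def]
    exact eLpNorm_congr_ae (LpToLpRestrictCLM_coeFn ℂ Zᶜ g)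
  rw [eLpNorm_one_eq_lintegral_enorm] at h1
  rw [h2, ENNReal.coe_toNNReal (ENNReal.rpow_ne_top_of_nonneg (by norm_num) (measure_ne_top _ _)),
    mul_comm]
  convert h1 using 3
  norm_num

/-- **Green's formula** for a plane wave whose direction of propagation is parallel to the planes
containing the Neumann part. -/
theorem inner_smoothPair_planeWave (hΩ : IsBoundedLipschitzDomain Ω) {Γ Z : Set E3} {ξ : E3}
    (hξ : ‖ξ‖ = 1) (hΓ : MeasurableSet Γ) (hZm : MeasurableSet Z)
    (hZ : volume {x | ∃ z ∈ Z, ∃ s : ℝ, x = z + s • ξ} = 0)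
    (hΓZ : ∀ᵐ x ∂(surfaceMeasure Ω), x ∈ Zᶜ → x ∈ Γ) (κ : ℝ) {x : SobolevPair Ω}
    (hx : x ∈ hΩ.formDomain Γ) :
    inner ℂ (hΩ.smoothPair (planeWave ξ κ)) x =
      ((1 + κ ^ 2 : ℝ) : ℂ) * inner ℂ (hΩ.smoothPair (planeWave ξ κ)).fst x.fst := by
  set e := hΩ.smoothPair (planeWave ξ κ) with he
  obtain ⟨C, hC⟩ := hΩ.exists_setLIntegral_le_norm Z
  -- The condition is closed, so smooth φ suffice. For these it is the divergence estimate applied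
  -- to φ times the conjugate wave, whose derivative along ξ has the two terms shown; the wave has
  -- modulus 1 and drops out of the boundary integral.
  have key : ∀ p ∈ hΩ.traceGraph,
      ‖∑ j, (ξ j : ℂ) * inner ℂ e.fst (p.1.snd j) - κ * Complex.I * inner ℂ e.fst p.1.fst‖ ≤
        3 * C * ‖LpToLpRestrictCLM E3 ℂ ℂ (surfaceMeasure Ω) 2 Zᶜ p.2‖ := by
    have hcl : IsClosed {p : SobolevPair Ω × Lp ℂ 2 (surfaceMeasure Ω) |
        ‖∑ j, (ξ j : ℂ) * inner ℂ e.fst (p.1.snd j) - κ * Complex.I * inner ℂ e.fst p.1.fst‖ ≤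
          3 * C * ‖LpToLpRestrictCLM E3 ℂ ℂ (surfaceMeasure Ω) 2 Zᶜ p.2‖} :=
      isClosed_le (by fun_prop) (by fun_prop)
    intro p hp
    refine closure_minimal ?_ hcl hp
    rintro _ ⟨φ, rfl⟩
    have hφ := contDiff_coe φ
    have hw := contDiff_coe (planeWave ξ κ)
    have hwc : ContDiff ℝ ∞ fun x => conj ((planeWave ξ κ : E3 → ℂ) x) :=
      Complex.conjCLE.contDiff.comp hw
    have h1 := hΩ.enorm_integral_fderiv_le_of_contDiff hξ (hφ.mul hwc) hZm hZ
    have h2 : ∫ x in Ω, fderiv ℝ (fun x => (φ : E3 → ℂ) x * conj ((planeWave ξ κ : E3 → ℂ) x)) x ξ =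
        ∑ j, (ξ j : ℂ) * inner ℂ e.fst ((hΩ.smoothPair φ).snd j) -
          κ * Complex.I * inner ℂ e.fst (hΩ.smoothPair φ).fst := by
      have hint : ∀ {f : E3 → ℂ}, Continuous f →
          Integrable (fun x => f x * conj ((planeWave ξ κ : E3 → ℂ) x)) (volume.restrict Ω) :=
        fun hf => (hΩ.memLp_volume hf).integrable_mul (hΩ.memLp_volume hwc.continuous)
      have hfst : inner ℂ e.fst (hΩ.smoothPair φ).fst =
          ∫ x in Ω, (φ : E3 → ℂ) x * conj ((planeWave ξ κ : E3 → ℂ) x) := by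
        rw [he, inner_smoothPair_fst]
        refine integral_congr_ae ?_
        filter_upwards [hΩ.smoothPair_fst_ae φ] with x hx
        rw [hx]
      have hsnd : ∀ j, inner ℂ e.fst ((hΩ.smoothPair φ).snd j) =
          ∫ x in Ω, partialDeriv j (φ : E3 → ℂ) x * conj ((planeWave ξ κ : E3 → ℂ) x) := by
        intro j
        rw [he, inner_smoothPair_fst]
        refine integral_congr_ae ?_
        filter_upwards [hΩ.smoothPair_snd_ae φ j] with x hx
        rw [hx]
      have hpt : ∀ x, fderiv ℝ (fun x => (φ : E3 → ℂ) x * conj ((planeWave ξ κ : E3 → ℂ) x)) x ξ =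
          ∑ j, (ξ j : ℂ) * (partialDeriv j (φ : E3 → ℂ) x * conj ((planeWave ξ κ : E3 → ℂ) x)) -
            κ * Complex.I * ((φ : E3 → ℂ) x * conj ((planeWave ξ κ : E3 → ℂ) x)) := by
        intro x
        have hconj : fderiv ℝ (fun x => conj ((planeWave ξ κ : E3 → ℂ) x)) x ξ =
            -(κ * Complex.I) * conj ((planeWave ξ κ : E3 → ℂ) x) := by
          have h := (Complex.conjCLE.toContinuousLinearMap.hasFDerivAt.comp x
            (hw.differentiable (by simp) x).hasFDerivAt).fderiv
          have h' : (⇑Complex.conjCLE.toContinuousLinearMap ∘ (planeWave ξ κ : E3 → ℂ)) =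
            fun y => conj ((planeWave ξ κ : E3 → ℂ) y) := rfl
          rw [h'] at h
          rw [h]
          change conj (fderiv ℝ (planeWave ξ κ : E3 → ℂ) x ξ) = _
          rw [fderiv_planeWave, real_inner_self_eq_norm_sq, hξ]
          simp
        rw [fderiv_fun_mul (hφ.differentiable (by simp) x) (hwc.differentiable (by simp) x)]
        simp only [add_apply, smul_apply, smul_eq_mul,
          hconj, fderiv_apply_eq_sum (φ : E3 → ℂ) x ξ, Finset.mul_sum]
        rw [add_comm, sub_eq_add_neg]
        congr 1
        · exact Finset.sum_congr rfl fun j _ => by ring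
        · ring
      simp only [hpt, hfst, hsnd]
      rw [integral_sub, integral_finsetSum]
      · simp only [integral_const_mul]
      · exact fun j _ => (hint (hφ.continuous_partialDeriv j)).const_mul _
      · exact integrable_finsetSum _ fun j _ => (hint (hφ.continuous_partialDeriv j)).const_mul _
      · exact (hint hφ.continuous).const_mul _
    have h3 : ∫⁻ x in frontier Ω \ Z, ‖(φ : E3 → ℂ) x * conj ((planeWave ξ κ : E3 → ℂ) x)‖ₑ
        ∂(Measure.hausdorffMeasure 2) ≤
        C * ‖LpToLpRestrictCLM E3 ℂ ℂ (surfaceMeasure Ω) 2 Zᶜ (hΩ.smoothTrace φ)‖ₑ := by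
      refine le_trans (le_of_eq ?_) (hC (hΩ.smoothTrace φ))
      have hμ : (surfaceMeasure Ω).restrict Zᶜ =
          (Measure.hausdorffMeasure 2 : Measure E3).restrict (frontier Ω \ Z) := by
        rw [surfaceMeasure, Measure.restrict_restrict hZm.compl, Set.inter_comm, ← Set.sdiff_eq]
      rw [← hμ]
      refine lintegral_congr_ae ?_
      filter_upwards [ae_restrict_of_ae (hΩ.smoothTrace_ae φ)] with x hx
      rw [hx, enorm_mul]
      have : ‖conj ((planeWave ξ κ : E3 → ℂ) x)‖ₑ = 1 := by
        rw [← ofReal_norm, RCLike.norm_conj, norm_planeWave, ENNReal.ofReal_one]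
      rw [this, mul_one]
    have h4 := h1.trans (mul_le_mul_right h3 3)
    rw [h2] at h4
    have h5 := ENNReal.toReal_mono (by finiteness) h4
    rw [ENNReal.toReal_mul, ENNReal.toReal_mul, toReal_enorm, toReal_enorm, ENNReal.coe_toReal,
      ENNReal.toReal_ofNat, ← mul_assoc] at h5
    exact h5
  obtain ⟨⟨y, g⟩, ⟨hp, hg⟩, rfl⟩ := hx
  have hg0 : LpToLpRestrictCLM E3 ℂ ℂ (surfaceMeasure Ω) 2 Zᶜ g = 0 := by
    rw [mem_ker_LpToLpRestrictCLM_iff hZm.compl]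
    filter_upwards [hΓZ, (mem_ker_LpToLpRestrictCLM_iff hΓ g).1 hg] with x h1 h2 h3
      using h2 (h1 h3)
  -- The trace of an element of the form domain vanishes almost everywhere off `Z`, so the estimate
  -- becomes an identity.
  have h1 := key _ hp
  rw [hg0, norm_zero, mul_zero, norm_le_zero_iff, sub_eq_zero] at h1
  -- Conjugation turns the factor iκ of the gradient of the wave into -iκ. Together with the factor
  -- iκ from `h1` it gives κ².
  have h2 : inner ℂ e.snd y.snd = -(κ * Complex.I) *
      ∑ j, (ξ j : ℂ) * inner ℂ e.fst (y.snd j) := by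
    rw [PiLp.inner_apply, Finset.mul_sum]
    refine Finset.sum_congr rfl fun j _ => ?_
    rw [he, smoothPair_planeWave_snd, inner_smul_left]
    simp
    ring
  change inner ℂ e y = ((1 + κ ^ 2 : ℝ) : ℂ) * inner ℂ e.fst y.fst
  rw [WithLp.prod_inner_apply]
  change inner ℂ e.fst y.fst + inner ℂ e.snd y.snd = _
  rw [h2, h1]
  push_cast
  linear_combination (-(κ : ℂ) ^ 2 * inner ℂ e.fst y.fst) * Complex.I_sq

end IsBoundedLipschitzDomain

end PlaneWave

/-! ### The eigenvalue inequality. -/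

theorem IsKthEigenvalue.nonneg_of_formGraph {Ω : Set E3} (hΩ : IsOpen Ω)
    {V : Submodule ℂ (SobolevPair Ω)} (hVc : IsClosed (V : Set (SobolevPair Ω)))
    (hV : V ≤ sobolevH1 Ω) {A : L2 Ω → L2 Ω → Prop} (hA : ∀ u f, A u f ↔ FormGraph V u f)
    {k : ℕ} (hk : 1 ≤ k) {l : ℝ} (h : IsKthEigenvalue A k l) : 0 ≤ l := by
  have : CompleteSpace V := hVc.completeSpace_coe
  have hk1 : (1 : Cardinal) ≤ k := by exact_mod_cast hk
  have h1 := h.1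
  rw [Set.mem_ofPred_eq, rank_spectralSpan hΩ hV hA] at h1
  have h2 : 1 ≤ 1 + l := one_le_of_one_le_rank_formSpan (V := V) (H := L2 Ω) (J := toL2 V)
    (fun v => norm_toL2_le V v) (hk1.trans h1)
  linarith

theorem corollary3p3 (Ω ΓD ΓN : Set E3) (hΩ : IsBoundedLipschitzDomain Ω)
    (hΓ : IsBoundaryDecomposition Ω ΓD ΓN)
    (H₁ H₂ : AffineSubspace ℝ E3) (P₁ P₂ : Set E3)
    (hP₁ : IsPlanePart Ω H₁ P₁) (hP₂ : IsPlanePart Ω H₂ P₂)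
    (hΓN : ΓN ⊆ P₁ ∪ P₂ ∪ parallelPlaneParts Ω H₁ ∪ parallelPlaneParts Ω H₂) :
    ∀ k : ℕ, 1 ≤ k → ∃ mu lam : ℝ,
      IsKthEigenvalue (NeumannLaplacian Ω) (k + 1) mu ∧
      IsKthEigenvalue (MixedLaplacian Ω ΓD ΓN) k lam ∧
      mu ≤ lam := by
  intro k hk
  set V := hΩ.formDomain ΓD with hV
  have hVH : V ≤ sobolevH1 Ω := hΩ.formDomain_le_sobolevH1 ΓD
  have hVc : IsClosed (V : Set (SobolevPair Ω)) := hΩ.isClosed_formDomain ΓD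
  have hcV : CompleteSpace V := hVc.completeSpace_coe
  have hcH : CompleteSpace (sobolevH1 Ω) := (isClosed_sobolevH1 Ω).completeSpace_coe
  have hDm := hΓ.relOpen_dirichlet.measurableSet
  obtain ⟨mu, hmu⟩ := hΩ.exists_isKthEigenvalue (isClosed_sobolevH1 Ω) le_rfl
    (fun φ _ => hΩ.smoothPair_mem_sobolevH1 φ) hΩ.neumannLaplacian_iff (k := k + 1) (by omega)
  obtain ⟨lam, hlam⟩ := hΩ.exists_isKthEigenvalue hVc hVH
    (fun φ hφ => hΩ.smoothPair_mem_formDomain φ hφ) (hΩ.mixedLaplacian_iff hΓ) hk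
  -- As `mu` is least, it remains to find at least k + 1 Neumann eigenvalues not exceeding `lam`.
  refine ⟨mu, lam, hmu, hlam, hmu.2 ?_⟩
  have hk' : (k : Cardinal) ≤ Module.rank ℂ (formSpan (V := V) (H := L2 Ω) (toL2 V) (1 + lam)) := by
    rw [← rank_spectralSpan hΩ.isOpen hVH (hΩ.mixedLaplacian_iff hΓ)]
    exact hlam.1
  have hlam0 : 0 ≤ lam :=
    hlam.nonneg_of_formGraph hΩ.isOpen hVc hVH (hΩ.mixedLaplacian_iff hΓ) hk
  obtain ⟨ξ, ⟨hξ₁, hξ₂⟩, hξ⟩ := exists_unit_vector_mem_inf hP₁.finrank_direction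
    hP₂.finrank_direction
  obtain ⟨n₁, hn₁, hn₁0⟩ := exists_ne_zero_mem_orthogonal hP₁.finrank_direction
  obtain ⟨n₂, hn₂, hn₂0⟩ := exists_ne_zero_mem_orthogonal hP₂.finrank_direction
  -- This set consists of whole planes parallel to ξ. It contains Γ_N, it is Lebesgue null, and
  -- sweeping along ξ does not enlarge it.
  set Z := heavyLevelPoints Ω n₁ ∪ heavyLevelPoints Ω n₂ with hZ
  have hZm : MeasurableSet Z :=
    (hΩ.measurableSet_heavyLevelPoints n₁).union (hΩ.measurableSet_heavyLevelPoints n₂)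
  have hZ0 : volume {x | ∃ z ∈ Z, ∃ s : ℝ, x = z + s • ξ} = 0 := by
    refine measure_mono_null ?_ (measure_union_null (hΩ.volume_heavyLevelPoints hn₁0)
      (hΩ.volume_heavyLevelPoints hn₂0))
    rintro _ ⟨z, hz, s, rfl⟩
    exact hz.imp (add_smul_mem_heavyLevelPoints ((Submodule.mem_orthogonal' _ _).1 hn₁ ξ hξ₁) s)
      (add_smul_mem_heavyLevelPoints ((Submodule.mem_orthogonal' _ _).1 hn₂ ξ hξ₂) s)
  have hNZ : ΓN ⊆ Z := by
    have h1 := parallelPlaneParts_subset_heavyLevelPoints (Ω := Ω) hn₁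
    have h2 := parallelPlaneParts_subset_heavyLevelPoints (Ω := Ω) hn₂
    refine hΓN.trans ?_
    refine Set.union_subset (Set.union_subset (Set.union_subset ?_ ?_) ?_) ?_
    · exact ((subset_parallelPlaneParts hP₁).trans h1).trans Set.subset_union_left
    · exact ((subset_parallelPlaneParts hP₂).trans h2).trans Set.subset_union_right
    · exact h1.trans Set.subset_union_left
    · exact h2.trans Set.subset_union_right
  have hDZ : ∀ᵐ x ∂(surfaceMeasure Ω), x ∈ Zᶜ → x ∈ ΓD := by
    have h1 : ∀ᵐ x ∂(surfaceMeasure Ω), x ∉ frontier Ω \ (ΓD ∪ ΓN) :=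
      measure_eq_zero_iff_ae_notMem.1 hΓ.null_remainder
    have h2 : ∀ᵐ x ∂(surfaceMeasure Ω), x ∈ frontier Ω :=
      ae_restrict_mem isClosed_frontier.measurableSet
    filter_upwards [h1, h2] with x hx hx' hxZ
    by_contra hD
    exact hx ⟨hx', fun h => h.elim hD fun hN => hxZ (hNZ hN)⟩
  -- With wave number √λ, the factor 1 + κ² of the plane wave matches the shifted level `1 + lam`.
  have hκ : Real.sqrt lam ^ 2 = lam := Real.sq_sqrt hlam0
  set w := planeWave ξ (Real.sqrt lam)
  set e : sobolevH1 Ω := ⟨hΩ.smoothPair w, hΩ.smoothPair_mem_sobolevH1 w⟩ with he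
  set ι : V →ₗ[ℂ] sobolevH1 Ω := Submodule.inclusion hVH
  -- The mixed spectral subspace is viewed inside H¹(Ω), since the plane wave lies outside the mixed
  -- form domain.
  set F := (formSpan (V := V) (H := L2 Ω) (toL2 V) (1 + lam)).map ι
  have hrank : Module.rank ℂ F =
      Module.rank ℂ (formSpan (V := V) (H := L2 Ω) (toL2 V) (1 + lam)) :=
    (LinearEquiv.rank_eq (Submodule.equivMapOfInjective ι
      (Submodule.inclusion_injective hVH) _)).symm
  have key := rank_add_one_le_rank_formSpan (V := sobolevH1 Ω) (H := L2 Ω)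
    (J := toL2 (sobolevH1 Ω)) (hΩ.isCompactOperator_toL2 le_rfl) (r := 1 + lam) (F := F) (e := e)
    ?_ ?_ ?_ ?_
  · rw [Set.mem_ofPred_eq, rank_spectralSpan hΩ.isOpen le_rfl hΩ.neumannLaplacian_iff]
    refine le_trans ?_ key
    rw [hrank]
    push_cast
    gcongr
  · rintro _ ⟨v, hv, rfl⟩
    exact norm_sq_le_of_mem_formSpan (V := V) (H := L2 Ω) (toL2 V) hv
  · have := hΩ.norm_sq_smoothPair_planeWave hξ (Real.sqrt lam)
    rw [hκ] at this
    exact this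
  · rintro _ ⟨v, hv, rfl⟩
    have := hΩ.inner_smoothPair_planeWave hξ hDm hZm hZ0 hDZ (Real.sqrt lam) v.2
    rw [hκ] at this
    exact this
  · rintro ⟨v, hv, hve⟩
    refine hΩ.smoothPair_notMem_formDomain hDm
      (hΩ.surfaceMeasure_ne_zero hΓ.relOpen_dirichlet hΓ.nonempty_dirichlet) (φ := w)
      (fun x h => ?_) ?_
    · have := norm_planeWave ξ (Real.sqrt lam) x
      rw [h] at this
      simp at this
    · have : (v : SobolevPair Ω) = hΩ.smoothPair w := congrArg Subtype.val hve
      rw [← this]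
      exact v.2
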